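/- Let $M$ be a connected smooth manifold without boundary (Hausdorff, second countable, of finite dimension), and let $h\in\Omega^2(M;\mathbb R)$ be a closed real 2-form on $M$. **The curved dg-category $\mathcal P(M)^{pre}[h]$.** Its objects are pairs $(E,\nabla^E)$ of a smooth real vector bundle $E\to M$ of finite rank and a connection $\nabla^E$ on $E$. The morphisms of degree $n$ are $\mathrm{Hom}^n(E,F)=\Omega^n(M,\mathrm{Hom}(E,F))$ (zero for $n<0$), and composition is the wedge product combined with composition of homomorphisms. Each morphism space carries the degree-one map $$\nabla f=\nabla^F\circ f-(-1)^{|f|}f\circ\nabla^E,$$ the exterior covariant derivative of the induced connection on $\mathrm{Hom}(E,F)$. The curvature of $E$ is $R_E=(\nabla^E)^2-h\cdot\mathrm{id}_E\in\mathrm{Hom}^2(E,E)$. Then $\nabla$ is a graded derivation, $\nabla^2f=R_F\circ f-f\circ R_E$ and $\nabla R_E=0$. **The dg-category $\mathcal P(M)^\infty[h]$.** It is the dg-category of twisted complexes over $\mathcal P(M)^{pre}[h]$. * Objects are pairs $(E^\bullet,\mathbb E)$, where $E^\bullet=(E^p)_{p\in\mathbb Z}$ is a family of objects of $\mathcal P(M)^{pre}[h]$,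 almost all of which are zero, and $\mathbb E$ is an endomorphism of $E^\bullet$ of total degree $1$ in the sense below. Its components $E^p\to E^p$ vanish, and it satisfies $\nabla\mathbb E+\mathbb E\circ\mathbb E+R_E=0$. Here $\nabla$ is applied to every component and $R_E$ is the diagonal endomorphism with entries $R_{E^p}$. * Morphisms of total degree $n$ are $$\mathrm{Hom}^n(E^\bullet,F^\bullet)=\bigoplus_{p\in\mathbb Z}\ \bigoplus_{a+b=n}\mathrm{Hom}^b(E^p,F^{p+a}),$$ where $a$ is the internal degree and $b$ the auxiliary degree. For components $g$ of bidegree $(a',b')$ and $f$ of bidegree $(a,b)$ the composition is $(-1)^{a'b}$ times their composition in $\mathcal P(M)^{pre}[h]$. * The differential of $f\colon(E^\bullet,\mathbb E)\to(F^\bullet,\mathbb F)$ is $df=\nabla f+\mathbb F\circ f-(-1)^{|f|}f\circ\mathbb E$. A dg-functor is a *quasi-equivalence* if it induces isomorphisms on the cohomology of all complexes of morphisms and every object of the target is homotopy equivalent (isomorphic in $H^0$) to an object in its image. The *zero dg-category* $0$ has one object, all of whose endomorphisms are zero. **Theorem.** 1. If $[h]=0$ in $H^2_{dR}(M,\mathbb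 R)$, then there is a quasi-equivalence $\mathcal P(M)^\infty[h]\to\mathcal P(M)^\infty[0]$. 2. If $[h]\neq0$ in $H^2_{dR}(M,\mathbb R)$, then there is a quasi-equivalence $\mathcal P(M)^\infty[h]\to0$. -/

import Mathlib

set_option linter.unusedSectionVars false
set_option linter.unusedVariables false
set_option linter.checkUnivs false

open scoped Manifold ContDiff

universe u v

noncomputable section

namespace DG

universe w u₁ v₁ u₂ v₂

/-- A `𝕜`-linear category with `ℤ`-graded modules of morphisms. In `comp h g f` the composite
is `g ∘ f`. -/
structure GradedCategory (𝕜 : Type w) [CommRing 𝕜] where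
  Obj : Type u₁
  Hom : Obj → Obj → ℤ → Type v₁
  [addCommGroup : ∀ E F n, AddCommGroup (Hom E F n)]
  [module : ∀ E F n, Module 𝕜 (Hom E F n)]
  comp : ∀ {E F G : Obj} {m n k : ℤ}, m + n = k → Hom F G m →ₗ[𝕜] Hom E F n →ₗ[𝕜] Hom E G k
  id : ∀ E, Hom E E 0
  comp_assoc : ∀ {E F G H : Obj} {l m n i j k : ℤ} (h₁ : l + m = i) (h₂ : i + n = k)
    (h₃ : m + n = j) (h₄ : l + j = k) (e : Hom G H l) (g : Hom F G m) (f : Hom E F n),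
    comp h₂ (comp h₁ e g) f = comp h₄ e (comp h₃ g f)
  id_comp : ∀ {E F : Obj} {n : ℤ} (h : 0 + n = n) (f : Hom E F n), comp h (id F) f = f
  comp_id : ∀ {E F : Obj} {n : ℤ} (h : n + 0 = n) (f : Hom E F n), comp h f (id E) = f

attribute [instance] GradedCategory.addCommGroup GradedCategory.module

/-- A zero object: an object whose identity vanishes. -/
def GradedCategory.IsZero {𝕜 : Type w} [CommRing 𝕜] (C : GradedCategory.{w, u₁, v₁} 𝕜)
    (E : C.Obj) : Prop := C.id E = 0

/-- A curved dg-category without conditions on degrees. -/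
structure CurvedCategory (𝕜 : Type w) [CommRing 𝕜] extends GradedCategory.{w, u₁, v₁} 𝕜 where
  nabla : ∀ {E F : Obj} {m n : ℤ}, m + 1 = n → Hom E F m →ₗ[𝕜] Hom E F n
  curv : ∀ E, Hom E E 2
  leibniz : ∀ {E F G : Obj} {m n k m' n' k' : ℤ} (h : m + n = k) (hm : m + 1 = m')
    (hn : n + 1 = n') (hk : k + 1 = k') (h₁ : m' + n = k') (h₂ : m + n' = k')
    (g : Hom F G m) (f : Hom E F n),
    nabla hk (comp h g f) = comp h₁ (nabla hm g) f + m.negOnePow • comp h₂ g (nabla hn f)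
  nabla_nabla : ∀ {E F : Obj} {m n k : ℤ} (h : m + 1 = n) (h' : n + 1 = k) (hl : 2 + m = k)
    (hr : m + 2 = k) (f : Hom E F m),
    nabla h' (nabla h f) = comp hl (curv F) f - comp hr f (curv E)
  nabla_curv : ∀ {k : ℤ} (h : 2 + 1 = k) (E : Obj), nabla h (curv E) = 0

/-- A non-negatively graded, pointed curved dg-category. -/
structure CDGCategory (𝕜 : Type w) [CommRing 𝕜] extends CurvedCategory.{w, u₁, v₁} 𝕜 where
  nonneg : ∀ (E F : Obj) (n : ℤ), n < 0 → Subsingleton (Hom E F n)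
  pointed : ∃ Z : Obj, toGradedCategory.IsZero Z

/-- A dg-category. -/
structure DGCategory (𝕜 : Type w) [CommRing 𝕜] extends GradedCategory.{w, u₁, v₁} 𝕜 where
  d : ∀ {E F : Obj} {m n : ℤ}, m + 1 = n → Hom E F m →ₗ[𝕜] Hom E F n
  d_comp : ∀ {E F G : Obj} {m n k m' n' k' : ℤ} (h : m + n = k) (hm : m + 1 = m')
    (hn : n + 1 = n') (hk : k + 1 = k') (h₁ : m' + n = k') (h₂ : m + n' = k')
    (g : Hom F G m) (f : Hom E F n),
    d hk (comp h g f) = comp h₁ (d hm g) f + m.negOnePow • comp h₂ g (d hn f)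
  d_d : ∀ {E F : Obj} {m n k : ℤ} (h : m + 1 = n) (h' : n + 1 = k) (f : Hom E F m),
    d h' (d h f) = 0

section Quasi

variable {𝕜 : Type w} [CommRing 𝕜]

namespace DGCategory

variable (C : DGCategory.{w, u₁, v₁} 𝕜)

/-- Closed morphisms of degree `n`. -/
def cocycles (E F : C.Obj) (n : ℤ) : Submodule 𝕜 (C.Hom E F n) :=
  LinearMap.ker (C.d (E := E) (F := F) (m := n) rfl)

/-- Exact morphisms of degree `n`. -/
def coboundaries (E F : C.Obj) (n : ℤ) : Submodule 𝕜 (C.Hom E F n) :=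
  LinearMap.range (C.d (E := E) (F := F) (sub_add_cancel n 1))

/-- The `n`-th cohomology of the complex of morphisms. -/
abbrev cohomology (E F : C.Obj) (n : ℤ) : Type _ :=
  C.cocycles E F n ⧸ (C.coboundaries E F n).submoduleOf (C.cocycles E F n)

/-- Two objects are homotopy equivalent, i.e. isomorphic in the homotopy category. -/
def HomotopyEquivalent (E F : C.Obj) : Prop :=
  ∃ (f : C.Hom E F 0) (g : C.Hom F E 0), f ∈ C.cocycles E F 0 ∧ g ∈ C.cocycles F E 0 ∧
    C.comp (add_zero 0) g f - C.id E ∈ C.coboundaries E E 0 ∧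
    C.comp (add_zero 0) f g - C.id F ∈ C.coboundaries F F 0

end DGCategory

/-- A dg-functor. -/
structure DGFunctor (C : DGCategory.{w, u₁, v₁} 𝕜) (D : DGCategory.{w, u₂, v₂} 𝕜) where
  obj : C.Obj → D.Obj
  map : ∀ {E F : C.Obj} {n : ℤ}, C.Hom E F n →ₗ[𝕜] D.Hom (obj E) (obj F) n
  map_id : ∀ E, map (C.id E) = D.id (obj E)
  map_comp : ∀ {E F G : C.Obj} {m n k : ℤ} (h : m + n = k) (g : C.Hom F G m) (f : C.Hom E F n),
    map (C.comp h g f) = D.comp h (map g) (map f)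
  map_d : ∀ {E F : C.Obj} {m n : ℤ} (h : m + 1 = n) (f : C.Hom E F m),
    map (C.d h f) = D.d h (map f)

namespace DGFunctor

variable {C : DGCategory.{w, u₁, v₁} 𝕜} {D : DGCategory.{w, u₂, v₂} 𝕜} (Φ : DGFunctor C D)

lemma map_mem_cocycles {E F : C.Obj} {n : ℤ} (f : C.Hom E F n) (hf : f ∈ C.cocycles E F n) :
    Φ.map f ∈ D.cocycles (Φ.obj E) (Φ.obj F) n := by
  rw [DGCategory.cocycles, LinearMap.mem_ker] at hf ⊢
  rw [← Φ.map_d, hf, map_zero]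

/-- The map induced on closed morphisms. -/
def mapCocycles (E F : C.Obj) (n : ℤ) :
    C.cocycles E F n →ₗ[𝕜] D.cocycles (Φ.obj E) (Φ.obj F) n :=
  Φ.map.restrict Φ.map_mem_cocycles

/-- The map induced on cohomology. -/
def mapCohomology (E F : C.Obj) (n : ℤ) :
    C.cohomology E F n →ₗ[𝕜] D.cohomology (Φ.obj E) (Φ.obj F) n :=
  Submodule.mapQ _ _ (Φ.mapCocycles E F n) (by
    rintro ⟨f, hf⟩ ⟨g, hg⟩
    exact ⟨Φ.map g, by rw [← Φ.map_d, hg]; rfl⟩)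

/-- A quasi-equivalence: quasi-fully faithful and quasi-essentially surjective. -/
structure IsQuasiEquivalence : Prop where
  bijective : ∀ (E F : C.Obj) (n : ℤ), Function.Bijective (Φ.mapCohomology E F n)
  essSurj : ∀ Y : D.Obj, ∃ X : C.Obj, D.HomotopyEquivalent (Φ.obj X) Y

end DGFunctor

/-- There is a quasi-equivalence of dg-categories. -/
def QuasiEquivalent (C : DGCategory.{w, u₁, v₁} 𝕜) (D : DGCategory.{w, u₂, v₂} 𝕜) : Prop :=
  ∃ Φ : DGFunctor C D, Φ.IsQuasiEquivalence

/-- The dg-category with one object and only the zero morphism. -/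
def zeroCategory (𝕜 : Type w) [CommRing 𝕜] : DGCategory.{w, 0, 0} 𝕜 where
  Obj := PUnit
  Hom := fun _ _ _ => PUnit
  comp := fun _ => 0
  id := fun _ => 0
  comp_assoc := fun _ _ _ _ _ _ _ => rfl
  id_comp := fun _ _ => rfl
  comp_id := fun _ _ => rfl
  d := fun _ => 0
  d_comp := fun _ _ _ _ _ _ _ _ => rfl
  d_d := fun _ _ _ => rfl

end Quasi

section Sequences

variable {𝕜 : Type w} [CommRing 𝕜]

lemma smul_map_unit {M N : Type*} [AddCommGroup M] [AddCommGroup N] [Module 𝕜 M] [Module 𝕜 N]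
    (φ : M →ₗ[𝕜] N) (u : ℤˣ) (x : M) : φ (u • x) = u • φ x := by
  simp only [Units.smul_def, map_zsmul]

lemma unit_smul_apply {M N : Type*} [AddCommGroup M] [AddCommGroup N] [Module 𝕜 M] [Module 𝕜 N]
    (φ : M →ₗ[𝕜] N) (u : ℤˣ) (x : M) : (u • φ) x = u • φ x := rfl

namespace GradedCategory

variable (C : GradedCategory.{w, u₁, v₁} 𝕜)

/-- Sequences of objects, almost all of which are zero. -/
structure Seq where
  obj : ℤ → C.Obj
  finite : {n | ¬ C.IsZero (obj n)}.Finite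

variable {C}

/-- Transport along an equality of degrees. -/
def degCast {E F : C.Obj} {m n : ℤ} (h : m = n) (f : C.Hom E F m) : C.Hom E F n := h ▸ f

lemma comp_degCast_left {E F G : C.Obj} {m m' n k : ℤ} (e : m = m') (h : m' + n = k)
    (h' : m + n = k) (g : C.Hom F G m) (f : C.Hom E F n) :
    C.comp h (degCast e g) f = C.comp h' g f := by subst e; rfl

lemma comp_degCast_right {E F G : C.Obj} {m n' n k : ℤ} (e : n = n') (h : m + n' = k)
    (h' : m + n = k) (g : C.Hom F G m) (f : C.Hom E F n) :
    C.comp h g (degCast e f) = C.comp h' g f := by subst e; rfl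

/-- Morphisms of total degree `n`: families of morphisms `E^p → F^q` of degree `n - (q - p)`. -/
abbrev SeqHom (E F : Seq C) (n : ℤ) : Type v₁ := ∀ p q : ℤ, C.Hom (E.obj p) (F.obj q) (n - (q - p))

/-- The morphism with given diagonal entries. -/
def diag {E : Seq C} {n : ℤ} (x : ∀ p, C.Hom (E.obj p) (E.obj p) n) : SeqHom E E n := fun p q =>
  if h : p = q then h ▸ degCast (show n = n - (p - p) by omega) (x p) else 0

lemma diag_self {E : Seq C} {n : ℤ} (x : ∀ p, C.Hom (E.obj p) (E.obj p) n) (p : ℤ) :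
    diag x p p = degCast (show n = n - (p - p) by omega) (x p) := by
  simp [diag]

lemma diag_ne {E : Seq C} {n : ℤ} (x : ∀ p, C.Hom (E.obj p) (E.obj p) n) {p q : ℤ} (h : p ≠ q) :
    diag x p q = 0 := by
  simp [diag, h]

lemma IsZero.to {E F : C.Obj} (h : C.IsZero F) {n : ℤ} (f : C.Hom E F n) : f = 0 := by
  rw [← C.id_comp (zero_add n) f, h]; simp

lemma IsZero.from {E F : C.Obj} (h : C.IsZero E) {n : ℤ} (f : C.Hom E F n) : f = 0 := by
  rw [← C.comp_id (add_zero n) f, h]; simp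

/-- Composition: the component `g^{q,r} ∘ f^{p,q}` carries the sign `(-1)^{a' b}`, where
`a' = r - q` is the internal degree of `g^{q,r}` and `b = n - (q - p)` is the auxiliary degree of
`f^{p,q}`. -/
def seqComp {E F G : Seq C} {m n k : ℤ} (h : m + n = k) :
    SeqHom F G m →ₗ[𝕜] SeqHom E F n →ₗ[𝕜] SeqHom E G k :=
  LinearMap.mk₂ 𝕜 (fun g f p r => ∑ q ∈ F.finite.toFinset,
      ((r - q) * (n - (q - p))).negOnePow •
        C.comp (show m - (r - q) + (n - (q - p)) = k - (r - p) by omega) (g q r) (f p q))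
    (fun g g' f => by
      funext p r
      simp only [Pi.add_apply, map_add, LinearMap.add_apply, smul_add, Finset.sum_add_distrib])
    (fun c g f => by
      funext p r
      simp only [Pi.smul_apply, map_smul, LinearMap.smul_apply, Finset.smul_sum]
      exact Finset.sum_congr rfl fun q _ => smul_comm _ _ _)
    (fun g f f' => by
      funext p r
      simp only [Pi.add_apply, map_add, smul_add, Finset.sum_add_distrib])
    (fun c g f => by
      funext p r
      simp only [Pi.smul_apply, map_smul, Finset.smul_sum]
      exact Finset.sum_congr rfl fun q _ => smul_comm _ _ _)

lemma seqComp_apply {E F G : Seq C} {m n k : ℤ} (h : m + n = k) (g : SeqHom F G m)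
    (f : SeqHom E F n) (p r : ℤ) :
    seqComp h g f p r = ∑ q ∈ F.finite.toFinset, ((r - q) * (n - (q - p))).negOnePow •
      C.comp (show m - (r - q) + (n - (q - p)) = k - (r - p) by omega) (g q r) (f p q) := rfl

lemma diag_seqComp {E F : Seq C} {m n k : ℤ} (h : m + n = k)
    (x : ∀ p, C.Hom (F.obj p) (F.obj p) m) (f : SeqHom E F n) (p r : ℤ) :
    seqComp h (diag x) f p r =
      C.comp (show m + (n - (r - p)) = k - (r - p) by omega) (x r) (f p r) := by
  rw [seqComp_apply, Finset.sum_eq_single r]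
  · rw [diag_self, comp_degCast_left (h' := show m + (n - (r - p)) = k - (r - p) by omega)]; simp
  · intro q _ hq
    rw [diag_ne x hq]; simp
  · intro hr
    rw [Set.Finite.mem_toFinset, Set.mem_ofPred_eq, not_not] at hr
    rw [hr.to (f p r)]; simp

lemma seqComp_diag {E F : Seq C} {m n k : ℤ} (h : m + n = k) (hn : Even n)
    (x : ∀ p, C.Hom (E.obj p) (E.obj p) n) (f : SeqHom E F m) (p r : ℤ) :
    seqComp h f (diag x) p r =
      C.comp (show (m - (r - p)) + n = k - (r - p) by omega) (f p r) (x p) := by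
  rw [seqComp_apply, Finset.sum_eq_single p]
  · rw [diag_self, comp_degCast_right, Int.negOnePow_even, one_smul]
    rw [sub_self, sub_zero]
    exact hn.mul_left _
  · intro q _ hq
    rw [diag_ne x hq.symm]; simp
  · intro hr
    rw [Set.Finite.mem_toFinset, Set.mem_ofPred_eq, not_not] at hr
    rw [hr.from (f p r)]; simp

lemma seqComp_assoc {E F G H : Seq C} {l m n i j k : ℤ} (h₁ : l + m = i) (h₂ : i + n = k)
    (h₃ : m + n = j) (h₄ : l + j = k) (e : SeqHom G H l) (g : SeqHom F G m) (f : SeqHom E F n) :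
    seqComp h₂ (seqComp h₁ e g) f = seqComp h₄ e (seqComp h₃ g f) := by
  funext p s
  simp only [seqComp_apply, map_sum, LinearMap.sum_apply, Finset.smul_sum, smul_map_unit,
    unit_smul_apply, smul_smul, ← Int.negOnePow_add]
  rw [Finset.sum_comm]
  refine Finset.sum_congr rfl fun r _ => Finset.sum_congr rfl fun q _ => ?_
  rw [C.comp_assoc _ _ (show m - (r - q) + (n - (q - p)) = j - (r - p) by omega) (by omega)]
  congr 2
  subst h₃
  ring

/-- Bounded sequences of objects as a graded category. -/
def seqCategory (C : GradedCategory.{w, u₁, v₁} 𝕜) : GradedCategory.{w, u₁, v₁} 𝕜 where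
  Obj := Seq C
  Hom := SeqHom
  comp := seqComp
  id := fun E => diag fun p => C.id (E.obj p)
  comp_assoc := seqComp_assoc
  id_comp := fun h f => by
    funext p r
    rw [diag_seqComp]
    exact C.id_comp (zero_add _) _
  comp_id := fun h f => by
    funext p r
    rw [seqComp_diag _ Even.zero]
    exact C.comp_id (add_zero _) _

end GradedCategory

namespace CurvedCategory

open GradedCategory

variable (C : CurvedCategory.{w, u₁, v₁} 𝕜)

lemma nabla_degCast {E F : C.Obj} {m m' n : ℤ} (e : m = m') (h : m' + 1 = n) (h' : m + 1 = n)
    (f : C.Hom E F m) : C.nabla h (degCast e f) = C.nabla h' f := by subst e; rfl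

/-- The connection, applied to every component. -/
def seqNabla {E F : Seq C.toGradedCategory} {m n : ℤ} (h : m + 1 = n) :
    SeqHom E F m →ₗ[𝕜] SeqHom E F n where
  toFun f p q := C.nabla (show m - (q - p) + 1 = n - (q - p) by omega) (f p q)
  map_add' f g := by funext p q; simp
  map_smul' c f := by funext p q; simp

lemma seqNabla_apply {E F : Seq C.toGradedCategory} {m n : ℤ} (h : m + 1 = n) (f : SeqHom E F m)
    (p q : ℤ) : C.seqNabla h f p q =
      C.nabla (show m - (q - p) + 1 = n - (q - p) by omega) (f p q) := rfl

lemma seqNabla_leibniz {E F G : Seq C.toGradedCategory} {m n k m' n' k' : ℤ} (h : m + n = k)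
    (hm : m + 1 = m') (hn : n + 1 = n') (hk : k + 1 = k') (h₁ : m' + n = k') (h₂ : m + n' = k')
    (g : SeqHom F G m) (f : SeqHom E F n) :
    C.seqNabla hk (seqComp h g f) = seqComp h₁ (C.seqNabla hm g) f +
      m.negOnePow • seqComp h₂ g (C.seqNabla hn f) := by
  funext p r
  rw [Pi.add_apply, Pi.add_apply, Pi.smul_apply, Pi.smul_apply]
  simp only [seqComp_apply, seqNabla_apply, map_sum, smul_map_unit, Finset.smul_sum,
    ← Finset.sum_add_distrib]
  refine Finset.sum_congr rfl fun q _ => ?_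
  rw [C.leibniz _ (show m - (r - q) + 1 = m' - (r - q) by omega)
    (show n - (q - p) + 1 = n' - (q - p) by omega) _ (by omega) (by omega), smul_add]
  simp only [smul_smul, ← Int.negOnePow_add]
  congr 2
  subst hn
  rw [Int.negOnePow_eq_iff]
  exact ⟨-(r - q), by ring⟩

lemma seqNabla_seqNabla {E F : Seq C.toGradedCategory} {m n k : ℤ} (h : m + 1 = n)
    (h' : n + 1 = k) (hl : 2 + m = k) (hr : m + 2 = k) (f : SeqHom E F m) :
    C.seqNabla h' (C.seqNabla h f) = seqComp hl (diag fun p => C.curv (F.obj p)) f -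
      seqComp hr f (diag fun p => C.curv (E.obj p)) := by
  funext p r
  rw [Pi.sub_apply, Pi.sub_apply, diag_seqComp, seqComp_diag _ (by decide), seqNabla_apply,
    seqNabla_apply, C.nabla_nabla]

lemma seqNabla_curv {k : ℤ} (h : 2 + 1 = k) (E : Seq C.toGradedCategory) :
    C.seqNabla h (diag fun p => C.curv (E.obj p)) = 0 := by
  funext p r
  rw [seqNabla_apply]
  by_cases hpr : p = r
  · subst hpr
    rw [diag_self, C.nabla_degCast (h' := show 2 + 1 = k - (p - p) by omega), C.nabla_curv]; rfl
  · rw [diag_ne _ hpr, map_zero]; rfl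

/-- Bounded sequences of objects as a curved category. -/
def seqCurved : CurvedCategory.{w, u₁, v₁} 𝕜 where
  toGradedCategory := seqCategory C.toGradedCategory
  nabla := C.seqNabla
  curv := fun E => diag fun p => C.curv (E.obj p)
  leibniz := C.seqNabla_leibniz
  nabla_nabla := C.seqNabla_seqNabla
  nabla_curv := C.seqNabla_curv

/-- Twisting of the differential by elements satisfying the Maurer-Cartan equation. -/
def twist {I : Type u₂} (base : I → C.Obj) (mc : ∀ i, C.Hom (base i) (base i) 1)
    (hmc : ∀ i, C.nabla (show (1 : ℤ) + 1 = 2 by norm_num) (mc i) +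
      C.comp (show (1 : ℤ) + 1 = 2 by norm_num) (mc i) (mc i) + C.curv (base i) = 0) :
    DGCategory.{w, u₂, v₁} 𝕜 where
  Obj := I
  Hom := fun i j => C.Hom (base i) (base j)
  comp := C.comp
  id := fun i => C.id (base i)
  comp_assoc := C.comp_assoc
  id_comp := C.id_comp
  comp_id := C.comp_id
  d := fun {i j m n} h => C.nabla h + C.comp (show 1 + m = n by omega) (mc j) -
    m.negOnePow • (C.comp h).flip (mc i)
  d_comp := fun {E F G m n k m' n' k'} h hm hn hk h₁ h₂ g f => by
    have hk2 : k.negOnePow = m.negOnePow * n.negOnePow := by rw [← h, Int.negOnePow_add]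
    simp only [LinearMap.sub_apply, LinearMap.add_apply, LinearMap.smul_apply,
      LinearMap.flip_apply, map_add, map_sub, smul_map_unit, smul_add, smul_sub,
      C.leibniz h hm hn hk h₁ h₂, hk2, mul_smul]
    rw [C.comp_assoc h hk hn h₂, C.comp_assoc hm h₁ (show 1 + n = n' by omega) h₂,
      C.comp_assoc (show 1 + m = m' by omega) h₁ h (by omega)]
    abel
  d_d := fun {E F m n k} h h' f => by
    have hs : n.negOnePow = -m.negOnePow := by rw [← h, Int.negOnePow_succ]
    have hF := congrArg (fun x => C.comp (show 2 + m = k by omega) x f) (hmc F)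
    have hE := congrArg (fun x => C.comp (show m + 2 = k by omega) f x) (hmc E)
    simp only [map_add, LinearMap.add_apply, map_zero, LinearMap.zero_apply] at hF hE
    simp only [LinearMap.sub_apply, LinearMap.add_apply, LinearMap.smul_apply,
      LinearMap.flip_apply, map_add, map_sub, smul_map_unit,
      C.nabla_nabla h h' (show 2 + m = k by omega) (show m + 2 = k by omega), hs]
    rw [C.leibniz (show 1 + m = n by omega) (show (1 : ℤ) + 1 = 2 by norm_num) h h'
        (show 2 + m = k by omega) (by omega),
      C.leibniz h h (show (1 : ℤ) + 1 = 2 by norm_num) h' h' (show m + 2 = k by omega),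
      C.comp_assoc (show 1 + m = n by omega) h' h (show 1 + n = k by omega),
      C.comp_assoc h h' (show (1 : ℤ) + 1 = 2 by norm_num) (show m + 2 = k by omega),
      ← C.comp_assoc (show (1 : ℤ) + 1 = 2 by norm_num) (show 2 + m = k by omega)
        (show 1 + m = n by omega)]
    rw [eq_neg_of_add_eq_zero_right hF, eq_neg_of_add_eq_zero_right hE, Int.negOnePow_one]
    rcases Int.units_eq_one_or m.negOnePow with e | e <;> rw [e] <;>
      simp only [Units.neg_smul, one_smul, neg_neg] <;> abel

end CurvedCategory

namespace CDGCategory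

open GradedCategory

variable (C : CDGCategory.{w, u₁, v₁} 𝕜)

/-- Twisted complexes: a bounded sequence of objects, with an endomorphism of total degree one
without part of internal degree zero, satisfying the Maurer-Cartan equation. -/
structure TwistedComplex where
  seq : C.seqCurved.Obj
  mc : C.seqCurved.Hom seq seq 1
  mc_diag : ∀ p : ℤ, mc p p = 0
  mc_eq : C.seqCurved.nabla (show (1 : ℤ) + 1 = 2 by norm_num) mc +
    C.seqCurved.comp (show (1 : ℤ) + 1 = 2 by norm_num) mc mc + C.seqCurved.curv seq = 0

/-- The dg-category of twisted complexes. -/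
def Tw : DGCategory.{w, max u₁ v₁, v₁} 𝕜 :=
  C.seqCurved.twist (I := C.TwistedComplex) (fun E => E.seq) (fun E => E.mc) (fun E => E.mc_eq)

end CDGCategory

end Sequences

end DG

namespace Cartan

section RawDefs

variable {A L W W₁ W₂ W₃ : Type*}

/-- Forms are handled as functions on lists of vectors of any length; see `Forms` for the official
notion. Interior product: `(ι_X φ)(v) = φ(X, v)`. -/
def rawIota (X : L) (φ : List L → W) : List L → W := fun v => φ (X :: v)

/-- Multiplication by `(-1)^k` in degree `k`. -/
def rawSign [AddCommGroup W] (φ : List L → W) : List L → W :=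
  fun v => (-1 : ℤ) ^ v.length • φ v

/-- Lie derivative along `X` with respect to `∇`:
`(L_X φ)(Y_1, …, Y_n) = ∇_X (φ(Y_1, …, Y_n)) - ∑ i, φ(Y_1, …, [X, Y_i], …, Y_n)`. -/
def rawLie [Bracket L L] [AddCommGroup W] (nab : L → W → W) (X : L) :
    (List L → W) → List L → W
  | φ, [] => nab X (φ [])
  | φ, Y :: v => rawLie nab X (rawIota Y φ) v - φ (⁅X, Y⁆ :: v)

/-- Exterior covariant derivative, by the formula `ι_X d = L_X - d ι_X`; for instance
`(dφ)(X) = ∇_X φ` and `(dφ)(X, Y) = ∇_X φ(Y) - ∇_Y φ(X) - φ([X, Y])`. -/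
def rawD [Bracket L L] [AddCommGroup W] (nab : L → W → W) : (List L → W) → List L → W
  | _, [] => 0
  | φ, X :: v => rawLie nab X φ v - rawD nab (rawIota X φ) v

/-- Wedge product with respect to a pairing `μ` of coefficients, by the formula
`ι_X (φ ∧ ψ) = ι_X φ ∧ ψ + (-1)^|φ| φ ∧ ι_X ψ`; for instance
`(φ ∧ ψ)(X, Y) = μ(φ(X), ψ(Y)) - μ(φ(Y), ψ(X))` for one-forms. -/
def rawWedge [AddCommGroup W₁] [AddCommGroup W₂] [AddCommGroup W₃]
    (μ : W₁ →+ W₂ →+ W₃) : (List L → W₁) → (List L → W₂) → List L → W₃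
  | φ, ψ, [] => μ (φ []) (ψ [])
  | φ, ψ, X :: v => rawWedge μ (rawIota X φ) ψ v + rawWedge μ (rawSign φ) (rawIota X ψ) v

/-- The operation `φ ↦ da ∧ φ` for a scalar `a`. -/
def rawDWedge [Bracket L A] [AddCommGroup W] [SMul A W] (a : A) : (List L → W) → List L → W
  | _, [] => 0
  | φ, X :: v => ⁅X, a⁆ • φ v - rawDWedge a (rawIota X φ) v

/-- Additivity, homogeneity and alternation at the position after `u`. -/
def FormLaws (A : Type*) [CommRing A] [AddCommGroup L] [Module A L] [AddCommGroup W]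
    [Module A W] (u : List L) (φ : List L → W) : Prop :=
  (∀ X Y v, φ (u ++ (X + Y) :: v) = φ (u ++ X :: v) + φ (u ++ Y :: v)) ∧
  (∀ (a : A) X v, φ (u ++ (a • X) :: v) = a • φ (u ++ X :: v)) ∧
  (∀ X v, φ (u ++ X :: X :: v) = 0)

/-- Alternating and `A`-multilinear. -/
def IsForm (A : Type*) [CommRing A] [AddCommGroup L] [Module A L] [AddCommGroup W]
    [Module A W] (φ : List L → W) : Prop := ∀ u, FormLaws A u φ

/-- The rules of a connection. -/
structure IsConn (A : Type*) [CommRing A] [LieRing L] [Module A L] [LieRingModule L A]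
    [AddCommGroup W] [Module A W] (nab : L → W → W) : Prop where
  add_vec : ∀ X Y w, nab (X + Y) w = nab X w + nab Y w
  smul_vec : ∀ (a : A) X w, nab (a • X) w = a • nab X w
  add : ∀ X w w', nab X (w + w') = nab X w + nab X w'
  smul : ∀ X (a : A) w, nab X (a • w) = a • nab X w + ⁅X, a⁆ • w

end RawDefs

section Sign

variable {L W W₁ W₂ W₃ : Type*} [AddCommGroup W]

lemma iota_sign (X : L) (φ : List L → W) : rawIota X (rawSign φ) = -rawSign (rawIota X φ) := by
  funext u; simp [rawSign, rawIota, pow_succ]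

lemma sign_sign (φ : List L → W) : rawSign (rawSign φ) = φ := by
  funext u
  simp only [rawSign, smul_smul, ← mul_pow]; simp

lemma sign_neg (φ : List L → W) : rawSign (-φ) = -rawSign φ := by
  funext u; simp [rawSign]
lemma sign_add (φ ψ : List L → W) : rawSign (φ + ψ) = rawSign φ + rawSign ψ := by
  funext u; simp [rawSign]
lemma sign_sub (φ ψ : List L → W) : rawSign (φ - ψ) = rawSign φ - rawSign ψ := by
  funext u; simp [rawSign, smul_sub]
lemma iota_add (X : L) (φ ψ : List L → W) : rawIota X (φ + ψ) = rawIota X φ + rawIota X ψ := rfl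
lemma iota_sub (X : L) (φ ψ : List L → W) : rawIota X (φ - ψ) = rawIota X φ - rawIota X ψ := rfl
lemma iota_neg (X : L) (φ : List L → W) : rawIota X (-φ) = -rawIota X φ := rfl
lemma iota_zero (X : L) : rawIota X (0 : List L → W) = 0 := rfl
lemma iota_smul {R : Type*} [SMul R W] (X : L) (a : R) (φ : List L → W) :
    rawIota X (a • φ) = a • rawIota X φ := rfl
lemma sign_smul {R : Type*} [Monoid R] [DistribMulAction R W] (a : R) (φ : List L → W) :
    rawSign (a • φ) = a • rawSign φ := by
  funext u; simp only [rawSign, Pi.smul_apply]; rw [smul_comm]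

end Sign

section Wedge

variable {L W₁ W₂ W₃ W₁₂ W₂₃ W : Type*} [AddCommGroup W₁] [AddCommGroup W₂] [AddCommGroup W₃]
  [AddCommGroup W₁₂] [AddCommGroup W₂₃] [AddCommGroup W] (μ : W₁ →+ W₂ →+ W₃)

lemma iota_wedge (X : L) (φ : List L → W₁) (ψ : List L → W₂) :
    rawIota X (rawWedge μ φ ψ) =
      rawWedge μ (rawIota X φ) ψ + rawWedge μ (rawSign φ) (rawIota X ψ) := rfl

lemma wedge_add_left (φ φ' : List L → W₁) (ψ : List L → W₂) :
    rawWedge μ (φ + φ') ψ = rawWedge μ φ ψ + rawWedge μ φ' ψ := by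
  funext v
  induction v generalizing φ φ' ψ with
  | nil => simp [rawWedge]
  | cons X v ih =>
    simp only [rawWedge, iota_add, sign_add, ih, Pi.add_apply]; abel

lemma wedge_add_right (φ : List L → W₁) (ψ ψ' : List L → W₂) :
    rawWedge μ φ (ψ + ψ') = rawWedge μ φ ψ + rawWedge μ φ ψ' := by
  funext v
  induction v generalizing φ ψ' ψ with
  | nil => simp [rawWedge]
  | cons X v ih =>
    simp only [rawWedge, iota_add, ih, Pi.add_apply]; abel

lemma wedge_neg_left (φ : List L → W₁) (ψ : List L → W₂) :
    rawWedge μ (-φ) ψ = -rawWedge μ φ ψ := by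
  funext v
  induction v generalizing φ ψ with
  | nil => simp [rawWedge]
  | cons X v ih =>
    simp only [rawWedge, iota_neg, sign_neg, ih, Pi.neg_apply]; abel

lemma wedge_neg_right (φ : List L → W₁) (ψ : List L → W₂) :
    rawWedge μ φ (-ψ) = -rawWedge μ φ ψ := by
  funext v
  induction v generalizing φ ψ with
  | nil => simp [rawWedge]
  | cons X v ih =>
    simp only [rawWedge, iota_neg, ih, Pi.neg_apply]; abel

lemma wedge_sub_left (φ φ' : List L → W₁) (ψ : List L → W₂) :
    rawWedge μ (φ - φ') ψ = rawWedge μ φ ψ - rawWedge μ φ' ψ := by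
  rw [sub_eq_add_neg, wedge_add_left, wedge_neg_left, sub_eq_add_neg]

lemma wedge_sub_right (φ : List L → W₁) (ψ ψ' : List L → W₂) :
    rawWedge μ φ (ψ - ψ') = rawWedge μ φ ψ - rawWedge μ φ ψ' := by
  rw [sub_eq_add_neg, wedge_add_right, wedge_neg_right, sub_eq_add_neg]

lemma wedge_zero_right (φ : List L → W₁) : rawWedge μ φ (0 : List L → W₂) = 0 := by
  simpa using wedge_sub_right μ φ 0 0

lemma wedge_zero_left (ψ : List L → W₂) : rawWedge μ (0 : List L → W₁) ψ = 0 := by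
  simpa using wedge_sub_left μ 0 0 ψ

lemma wedge_smul_left {R : Type*} [Monoid R] [DistribMulAction R W₁] [DistribMulAction R W₃]
    (hμ : ∀ (a : R) x y, μ (a • x) y = a • μ x y)
    (a : R) (φ : List L → W₁) (ψ : List L → W₂) :
    rawWedge μ (a • φ) ψ = a • rawWedge μ φ ψ := by
  funext v
  induction v generalizing φ ψ with
  | nil => simp [rawWedge, hμ]
  | cons X v ih =>
    simp only [rawWedge, iota_smul, sign_smul, ih, Pi.smul_apply, smul_add]

lemma wedge_smul_right {R : Type*} [Monoid R] [DistribMulAction R W₂] [DistribMulAction R W₃]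
    (hμ : ∀ (a : R) x y, μ x (a • y) = a • μ x y)
    (a : R) (φ : List L → W₁) (ψ : List L → W₂) :
    rawWedge μ φ (a • ψ) = a • rawWedge μ φ ψ := by
  funext v
  induction v generalizing φ ψ with
  | nil => simp [rawWedge, hμ]
  | cons X v ih =>
    simp only [rawWedge, iota_smul, ih, Pi.smul_apply, smul_add]

lemma sign_wedge (φ : List L → W₁) (ψ : List L → W₂) :
    rawSign (rawWedge μ φ ψ) = rawWedge μ (rawSign φ) (rawSign ψ) := by
  funext v
  induction v generalizing φ ψ with
  | nil => simp [rawWedge, rawSign]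
  | cons X v ih =>
    have h := congrFun (iota_sign X (rawWedge μ φ ψ)) v
    rw [iota_wedge, sign_add] at h
    simp only [rawIota, Pi.neg_apply, Pi.add_apply] at h
    rw [h]
    change -(rawSign (rawWedge μ (rawIota X φ) ψ) v +
      rawSign (rawWedge μ (rawSign φ) (rawIota X ψ)) v) = _
    rw [ih, ih, sign_sign]
    simp only [rawWedge, iota_sign, sign_sign, wedge_neg_left, wedge_neg_right, Pi.neg_apply]
    abel

lemma wedge_assoc (μ₁₂ : W₁ →+ W₂ →+ W₁₂) (ν : W₁₂ →+ W₃ →+ W)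
    (μ₂₃ : W₂ →+ W₃ →+ W₂₃) (ρ : W₁ →+ W₂₃ →+ W)
    (h : ∀ x y z, ν (μ₁₂ x y) z = ρ x (μ₂₃ y z))
    (φ : List L → W₁) (ψ : List L → W₂) (χ : List L → W₃) :
    rawWedge ν (rawWedge μ₁₂ φ ψ) χ = rawWedge ρ φ (rawWedge μ₂₃ ψ χ) := by
  funext v
  induction v generalizing φ ψ χ with
  | nil => simp [rawWedge, h]
  | cons X v ih =>
    simp only [rawWedge, iota_wedge, sign_wedge, wedge_add_left, wedge_add_right, ih,
      Pi.add_apply]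
    abel

/-- wedge with a form concentrated in degree zero -/
lemma wedge_deg_zero_left (φ : List L → W₁) (hφ : ∀ X, rawIota X φ = 0) (ψ : List L → W₂)
    (v : List L) : rawWedge μ φ ψ v = μ (φ []) (ψ v) := by
  have hs : rawSign φ = φ := by
    funext u
    cases u with
    | nil => simp [rawSign]
    | cons X u =>
      have := congrFun (hφ X) u
      simp only [rawIota, Pi.zero_apply] at this
      simp [rawSign, this]
  induction v generalizing ψ with
  | nil => rfl
  | cons X v ih => rw [rawWedge, hφ, wedge_zero_left, hs, ih]; simp [rawIota]

lemma wedge_deg_zero_right (φ : List L → W₁) (ψ : List L → W₂) (hψ : ∀ X, rawIota X ψ = 0)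
    (v : List L) : rawWedge μ φ ψ v = μ (φ v) (ψ []) := by
  induction v generalizing φ with
  | nil => rfl
  | cons X v ih => rw [rawWedge, hψ, wedge_zero_right, ih]; simp [rawIota]

/-- a central form of degree one anticommutes, one of degree two commutes -/
lemma wedge_comm_one (μ' : W₁₂ →+ W₁ →+ W₃) (f : List L → W₁) {α : List L → W₁₂}
    (h0 : α [] = 0) (h2 : ∀ X Y, rawIota Y (rawIota X α) = 0) {β : List L → W₂}
    (hβ0 : β [] = 0) (hβ2 : ∀ X Y, rawIota Y (rawIota X β) = 0)
    (hc : ∀ Y w, μ' (α [Y]) w = μ w (β [Y])) :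
    rawWedge μ' α f = rawWedge μ (rawSign f) β := by
  have hs : rawSign α = -α := by
    funext u
    match u with
    | [] => simp [rawSign, h0]
    | [Y] => simp [rawSign]
    | Y :: Z :: u =>
      have := congrFun (h2 Y Z) u
      simp only [rawIota, Pi.zero_apply] at this
      simp [rawSign, this]
  funext v
  induction v generalizing f with
  | nil => simp [rawWedge, h0, hβ0]
  | cons Y v ih =>
    rw [rawWedge, rawWedge, wedge_deg_zero_left _ _ (h2 Y), hs, wedge_neg_left, sign_sign,
      iota_sign, wedge_neg_left, wedge_deg_zero_right _ _ _ (hβ2 Y), Pi.neg_apply, Pi.neg_apply,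
      ih]
    simp only [rawIota, hc]
    abel

lemma wedge_comm_two (μ' : W₁₂ →+ W₁ →+ W₃) (f : List L → W₁) {α : List L → W₁₂}
    (h0 : α [] = 0) (h1 : ∀ X, α [X] = 0)
    (h3 : ∀ X Y Z, rawIota Z (rawIota Y (rawIota X α)) = 0) {β : List L → W₂}
    (hβ0 : β [] = 0) (hβ1 : ∀ X, β [X] = 0)
    (hβ3 : ∀ X Y Z, rawIota Z (rawIota Y (rawIota X β)) = 0)
    (hc : ∀ X Y w, μ' (α [X, Y]) w = μ w (β [X, Y])) :
    rawWedge μ' α f = rawWedge μ f β := by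
  have hs : rawSign α = α := by
    funext u
    match u with
    | [] => simp [rawSign]
    | [Y] => simp [rawSign, h1]
    | [Y, Z] => simp [rawSign]
    | Y :: Z :: T :: u =>
      have := congrFun (h3 Y Z T) u
      simp only [rawIota, Pi.zero_apply] at this
      simp [rawSign, this]
  funext v
  induction v generalizing f with
  | nil => simp [rawWedge, h0, hβ0]
  | cons X v ih =>
    rw [rawWedge, rawWedge, wedge_comm_one μ μ' f (β := rawIota X β) (h1 X) (h3 X) (hβ1 X) (hβ3 X)
      (hc X), hs, ih, add_comm]

end Wedge

section Form

variable {A L W W₁ W₂ W₃ : Type*} [CommRing A] [LieRing L] [Module A L]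
  [AddCommGroup W] [Module A W] [AddCommGroup W₁] [Module A W₁] [AddCommGroup W₂] [Module A W₂]
  [AddCommGroup W₃] [Module A W₃]

lemma FormLaws.plus {u : List L} {φ ψ : List L → W} (h : FormLaws A u φ) (h' : FormLaws A u ψ) :
    FormLaws A u (φ + ψ) := by
  obtain ⟨h1, h2, h3⟩ := h
  obtain ⟨k1, k2, k3⟩ := h'
  refine ⟨fun X Y v => ?_, fun a X v => ?_, fun X v => ?_⟩
  · simp only [Pi.add_apply, h1, k1]; abel
  · simp only [Pi.add_apply, h2, k2, smul_add]
  · simp only [Pi.add_apply, h3, k3, add_zero]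

lemma FormLaws.smulr {R : Type*} [Monoid R] [DistribMulAction R W] [SMulCommClass A R W]
    (c : R) {u : List L} {φ : List L → W} (h : FormLaws A u φ) :
    FormLaws A u (c • φ) := by
  obtain ⟨h1, h2, h3⟩ := h
  refine ⟨fun X Y v => ?_, fun a X v => ?_, fun X v => ?_⟩
  · simp only [Pi.smul_apply, h1, smul_add]
  · simp only [Pi.smul_apply, h2, smul_comm]
  · simp only [Pi.smul_apply, h3, smul_zero]

lemma FormLaws.minus {u : List L} {φ ψ : List L → W} (h : FormLaws A u φ) (h' : FormLaws A u ψ) :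
    FormLaws A u (φ - ψ) := by
  have := h.plus (h'.smulr (-1 : ℤ))
  rwa [neg_one_smul, ← sub_eq_add_neg] at this

lemma IsForm.iota {φ : List L → W} (h : IsForm A φ) (X : L) : IsForm A (rawIota X φ) :=
  fun u => h (X :: u)

lemma IsForm.iota_addv {φ : List L → W} (h : IsForm A φ) (X Y : L) :
    rawIota (X + Y) φ = rawIota X φ + rawIota Y φ := by
  funext v; exact (h []).1 X Y v

lemma IsForm.iota_smulv {φ : List L → W} (h : IsForm A φ) (a : A) (X : L) :
    rawIota (a • X) φ = a • rawIota X φ := by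
  funext v; exact (h []).2.1 a X v

lemma IsForm.iota_self {φ : List L → W} (h : IsForm A φ) (X : L) :
    rawIota X (rawIota X φ) = 0 := by
  funext v; exact (h []).2.2 X v

lemma IsForm.iota_zerov {φ : List L → W} (h : IsForm A φ) :
    rawIota 0 φ = 0 := by
  have := h.iota_smulv 0 0
  rwa [zero_smul, zero_smul] at this

lemma IsForm.iota_negv {φ : List L → W} (h : IsForm A φ) (X : L) :
    rawIota (-X) φ = -rawIota X φ := by
  have := h.iota_smulv (-1) X
  rwa [neg_one_smul, neg_one_smul] at this

lemma IsForm.iota_subv {φ : List L → W} (h : IsForm A φ) (X Y : L) :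
    rawIota (X - Y) φ = rawIota X φ - rawIota Y φ := by
  rw [sub_eq_add_neg, h.iota_addv, h.iota_negv, sub_eq_add_neg]

lemma IsForm.iota_swap {φ : List L → W} (h : IsForm A φ) (X Y : L) :
    rawIota X (rawIota Y φ) = -rawIota Y (rawIota X φ) := by
  have := h.iota_self (X + Y)
  rw [h.iota_addv, iota_add, (h.iota X).iota_addv, (h.iota Y).iota_addv, h.iota_self,
    h.iota_self, zero_add, add_zero] at this
  exact eq_neg_of_add_eq_zero_right this

lemma formLaws_nil {φ : List L → W} (h1 : ∀ X Y, rawIota (X + Y) φ = rawIota X φ + rawIota Y φ)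
    (h2 : ∀ (a : A) X, rawIota (a • X) φ = a • rawIota X φ)
    (h3 : ∀ X, rawIota X (rawIota X φ) = 0) : FormLaws A [] φ :=
  ⟨fun X Y v => congrFun (h1 X Y) v, fun a X v => congrFun (h2 a X) v,
    fun X v => congrFun (h3 X) v⟩

lemma formLaws_cons {φ : List L → W} {Z : L} {u : List L} (h : FormLaws A u (rawIota Z φ)) :
    FormLaws A (Z :: u) φ := h

lemma IsForm.sign {φ : List L → W} (h : IsForm A φ) : IsForm A (rawSign φ) := by
  intro u
  induction u generalizing φ with
  | nil =>
    refine formLaws_nil (fun X Y => ?_) (fun a X => ?_) (fun X => ?_)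
    · simp only [iota_sign, h.iota_addv, sign_add, neg_add]
    · simp only [iota_sign, h.iota_smulv, sign_smul, smul_neg]
    · simp only [iota_sign, iota_neg, h.iota_self, neg_neg]
      funext v; simp [rawSign]
  | cons Z u ih =>
    apply formLaws_cons
    rw [iota_sign, ← neg_one_smul ℤ]
    exact (ih (h.iota Z)).smulr _

lemma IsForm.wedge (μ : W₁ →+ W₂ →+ W₃) (hl : ∀ (a : A) x y, μ (a • x) y = a • μ x y)
    (hr : ∀ (a : A) x y, μ x (a • y) = a • μ x y) {φ : List L → W₁} {ψ : List L → W₂}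
    (h : IsForm A φ) (h' : IsForm A ψ) : IsForm A (rawWedge μ φ ψ) := by
  intro u
  induction u generalizing φ ψ with
  | nil =>
    refine formLaws_nil (fun X Y => ?_) (fun a X => ?_) (fun X => ?_)
    · simp only [iota_wedge, h.iota_addv, h'.iota_addv, wedge_add_left, wedge_add_right]; abel
    · simp only [iota_wedge, h.iota_smulv, h'.iota_smulv, wedge_smul_left μ hl,
        wedge_smul_right μ hr, smul_add]
    · simp only [iota_wedge, iota_add, h.iota_self, h'.iota_self, iota_sign, wedge_neg_left,
        wedge_zero_left, wedge_zero_right]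
      abel
  | cons Z u ih =>
    apply formLaws_cons
    rw [iota_wedge]
    exact (ih (h.iota Z) h').plus (ih h.sign (h'.iota Z))

end Form

section Lie

variable {A L W W₁ W₂ W₃ : Type*} [CommRing A] [LieRing L] [Module A L] [LieRingModule L A]
  [LieRinehartRing A L]
  [AddCommGroup W] [Module A W] [AddCommGroup W₁] [Module A W₁] [AddCommGroup W₂] [Module A W₂]
  [AddCommGroup W₃] [Module A W₃] {nab : L → W → W}

lemma iota_lie (X Y : L) (φ : List L → W) :
    rawIota Y (rawLie nab X φ) = rawLie nab X (rawIota Y φ) - rawIota ⁅X, Y⁆ φ := rfl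

lemma iota_d (X : L) (φ : List L → W) :
    rawIota X (rawD nab φ) = rawLie nab X φ - rawD nab (rawIota X φ) := rfl

lemma iota_dWedge (a : A) (X : L) (φ : List L → W) :
    rawIota X (rawDWedge a φ) = ⁅X, a⁆ • φ - rawDWedge a (rawIota X φ) := rfl

lemma IsConn.zero (hn : IsConn A nab) (X : L) : nab X 0 = 0 := by
  simpa using hn.add X 0 0

lemma IsConn.neg (hn : IsConn A nab) (X : L) (w : W) : nab X (-w) = -nab X w := by
  rw [eq_neg_iff_add_eq_zero, ← hn.add, neg_add_cancel, hn.zero]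

lemma IsConn.sub (hn : IsConn A nab) (X : L) (w w' : W) : nab X (w - w') = nab X w - nab X w' := by
  rw [sub_eq_add_neg, hn.add, hn.neg, sub_eq_add_neg]

lemma lie_add' (hn : IsConn A nab) (X : L) (φ ψ : List L → W) :
    rawLie nab X (φ + ψ) = rawLie nab X φ + rawLie nab X ψ := by
  funext v
  induction v generalizing φ ψ with
  | nil => simp [rawLie, hn.add]
  | cons Y v ih => simp only [rawLie, iota_add, ih, Pi.add_apply]; abel

lemma lie_zero' (hn : IsConn A nab) (X : L) : rawLie nab X (0 : List L → W) = 0 := by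
  simpa using lie_add' hn X 0 0

lemma lie_neg' (hn : IsConn A nab) (X : L) (φ : List L → W) :
    rawLie nab X (-φ) = -rawLie nab X φ := by
  rw [eq_neg_iff_add_eq_zero, ← lie_add' hn, neg_add_cancel, lie_zero' hn]

lemma lie_sub' (hn : IsConn A nab) (X : L) (φ ψ : List L → W) :
    rawLie nab X (φ - ψ) = rawLie nab X φ - rawLie nab X ψ := by
  rw [sub_eq_add_neg, lie_add' hn, lie_neg' hn, sub_eq_add_neg]

lemma lie_smul' (hn : IsConn A nab) (X : L) (a : A) (φ : List L → W) :
    rawLie nab X (a • φ) = a • rawLie nab X φ + ⁅X, a⁆ • φ := by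
  funext v
  induction v generalizing φ with
  | nil => simp [rawLie, hn.smul]
  | cons Y v ih =>
    simp only [rawLie, iota_smul, ih, Pi.add_apply, Pi.smul_apply, smul_sub, rawIota]; abel

lemma lie_smul_const {R : Type*} [Monoid R] [DistribMulAction R W] (X : L) (c : R)
    (hc : ∀ X w, nab X (c • w) = c • nab X w) (φ : List L → W) :
    rawLie nab X (c • φ) = c • rawLie nab X φ := by
  funext v
  induction v generalizing φ with
  | nil => simp [rawLie, hc]
  | cons Y v ih => simp only [rawLie, iota_smul, ih, Pi.smul_apply, smul_sub]

lemma lie_sign (hn : IsConn A nab) (X : L) (φ : List L → W) :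
    rawLie nab X (rawSign φ) = rawSign (rawLie nab X φ) := by
  funext v
  induction v generalizing φ with
  | nil => simp [rawLie, rawSign]
  | cons Y v ih =>
    have h := congrFun (iota_sign Y (rawLie nab X φ)) v
    rw [iota_lie, sign_sub] at h
    change rawSign (rawLie nab X φ) (Y :: v) = _ at h
    rw [h, rawLie, iota_sign, lie_neg' hn, Pi.neg_apply, ih]
    have h2 := congrFun (iota_sign ⁅X, Y⁆ φ) v
    change rawSign φ (⁅X, Y⁆ :: v) = _ at h2
    rw [h2]
    simp only [Pi.neg_apply, Pi.sub_apply]; abel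

lemma lie_addv (hn : IsConn A nab) {φ : List L → W} (h : IsForm A φ) (X Y : L) :
    rawLie nab (X + Y) φ = rawLie nab X φ + rawLie nab Y φ := by
  funext v
  induction v generalizing φ with
  | nil => simp [rawLie, hn.add_vec]
  | cons Z v ih =>
    have := congrFun (h.iota_addv ⁅X, Z⁆ ⁅Y, Z⁆) v
    simp only [rawIota, Pi.add_apply] at this
    simp only [rawLie, ih (h.iota Z), Pi.add_apply, add_lie, this]; abel

lemma IsForm.lie (hn : IsConn A nab) {φ : List L → W} (h : IsForm A φ) (X : L) :
    IsForm A (rawLie nab X φ) := by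
  intro u
  induction u generalizing φ with
  | nil =>
    refine formLaws_nil (fun Y Z => ?_) (fun a Y => ?_) (fun Y => ?_)
    · simp only [iota_lie, h.iota_addv, lie_add, lie_add' hn]; abel
    · simp only [iota_lie, h.iota_smulv, lie_smul' hn, LieRinehartRing.leibniz_smul_right,
        h.iota_addv, smul_sub]
      abel
    · simp only [iota_lie, iota_sub, h.iota_self, lie_zero' hn, h.iota_swap Y ⁅X, Y⁆]; abel
  | cons Z u ih =>
    apply formLaws_cons
    rw [iota_lie]
    exact (ih (h.iota Z)).minus (h.iota _ u)

lemma dWedge_neg (a : A) (φ : List L → W) : rawDWedge a (-φ) = -rawDWedge a φ := by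
  funext v
  induction v generalizing φ with
  | nil => simp [rawDWedge]
  | cons Y v ih => simp only [rawDWedge, iota_neg, ih, Pi.neg_apply, smul_neg]; abel

lemma lie_smulv (hn : IsConn A nab) {φ : List L → W} (h : IsForm A φ) (a : A) (X : L) :
    rawLie nab (a • X) φ = a • rawLie nab X φ + rawDWedge a (rawIota X φ) := by
  funext v
  induction v generalizing φ with
  | nil => simp [rawLie, hn.smul_vec, rawDWedge]
  | cons Y v ih =>
    have hb : ⁅a • X, Y⁆ = a • ⁅X, Y⁆ - ⁅Y, a⁆ • X := by
      rw [← lie_skew, LieRinehartRing.leibniz_smul_right, ← lie_skew X Y, smul_neg, neg_add,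
        sub_eq_add_neg]
    have h1 := congrFun (h.iota_subv (a • ⁅X, Y⁆) (⁅Y, a⁆ • X)) v
    rw [h.iota_smulv, h.iota_smulv] at h1
    simp only [rawLie, ih (h.iota Y), Pi.add_apply, Pi.smul_apply, hb, rawDWedge,
      h.iota_swap X Y, dWedge_neg, Pi.neg_apply, smul_sub]
    simp only [rawIota, Pi.sub_apply, Pi.smul_apply] at h1
    rw [h1]
    simp only [rawIota]
    abel

lemma d_add (hn : IsConn A nab) (φ ψ : List L → W) :
    rawD nab (φ + ψ) = rawD nab φ + rawD nab ψ := by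
  funext v
  induction v generalizing φ ψ with
  | nil => simp [rawD]
  | cons Y v ih => simp only [rawD, iota_add, lie_add' hn, ih, Pi.add_apply]; abel

lemma d_zero (hn : IsConn A nab) : rawD nab (0 : List L → W) = 0 := by
  simpa using d_add hn 0 0

lemma d_neg (hn : IsConn A nab) (φ : List L → W) :
    rawD nab (-φ) = -rawD nab φ := by
  rw [eq_neg_iff_add_eq_zero, ← d_add hn, neg_add_cancel, d_zero hn]

lemma d_sub (hn : IsConn A nab) (φ ψ : List L → W) :
    rawD nab (φ - ψ) = rawD nab φ - rawD nab ψ := by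
  rw [sub_eq_add_neg, d_add hn, d_neg hn, sub_eq_add_neg]

lemma d_smul_const {R : Type*} [Monoid R] [DistribMulAction R W] (c : R)
    (hc : ∀ X w, nab X (c • w) = c • nab X w) (φ : List L → W) :
    rawD nab (c • φ) = c • rawD nab φ := by
  funext v
  induction v generalizing φ with
  | nil => simp [rawD]
  | cons Y v ih =>
    simp only [rawD, iota_smul, ih, lie_smul_const _ c hc, Pi.smul_apply, smul_sub]

lemma d_smul (hn : IsConn A nab) (a : A) (φ : List L → W) :
    rawD nab (a • φ) = a • rawD nab φ + rawDWedge a φ := by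
  funext v
  induction v generalizing φ with
  | nil => simp [rawD, rawDWedge]
  | cons Y v ih =>
    simp only [rawD, rawDWedge, iota_smul, lie_smul' hn, ih, Pi.add_apply, Pi.smul_apply, smul_sub]
    abel

lemma IsForm.d (hn : IsConn A nab) {φ : List L → W} (h : IsForm A φ) :
    IsForm A (rawD nab φ) := by
  intro u
  induction u generalizing φ with
  | nil =>
    refine formLaws_nil (fun Y Z => ?_) (fun a Y => ?_) (fun Y => ?_)
    · simp only [iota_d, h.iota_addv, lie_addv hn h, d_add hn]; abel
    · simp only [iota_d, h.iota_smulv, lie_smulv hn h, d_smul hn, smul_sub]; abel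
    · simp only [iota_d, iota_sub, iota_lie, lie_self, h.iota_self, d_zero hn, h.iota_zerov]; abel
  | cons Z u ih =>
    apply formLaws_cons
    rw [iota_d]
    exact ((h.lie hn Z) u).minus (ih (h.iota Z))

lemma d_sign (hn : IsConn A nab) (φ : List L → W) :
    rawD nab (rawSign φ) = -rawSign (rawD nab φ) := by
  funext v
  induction v generalizing φ with
  | nil => simp [rawD, rawSign]
  | cons Y v ih =>
    have h := congrFun (iota_sign Y (rawD nab φ)) v
    rw [iota_d, sign_sub] at h
    change rawSign (rawD nab φ) (Y :: v) = _ at h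
    rw [Pi.neg_apply, h, rawD, iota_sign, d_neg hn, Pi.neg_apply, ih, lie_sign hn]
    simp only [Pi.neg_apply, Pi.sub_apply]; abel

lemma lie_wedge {nab₁ : L → W₁ → W₁} {nab₂ : L → W₂ → W₂} {nab₃ : L → W₃ → W₃}
    (h1 : IsConn A nab₁) (h3 : IsConn A nab₃) (μ : W₁ →+ W₂ →+ W₃)
    (hμ : ∀ X x y, nab₃ X (μ x y) = μ (nab₁ X x) y + μ x (nab₂ X y)) (X : L)
    (φ : List L → W₁) (ψ : List L → W₂) :
    rawLie nab₃ X (rawWedge μ φ ψ) =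
      rawWedge μ (rawLie nab₁ X φ) ψ + rawWedge μ φ (rawLie nab₂ X ψ) := by
  funext v
  induction v generalizing φ ψ with
  | nil => simp [rawLie, rawWedge, hμ]
  | cons Y v ih =>
    simp only [rawLie, iota_wedge, lie_add' h3, Pi.add_apply, ih, rawWedge, iota_lie,
      wedge_sub_left, wedge_sub_right, lie_sign h1, Pi.sub_apply]
    abel

lemma d_wedge {nab₁ : L → W₁ → W₁} {nab₂ : L → W₂ → W₂} {nab₃ : L → W₃ → W₃}
    (h1 : IsConn A nab₁) (h3 : IsConn A nab₃) (μ : W₁ →+ W₂ →+ W₃)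
    (hμ : ∀ X x y, nab₃ X (μ x y) = μ (nab₁ X x) y + μ x (nab₂ X y))
    (φ : List L → W₁) (ψ : List L → W₂) :
    rawD nab₃ (rawWedge μ φ ψ) =
      rawWedge μ (rawD nab₁ φ) ψ + rawWedge μ (rawSign φ) (rawD nab₂ ψ) := by
  funext v
  induction v generalizing φ ψ with
  | nil => simp [rawD, rawWedge]
  | cons X v ih =>
    simp only [rawD, iota_wedge, d_add h3, Pi.add_apply, ih, rawWedge, iota_d, lie_wedge h1 h3 μ hμ,
      wedge_sub_left, wedge_sub_right, d_sign h1, iota_sign, sign_sign, wedge_neg_left,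
      Pi.sub_apply, Pi.neg_apply]
    abel

/-- Curvature operator. -/
def curvAt (nab : L → W → W) (X Y : L) (w : W) : W :=
  nab X (nab Y w) - nab Y (nab X w) - nab ⁅X, Y⁆ w

/-- Auxiliary description of `L_X d - d L_X`. -/
def rawCurvOne (K : L → W → W) : (List L → W) → List L → W
  | _, [] => 0
  | φ, Y :: v => K Y (φ v) - rawCurvOne K (rawIota Y φ) v

/-- Auxiliary description of `d ∘ d`. -/
def rawCurv (K : L → L → W → W) : (List L → W) → List L → W
  | _, [] => 0
  | φ, X :: v => rawCurvOne (K X) φ v + rawCurv K (rawIota X φ) v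

lemma lie_lie' (hn : IsConn A nab) {φ : List L → W} (h : IsForm A φ) (X Y : L) (v : List L) :
    rawLie nab X (rawLie nab Y φ) v - rawLie nab Y (rawLie nab X φ) v - rawLie nab ⁅X, Y⁆ φ v =
      curvAt nab X Y (φ v) := by
  induction v generalizing φ with
  | nil => simp [rawLie, curvAt]
  | cons Z v ih =>
    have hj : ⁅⁅X, Y⁆, Z⁆ = ⁅X, ⁅Y, Z⁆⁆ - ⁅Y, ⁅X, Z⁆⁆ := by
      rw [lie_lie]
    have h1 := congrFun (h.iota_subv ⁅X, ⁅Y, Z⁆⁆ ⁅Y, ⁅X, Z⁆⁆) v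
    rw [← hj] at h1
    simp only [rawIota, Pi.sub_apply] at h1
    have h2 := ih (h.iota Z)
    simp only [rawLie, iota_lie, lie_sub' hn, Pi.sub_apply, h1]
    simp only [rawIota] at h2 ⊢
    rw [← h2]
    abel

lemma lie_d (hn : IsConn A nab) {φ : List L → W} (h : IsForm A φ) (X : L) :
    rawLie nab X (rawD nab φ) - rawD nab (rawLie nab X φ) = rawCurvOne (curvAt nab X) φ := by
  funext v
  induction v generalizing φ with
  | nil => simp [rawLie, rawD, rawCurvOne, hn.zero]
  | cons Y v ih =>
    have h2 := ih (h.iota Y)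
    have h1 := lie_lie' hn h X Y v
    simp only [rawCurvOne, ← h1, ← h2, Pi.sub_apply]
    simp only [rawLie, rawD, iota_d, iota_lie, lie_sub' hn, d_sub hn, Pi.sub_apply]
    abel

lemma d_d (hn : IsConn A nab) {φ : List L → W} (h : IsForm A φ) :
    rawD nab (rawD nab φ) = rawCurv (curvAt nab) φ := by
  funext v
  induction v generalizing φ with
  | nil => simp [rawD, rawCurv]
  | cons X v ih =>
    have h1 := congrFun (lie_d hn h X) v
    rw [Pi.sub_apply] at h1
    rw [rawCurv, ← ih (h.iota X), ← h1, rawD, iota_d, d_sub hn, Pi.sub_apply]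
    abel

lemma d_d_flat (hn : IsConn A nab) (hK : ∀ X Y w, curvAt nab X Y w = 0) {φ : List L → W}
    (h : IsForm A φ) : rawD nab (rawD nab φ) = 0 := by
  have h1 : ∀ X v (φ : List L → W), rawCurvOne (curvAt nab X) φ v = 0 := by
    intro X v
    induction v with
    | nil => intro φ; rfl
    | cons Y v ih => intro φ; simp [rawCurvOne, hK, ih]
  rw [d_d hn h]
  funext v
  clear h
  induction v generalizing φ with
  | nil => rfl
  | cons Y v ih => simp [rawCurv, h1, ih]

/-- the operator `rawCurv` of a two-form valued in endomorphisms acting on both sides -/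
lemma rawCurv_eq_wedge (μ₁ : W₁ →+ W →+ W) (μ₂ : W →+ W₂ →+ W) {R₁ : List L → W₁}
    {R₂ : List L → W₂}
    (h0 : R₁ [] = 0) (h1 : ∀ X, R₁ [X] = 0)
    (h3 : ∀ X Y Z, rawIota Z (rawIota Y (rawIota X R₁)) = 0)
    (k0 : R₂ [] = 0) (k1 : ∀ X, R₂ [X] = 0)
    (k3 : ∀ X Y Z, rawIota Z (rawIota Y (rawIota X R₂)) = 0)
    {K : L → L → W → W} (hK : ∀ X Y w, K X Y w = μ₁ (R₁ [X, Y]) w - μ₂ w (R₂ [X, Y]))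
    (φ : List L → W) :
    rawCurv K φ = rawWedge μ₁ R₁ φ - rawWedge μ₂ φ R₂ := by
  have hs : rawSign R₁ = R₁ := by
    funext u
    match u with
    | [] => simp [rawSign]
    | [Y] => simp [rawSign, h1]
    | [Y, Z] => simp [rawSign]
    | Y :: Z :: T :: u =>
      have := congrFun (h3 Y Z T) u
      simp only [rawIota, Pi.zero_apply] at this
      simp [rawSign, this]
  have hs1 : ∀ X, rawSign (rawIota X R₁) = -rawIota X R₁ := by
    intro X
    have := iota_sign X R₁
    rw [hs] at this
    exact (neg_eq_iff_eq_neg.mpr this).symm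
  have hT : ∀ X φ, rawCurvOne (K X) φ =
      rawWedge μ₁ (rawIota X R₁) φ - rawWedge μ₂ (rawSign φ) (rawIota X R₂) := by
    intro X φ
    funext v
    induction v generalizing φ with
    | nil => simp [rawCurvOne, rawWedge, rawIota, h1, k1]
    | cons Y v ih =>
      rw [rawCurvOne, ih, hK]
      simp only [Pi.sub_apply]
      rw [rawWedge, rawWedge, wedge_deg_zero_left _ _ (h3 X Y), hs1, wedge_neg_left, sign_sign,
        iota_sign, wedge_neg_left, wedge_deg_zero_right _ _ _ (k3 X Y)]
      simp only [rawIota, Pi.neg_apply]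
      abel
  funext v
  induction v generalizing φ with
  | nil => simp [rawCurv, rawWedge, h0, k0]
  | cons X v ih =>
    rw [rawCurv, ih, hT]
    simp only [Pi.sub_apply]
    rw [rawWedge, rawWedge, hs]
    abel

end Lie

section Conc

variable {A L W W₁ W₂ W₃ : Type*} [CommRing A] [LieRing L] [Module A L] [LieRingModule L A]
  [LieRinehartRing A L]
  [AddCommGroup W] [Module A W] [AddCommGroup W₁] [AddCommGroup W₂]
  [AddCommGroup W₃] {nab : L → W → W}

/-- concentrated in degree `k` -/
def Conc (k : ℤ) (φ : List L → W) : Prop := ∀ v, (v.length : ℤ) ≠ k → φ v = 0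

lemma Conc.iota {k : ℤ} {φ : List L → W} (h : Conc k φ) (X : L) : Conc (k - 1) (rawIota X φ) := by
  intro v hv
  apply h
  simp only [List.length_cons, Nat.cast_add, Nat.cast_one]
  omega

lemma Conc.sign_eq {k : ℤ} {φ : List L → W} (h : Conc k φ) : rawSign φ = k.negOnePow • φ := by
  funext v
  by_cases hv : (v.length : ℤ) = k
  · subst hv
    simp only [rawSign, Pi.smul_apply, Int.negOnePow_def, zpow_natCast, Units.smul_def]
    push_cast
    rfl
  · simp [rawSign, h v hv]

lemma Conc.sign {k : ℤ} {φ : List L → W} (h : Conc k φ) : Conc k (rawSign φ) := by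
  intro v hv
  simp [rawSign, h v hv]

lemma Conc.wedge {m n k : ℤ} (hk : m + n = k) (μ : W₁ →+ W₂ →+ W₃) {φ : List L → W₁}
    {ψ : List L → W₂} (h : Conc m φ) (h' : Conc n ψ) : Conc k (rawWedge μ φ ψ) := by
  intro v hv
  induction v generalizing φ ψ m n k with
  | nil =>
    by_cases hm : 0 = m
    · by_cases hn : 0 = n
      · simp only [List.length_nil, Nat.cast_zero] at hv; omega
      · simp [rawWedge, h' [] (by simpa using hn)]
    · simp [rawWedge, h [] (by simpa using hm)]
  | cons X v ih =>
    simp only [List.length_cons, Nat.cast_add, Nat.cast_one] at hv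
    rw [rawWedge, ih (k := k - 1) (by omega) (h.iota X) h' (by omega),
      ih (k := k - 1) (by omega) h.sign (h'.iota X) (by omega), add_zero]

lemma Conc.lie {k : ℤ} (hn : IsConn A nab) (X : L) {φ : List L → W} (h : Conc k φ) :
    Conc k (rawLie nab X φ) := by
  intro v hv
  induction v generalizing φ k with
  | nil => simp [rawLie, h [] hv, hn.zero]
  | cons Y v ih =>
    have hv' := hv
    simp only [List.length_cons, Nat.cast_add, Nat.cast_one] at hv
    rw [rawLie, ih (h.iota Y) (by omega), h _ (by simpa using hv'), sub_zero]

lemma Conc.d {k l : ℤ} (hl : k + 1 = l) (hn : IsConn A nab) {φ : List L → W} (h : Conc k φ) :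
    Conc l (rawD nab φ) := by
  intro v hv
  induction v generalizing φ k l with
  | nil => rfl
  | cons Y v ih =>
    simp only [List.length_cons, Nat.cast_add, Nat.cast_one] at hv
    rw [rawD, h.lie hn Y v (by omega), ih (l := l - 1) (by omega) (h.iota Y) (by omega), sub_zero]

end Conc

section Official

variable (A L W : Type*) [CommRing A] [LieRing L] [Module A L] [AddCommGroup W] [Module A W]

/-- Families, indexed by `n`, of alternating `A`-multilinear maps `L × ⋯ × L → W` of `n` variables. -/
abbrev Forms : Type _ := ∀ n : ℕ, L [⋀^Fin n]→ₗ[A] W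

variable {A L W}

/-- Evaluation of a family of alternating maps on lists of vectors of any length. -/
def Forms.ev (f : Forms A L W) (v : List L) : W := f v.length v.get

lemma Forms.ev_ofFn (f : Forms A L W) {n : ℕ} (v : Fin n → L) : f.ev (List.ofFn v) = f n v := by
  have : ∀ (m : ℕ) (hm : m = n) (w : Fin m → L), (∀ i, w i = v (Fin.cast hm i)) →
      f m w = f n v := by
    rintro m rfl w hw
    congr 1
    funext i
    exact hw i
  exact this _ (List.length_ofFn) _ (fun i => by simp; rfl)

lemma Forms.ext_ev {f g : Forms A L W} (h : f.ev = g.ev) : f = g := by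
  funext n
  ext v
  rw [← f.ev_ofFn, ← g.ev_ofFn, h]

lemma Forms.ev_eq (f : Forms A L W) {n : ℕ} (v : List L) (hv : v.length = n) :
    f.ev v = f n (fun i => v.get (i.cast hv.symm)) := by
  subst hv; rfl

lemma Forms.isForm (f : Forms A L W) : IsForm A f.ev := by
  have key : ∀ (u v : List L) (X : L), f.ev (u ++ X :: v) =
      f (u ++ (0 : L) :: v).length (Function.update (u ++ (0 : L) :: v).get
        ⟨u.length, by simp⟩ X) := by
    intro u v X
    rw [f.ev_eq _ (n := (u ++ (0 : L) :: v).length) (by simp)]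
    congr 1
    funext i
    simp only [List.get_eq_getElem, Fin.val_cast]
    by_cases hi : i = ⟨u.length, by simp⟩
    · subst hi; simp
    · rw [Function.update_of_ne hi]
      have hi' : (i : ℕ) ≠ u.length := fun h => hi (Fin.ext h)
      rcases lt_or_gt_of_ne hi' with h | h
      · simp [List.getElem_append_left h]
      · obtain ⟨k, hk⟩ : ∃ k, (i : ℕ) = u.length + (k + 1) := ⟨i - u.length - 1, by omega⟩
        simp only [List.get_eq_getElem, hk]
        rw [List.getElem_append_right (by omega), List.getElem_append_right (by omega)]
        simp
  intro u
  refine ⟨fun X Y v => ?_, fun a X v => ?_, fun X v => ?_⟩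
  · rw [key, key, key, (f _).map_update_add]
  · rw [key, key, (f _).map_update_smul]
  · refine (f _).map_eq_zero_of_eq _ (i := ⟨u.length, by simp⟩) (j := ⟨u.length + 1, by simp⟩) ?_ ?_
    · simp [List.getElem_append_right]
    · simp

lemma IsForm.swap' {φ : List L → W} (h : IsForm A φ) (u : List L) (X Y : L) (v : List L) :
    φ (u ++ X :: Y :: v) = -φ (u ++ Y :: X :: v) := by
  induction u generalizing φ with
  | nil => exact congrFun (h.iota_swap Y X) v
  | cons Z u ih => exact ih (h.iota Z)

lemma IsForm.alt' {φ : List L → W} (h : IsForm A φ) (X : L) (v : List L) (u w : List L) :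
    φ (u ++ X :: (v ++ X :: w)) = 0 := by
  induction v generalizing u with
  | nil => exact (h u).2.2 X w
  | cons Y v ih =>
    rw [List.cons_append, h.swap']
    have := ih (u ++ [Y])
    rw [List.append_assoc] at this
    simpa using this

/-- Converse of `Forms.ev`. -/
def ofRaw (φ : List L → W) (h : IsForm A φ) : Forms A L W := fun n =>
  have key : ∀ (v : Fin n → L) (i : Fin n) (x : L), List.ofFn (Function.update v i x) =
      (List.ofFn v).take i ++ x :: (List.ofFn v).drop (i + 1) := by
    intro v i x
    have hi : (i : ℕ) < (List.ofFn v).length := by simp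
    have hset := List.set_eq_take_append_cons_drop (l := List.ofFn v) (i := i) (a := x)
    rw [if_pos hi] at hset
    rw [← hset]
    apply List.ext_getElem
    · simp
    · intro k h1 h2
      rw [List.getElem_set]
      simp only [List.getElem_ofFn, Function.update_apply, Fin.ext_iff]
      simp only [eq_comm]
  { toFun := fun v => φ (List.ofFn v)
    map_update_add' := by
      intro inst v i x y
      have : inst = instDecidableEqFin n := Subsingleton.elim _ _
      subst this
      rw [key, key, key, (h _).1]
    map_update_smul' := by
      intro inst v i a x
      have : inst = instDecidableEqFin n := Subsingleton.elim _ _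
      subst this
      rw [key, key, (h _).2.1]
    map_eq_zero_of_eq' := by
      intro v i j hv hij
      wlog hlt : i < j generalizing i j
      · exact this j i hv.symm hij.symm (lt_of_le_of_ne (not_lt.mp hlt) hij.symm)
      have e1 : List.ofFn v = (List.ofFn v).take i ++ v i :: (List.ofFn v).drop (i + 1) := by
        conv_lhs => rw [← Function.update_eq_self i v]
        exact key v i (v i)
      have e2 : (List.ofFn v).drop (i + 1) =
          ((List.ofFn v).drop (i + 1)).take (j - (i + 1)) ++ v i :: (List.ofFn v).drop (j + 1) := by
        rw [hv]
        have hj : (j : ℕ) < (List.ofFn v).length := by simp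
        have : v j = (List.ofFn v)[(j : ℕ)] := by simp
        have hlt' : (i : ℕ) < j := hlt
        rw [this]
        conv_lhs => rw [← List.take_append_drop (j - (i + 1)) ((List.ofFn v).drop (i + 1))]
        rw [List.drop_drop, show (i : ℕ) + 1 + (j - (i + 1)) = j by omega,
          List.drop_eq_getElem_cons hj]
      rw [e1, e2]
      exact h.alt' _ _ _ _ }

lemma ev_ofRaw (φ : List L → W) (h : IsForm A φ) : (ofRaw φ h).ev = φ := by
  funext v
  change φ (List.ofFn v.get) = φ v
  rw [List.ofFn_get]

lemma Forms.ev_add (f g : Forms A L W) : (f + g).ev = f.ev + g.ev := rfl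
lemma Forms.ev_smul {R : Type*} [Monoid R] [DistribMulAction R W] [SMulCommClass A R W] (c : R)
    (f : Forms A L W) : (c • f).ev = c • f.ev := rfl

end Official

section Omega

variable (𝕜 A L W : Type*) [CommRing 𝕜] [CommRing A] [Algebra 𝕜 A] [LieRing L] [Module A L]
  [AddCommGroup W] [Module A W] [Module 𝕜 W] [IsScalarTower 𝕜 A W]

/-- Families of alternating maps concentrated in degree `k`. -/
def homogeneous (k : ℤ) : Submodule 𝕜 (Forms A L W) where
  carrier := {f | ∀ n : ℕ, (n : ℤ) ≠ k → f n = 0}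
  add_mem' := fun hf hg n hn => by rw [Pi.add_apply, hf n hn, hg n hn, add_zero]
  zero_mem' := fun n _ => rfl
  smul_mem' := fun c f hf n hn => by rw [Pi.smul_apply, hf n hn, smul_zero]

/-- `W`-valued forms of degree `k`; there are none but zero for negative `k`. -/
def Omega (k : ℤ) : Type _ := homogeneous 𝕜 A L W k

instance (k : ℤ) : AddCommGroup (Omega 𝕜 A L W k) :=
  inferInstanceAs (AddCommGroup (homogeneous 𝕜 A L W k))

instance (k : ℤ) : Module 𝕜 (Omega 𝕜 A L W k) :=
  inferInstanceAs (Module 𝕜 (homogeneous 𝕜 A L W k))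

variable {𝕜 A L W}

lemma omega_conc {k : ℤ} (f : Omega 𝕜 A L W k) : Conc k f.1.ev := by
  intro v hv
  rw [Forms.ev, f.2 _ hv]; rfl

/-- A form of degree `k` from a function on lists. -/
def Omega.ofRaw {k : ℤ} (φ : List L → W) (h : IsForm A φ) (hc : Conc k φ) : Omega 𝕜 A L W k :=
  Subtype.mk (Cartan.ofRaw φ h) fun n hn => by
    ext v
    exact hc (List.ofFn v) (by simpa using hn)

lemma Omega.ev_ofRaw {k : ℤ} (φ : List L → W) (h : IsForm A φ) (hc : Conc k φ) :
    (Omega.ofRaw (𝕜 := 𝕜) φ h hc).1.ev = φ := Cartan.ev_ofRaw φ h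

lemma Omega.ext_ev {k : ℤ} {f g : Omega 𝕜 A L W k} (h : f.1.ev = g.1.ev) : f = g :=
  Subtype.ext (Forms.ext_ev h)

lemma Omega.ev_add {k : ℤ} (f g : Omega 𝕜 A L W k) : (f + g).1.ev = f.1.ev + g.1.ev := rfl
lemma Omega.ev_sub {k : ℤ} (f g : Omega 𝕜 A L W k) : (f - g).1.ev = f.1.ev - g.1.ev := rfl
lemma Omega.ev_smul {k : ℤ} (c : 𝕜) (f : Omega 𝕜 A L W k) : (c • f).1.ev = c • f.1.ev := rfl

end Omega

section Conn

variable (𝕜 A L W : Type*) [CommRing 𝕜] [CommRing A] [Algebra 𝕜 A] [LieRing L] [Module A L]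
  [LieRingModule L A] [AddCommGroup W] [Module A W] [Module 𝕜 W] [IsScalarTower 𝕜 A W]

/-- A connection on `W`: a `𝕜`-linear map from `W` to the `W`-valued one-forms satisfying the
Leibniz rule. -/
structure Connection where
  toFun : W →ₗ[𝕜] (L →ₗ[A] W)
  leibniz : ∀ (a : A) (w : W) (X : L), toFun (a • w) X = a • toFun w X + ⁅X, a⁆ • w

variable {𝕜 A L W}

namespace Connection

/-- The covariant derivative `∇_X w`. -/
def nab (D : Connection 𝕜 A L W) (X : L) (w : W) : W := D.toFun w X

lemma isConn (D : Connection 𝕜 A L W) : IsConn A D.nab where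
  add_vec := fun X Y w => map_add _ _ _
  smul_vec := fun a X w => map_smul _ _ _
  add := fun X w w' => by simp [nab]
  smul := fun X a w => D.leibniz a w X

lemma nab_const (D : Connection 𝕜 A L W) (c : 𝕜) (X : L) (w : W) :
    D.nab X (c • w) = c • D.nab X w := by simp [nab]

end Connection

/-- The exterior covariant derivative of a connection. -/
def Connection.d [LieRinehartRing A L] (D : Connection 𝕜 A L W) {k l : ℤ} (h : k + 1 = l) :
    Omega 𝕜 A L W k →ₗ[𝕜] Omega 𝕜 A L W l where
  toFun f := Omega.ofRaw (rawD D.nab f.1.ev) (f.1.isForm.d D.isConn) ((omega_conc f).d h D.isConn)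
  map_add' f g := Omega.ext_ev (by
    simp only [Omega.ev_add, Omega.ev_ofRaw, d_add D.isConn])
  map_smul' c f := Omega.ext_ev (by
    simp only [Omega.ev_smul, Omega.ev_ofRaw, RingHom.id_apply]
    exact d_smul_const c (D.nab_const c) _)

lemma Connection.ev_d [LieRinehartRing A L] (D : Connection 𝕜 A L W) {k l : ℤ} (h : k + 1 = l)
    (f : Omega 𝕜 A L W k) : (D.d h f).1.ev = rawD D.nab f.1.ev :=
  Cartan.ev_ofRaw _ (f.1.isForm.d D.isConn)

end Conn

section WedgeOmega

variable {𝕜 A L W₁ W₂ W₃ : Type*} [CommRing 𝕜] [CommRing A] [Algebra 𝕜 A] [LieRing L]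
  [Module A L]
  [AddCommGroup W₁] [Module A W₁] [Module 𝕜 W₁] [IsScalarTower 𝕜 A W₁]
  [AddCommGroup W₂] [Module A W₂] [Module 𝕜 W₂] [IsScalarTower 𝕜 A W₂]
  [AddCommGroup W₃] [Module A W₃] [Module 𝕜 W₃] [IsScalarTower 𝕜 A W₃]

/-- A bilinear pairing as a biadditive one. -/
def toAdd (μ : W₁ →ₗ[A] W₂ →ₗ[A] W₃) : W₁ →+ W₂ →+ W₃ :=
  LinearMap.toAddMonoidHom'.comp μ.toAddMonoidHom

lemma toAdd_apply (μ : W₁ →ₗ[A] W₂ →ₗ[A] W₃) (x : W₁) (y : W₂) : toAdd μ x y = μ x y := rfl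

lemma smul_const_left (μ : W₁ →ₗ[A] W₂ →ₗ[A] W₃) (c : 𝕜) (x : W₁) (y : W₂) :
    toAdd μ (c • x) y = c • toAdd μ x y := by
  rw [← algebraMap_smul A c x, ← algebraMap_smul A c (toAdd μ x y)]; simp [toAdd_apply]

lemma smul_const_right (μ : W₁ →ₗ[A] W₂ →ₗ[A] W₃) (c : 𝕜) (x : W₁) (y : W₂) :
    toAdd μ x (c • y) = c • toAdd μ x y := by
  rw [← algebraMap_smul A c y, ← algebraMap_smul A c (toAdd μ x y)]; simp [toAdd_apply]

/-- The wedge product with respect to a bilinear pairing of the coefficients. -/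
def wedge (μ : W₁ →ₗ[A] W₂ →ₗ[A] W₃) {m n k : ℤ} (h : m + n = k) :
    Omega 𝕜 A L W₁ m →ₗ[𝕜] Omega 𝕜 A L W₂ n →ₗ[𝕜] Omega 𝕜 A L W₃ k :=
  LinearMap.mk₂ 𝕜 (fun f g => Omega.ofRaw (rawWedge (toAdd μ) f.1.ev g.1.ev)
      (f.1.isForm.wedge (toAdd μ) (fun a x y => by simp [toAdd_apply])
        (fun a x y => by simp [toAdd_apply]) g.1.isForm)
      ((omega_conc f).wedge h (toAdd μ) (omega_conc g)))
    (fun f f' g => Omega.ext_ev (by simp only [Omega.ev_add, Omega.ev_ofRaw, wedge_add_left]))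
    (fun c f g => Omega.ext_ev (by
      simp only [Omega.ev_smul, Omega.ev_ofRaw]
      exact wedge_smul_left _ (smul_const_left μ) _ _ _))
    (fun f g g' => Omega.ext_ev (by simp only [Omega.ev_add, Omega.ev_ofRaw, wedge_add_right]))
    (fun c f g => Omega.ext_ev (by
      simp only [Omega.ev_smul, Omega.ev_ofRaw]
      exact wedge_smul_right _ (smul_const_right μ) _ _ _))

lemma ev_wedge (μ : W₁ →ₗ[A] W₂ →ₗ[A] W₃) {m n k : ℤ} (h : m + n = k) (f : Omega 𝕜 A L W₁ m)
    (g : Omega 𝕜 A L W₂ n) :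
    (wedge μ h f g).1.ev = rawWedge (toAdd μ) f.1.ev g.1.ev :=
  Cartan.ev_ofRaw _ (f.1.isForm.wedge (toAdd μ) (fun a x y => by simp [toAdd_apply])
    (fun a x y => by simp [toAdd_apply]) g.1.isForm)

end WedgeOmega

section Curvature

variable {𝕜 A L W₁ W₂ W₃ W : Type*} [CommRing 𝕜] [CommRing A] [Algebra 𝕜 A] [LieRing L]
  [Module A L] [LieRingModule L A] [LieRinehartRing A L]
  [AddCommGroup W₁] [Module A W₁] [Module 𝕜 W₁] [IsScalarTower 𝕜 A W₁]
  [AddCommGroup W₂] [Module A W₂] [Module 𝕜 W₂] [IsScalarTower 𝕜 A W₂]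
  [AddCommGroup W₃] [Module A W₃] [Module 𝕜 W₃] [IsScalarTower 𝕜 A W₃]
  [AddCommGroup W] [Module A W] [Module 𝕜 W] [IsScalarTower 𝕜 A W]

/-- The connection `f ↦ ∇ ∘ f - f ∘ ∇` on the module of homomorphisms. Its exterior covariant
derivative is `f ↦ ∇ ∘ f - (-1)^|f| f ∘ ∇` on forms with values in homomorphisms. -/
def Connection.hom (D₁ : Connection 𝕜 A L W₁) (D₂ : Connection 𝕜 A L W₂) :
    Connection 𝕜 A L (W₁ →ₗ[A] W₂) where
  toFun :=
    { toFun := fun f =>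
        { toFun := fun X =>
            { toFun := fun s => D₂.nab X (f s) - f (D₁.nab X s)
              map_add' := fun s t => by
                rw [map_add, D₂.isConn.add, D₁.isConn.add, map_add]; abel
              map_smul' := fun a s => by
                rw [map_smul, D₂.isConn.smul, D₁.isConn.smul, map_add, map_smul, map_smul,
                  RingHom.id_apply, smul_sub]; abel }
          map_add' := fun X Y => by
            ext s; simp [D₁.isConn.add_vec, D₂.isConn.add_vec]; abel
          map_smul' := fun a X => by
            ext s; simp [D₁.isConn.smul_vec, D₂.isConn.smul_vec, smul_sub] }
      map_add' := fun f g => by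
        ext X s; simp [D₂.isConn.add]; abel
      map_smul' := fun c f => by
        ext X s; simp [D₂.nab_const, smul_sub] }
  leibniz := fun a f X => by
    ext s; simp [D₂.isConn.smul, smul_sub]; abel

lemma Connection.hom_nab (D₁ : Connection 𝕜 A L W₁) (D₂ : Connection 𝕜 A L W₂) (X : L)
    (f : W₁ →ₗ[A] W₂) (s : W₁) : (D₁.hom D₂).nab X f s = D₂.nab X (f s) - f (D₁.nab X s) := rfl

/-- The action of vectors on scalars as a connection. -/
def scalarConn (𝕜 A L : Type*) [CommRing 𝕜] [CommRing A] [Algebra 𝕜 A] [LieRing L]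
    [LieAlgebra 𝕜 L] [Module A L] [LieRingModule L A] [LieRinehartRing A L]
    [LieRinehartAlgebra 𝕜 A L] : Connection 𝕜 A L A where
  toFun :=
    { toFun := fun a =>
        { toFun := fun X => ⁅X, a⁆
          map_add' := fun X Y => add_lie X Y a
          map_smul' := fun b X => by simp }
      map_add' := fun a b => by ext X; exact lie_add X a b
      map_smul' := fun c a => by ext X; exact lie_smul c X a }
  leibniz := fun a b X => by simp

/-- The curvature endomorphism `∇_X ∇_Y - ∇_Y ∇_X - ∇_[X,Y]`. -/
def Connection.curvEnd (D : Connection 𝕜 A L W) (X Y : L) : W →ₗ[A] W where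
  toFun := curvAt D.nab X Y
  map_add' := fun s t => by simp only [curvAt, D.isConn.add]; abel
  map_smul' := fun a s => by
    simp only [curvAt, D.isConn.smul, D.isConn.add, RingHom.id_apply, smul_sub, lie_lie, sub_smul]
    abel

lemma Connection.curvEnd_apply (D : Connection 𝕜 A L W) (X Y : L) (w : W) :
    D.curvEnd X Y w = D.nab X (D.nab Y w) - D.nab Y (D.nab X w) - D.nab ⁅X, Y⁆ w := rfl

/-- The function on lists given by a function of two vectors. -/
def rawTwo (R : L → L → W) : List L → W
  | [X, Y] => R X Y
  | _ => 0

lemma isForm_rawTwo {R : L → L → W} (h1 : ∀ X X' Y, R (X + X') Y = R X Y + R X' Y)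
    (h2 : ∀ (a : A) X Y, R (a • X) Y = a • R X Y) (h3 : ∀ X, R X X = 0)
    (h4 : ∀ X Y, R X Y = -R Y X) : IsForm A (rawTwo R) := by
  have h1' : ∀ Y X X', R Y (X + X') = R Y X + R Y X' := by
    intro Y X X'; rw [h4, h1, h4 X, h4 X']; abel
  have h2' : ∀ (a : A) X Y, R Y (a • X) = a • R Y X := by
    intro a X Y; rw [h4, h2, h4 X, smul_neg, neg_neg]
  intro u
  refine ⟨fun X Y v => ?_, fun a X v => ?_, fun X v => ?_⟩
  · match u, v with
    | [], [] => simp [rawTwo]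
    | [], [Z] => simp [rawTwo, h1]
    | [], Z :: T :: v => simp [rawTwo]
    | [Z], [] => simp [rawTwo, h1']
    | [Z], T :: v => simp [rawTwo]
    | [Z, T], v => simp [rawTwo]
    | Z :: T :: S :: u, v => simp [rawTwo]
  · match u, v with
    | [], [] => simp [rawTwo]
    | [], [Z] => simp [rawTwo, h2]
    | [], Z :: T :: v => simp [rawTwo]
    | [Z], [] => simp [rawTwo, h2']
    | [Z], T :: v => simp [rawTwo]
    | [Z, T], v => simp [rawTwo]
    | Z :: T :: S :: u, v => simp [rawTwo]
  · match u, v with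
    | [], [] => simp [rawTwo, h3]
    | [], Z :: v => simp [rawTwo]
    | [Z], v => simp [rawTwo]
    | [Z, T], v => simp [rawTwo]
    | Z :: T :: S :: u, v => simp [rawTwo]

lemma conc_rawTwo (R : L → L → W) : Conc 2 (rawTwo R) := by
  intro v hv
  match v with
  | [] => rfl
  | [X] => rfl
  | [X, Y] => exact absurd rfl hv
  | X :: Y :: Z :: v => rfl

lemma Connection.isForm_curv (D : Connection 𝕜 A L W) : IsForm A (rawTwo D.curvEnd) := by
  have hD := D.isConn
  refine isForm_rawTwo (fun X X' Y => ?_) (fun a X Y => ?_) (fun X => ?_) (fun X Y => ?_)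
  · ext w
    simp only [LinearMap.add_apply, D.curvEnd_apply, add_lie, hD.add_vec, hD.add]; abel
  · ext w
    have hb : ⁅a • X, Y⁆ = a • ⁅X, Y⁆ - ⁅Y, a⁆ • X := by
      rw [← lie_skew, LieRinehartRing.leibniz_smul_right, ← lie_skew X Y, smul_neg, neg_add,
        sub_eq_add_neg]
    simp only [LinearMap.smul_apply, D.curvEnd_apply, hb, sub_eq_add_neg, ← neg_smul,
      hD.add_vec, hD.smul_vec, hD.smul, smul_add]
    simp only [neg_smul, smul_neg]
    abel
  · ext w
    simp [D.curvEnd_apply, (by simpa using hD.smul_vec 0 0 w : D.nab 0 w = 0)]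
  · ext w
    have : D.nab ⁅X, Y⁆ w = -D.nab ⁅Y, X⁆ w := by
      rw [← lie_skew, ← neg_one_smul A, hD.smul_vec, neg_one_smul]
    simp only [LinearMap.neg_apply, D.curvEnd_apply, this]; abel

/-- The curvature of a connection, a two-form valued in endomorphisms. -/
def Connection.curv (D : Connection 𝕜 A L W) : Omega 𝕜 A L (W →ₗ[A] W) 2 :=
  Omega.ofRaw (rawTwo D.curvEnd) D.isForm_curv (conc_rawTwo _)

lemma Connection.ev_curv (D : Connection 𝕜 A L W) : D.curv.1.ev = rawTwo D.curvEnd :=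
  Omega.ev_ofRaw _ _ _

lemma Connection.nab_zero (D : Connection 𝕜 A L W) (X : L) : D.nab X 0 = 0 := D.isConn.zero X

lemma Connection.bianchi (D : Connection 𝕜 A L W) {k : ℤ} (h : 2 + 1 = k) :
    (D.hom D).d h D.curv = 0 := by
  apply Omega.ext_ev
  funext v
  change ((D.hom D).d h D.curv).1.ev v = 0
  by_cases hv : (v.length : ℤ) = k
  swap
  · exact omega_conc _ v hv
  rw [Connection.ev_d, D.ev_curv]
  match v with
  | [] => rfl
  | [X] => simp at hv; omega
  | [X, Y] => simp at hv; omega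
  | X :: Y :: Z :: T :: v => simp at hv; omega
  | [X, Y, Z] =>
    have hD := D.isConn
    have hv0 : ∀ w, D.nab ⁅⁅X, Y⁆, Z⁆ w = D.nab ⁅X, ⁅Y, Z⁆⁆ w - D.nab ⁅Y, ⁅X, Z⁆⁆ w := by
      intro w
      rw [lie_lie, sub_eq_add_neg, ← neg_one_smul A, hD.add_vec, hD.smul_vec, neg_one_smul,
        sub_eq_add_neg]
    ext w
    simp only [rawD, rawLie, rawTwo, rawIota, LinearMap.sub_apply,
      Connection.hom_nab, Connection.curvEnd_apply, LinearMap.zero_apply, hD.sub,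
      sub_zero]
    simp only [hv0]
    abel

end Curvature

section DeRham

variable (𝕜 A L : Type*) [CommRing 𝕜] [CommRing A] [Algebra 𝕜 A] [LieRing L]
  [LieAlgebra 𝕜 L] [Module A L] [LieRingModule L A] [LieRinehartRing A L]
  [LieRinehartAlgebra 𝕜 A L]

/-- The exterior derivative of scalar forms. -/
def extD {k l : ℤ} (h : k + 1 = l) : Omega 𝕜 A L A k →ₗ[𝕜] Omega 𝕜 A L A l :=
  (scalarConn 𝕜 A L).d h

/-- Closed scalar forms. -/
def closedForms (k : ℤ) : Submodule 𝕜 (Omega 𝕜 A L A k) :=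
  LinearMap.ker (extD 𝕜 A L (rfl : k + 1 = k + 1))

/-- Exact scalar forms. -/
def exactForms (k : ℤ) : Submodule 𝕜 (Omega 𝕜 A L A k) :=
  LinearMap.range (extD 𝕜 A L (sub_add_cancel k 1))

/-- De Rham cohomology: closed forms modulo exact forms. -/
abbrev deRham (k : ℤ) : Type _ :=
  closedForms 𝕜 A L k ⧸ (exactForms 𝕜 A L k).submoduleOf (closedForms 𝕜 A L k)

variable {𝕜 A L}

lemma extD_extD {k l m : ℤ} (h : k + 1 = l) (h' : l + 1 = m) (f : Omega 𝕜 A L A k) :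
    extD 𝕜 A L h' (extD 𝕜 A L h f) = 0 := by
  apply Omega.ext_ev
  rw [extD, extD, Connection.ev_d, Connection.ev_d]
  refine d_d_flat (scalarConn 𝕜 A L).isConn (fun X Y a => ?_) f.1.isForm
  change ⁅X, ⁅Y, a⁆⁆ - ⁅Y, ⁅X, a⁆⁆ - ⁅⁅X, Y⁆, a⁆ = 0
  rw [lie_lie]; abel

end DeRham

section Cat

variable {𝕜 A L W₁ W₂ W₃ W : Type*} [CommRing 𝕜] [CommRing A] [Algebra 𝕜 A] [LieRing L]
  [LieAlgebra 𝕜 L] [Module A L] [LieRingModule L A] [LieRinehartRing A L]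
  [LieRinehartAlgebra 𝕜 A L]
  [AddCommGroup W₁] [Module A W₁] [Module 𝕜 W₁] [IsScalarTower 𝕜 A W₁]
  [AddCommGroup W₂] [Module A W₂] [Module 𝕜 W₂] [IsScalarTower 𝕜 A W₂]
  [AddCommGroup W₃] [Module A W₃] [Module 𝕜 W₃] [IsScalarTower 𝕜 A W₃]
  [AddCommGroup W] [Module A W] [Module 𝕜 W] [IsScalarTower 𝕜 A W]

/-- Change of coefficients. -/
def mapCoeff (g : W₁ →ₗ[A] W₂) {k : ℤ} (f : Omega 𝕜 A L W₁ k) : Omega 𝕜 A L W₂ k :=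
  Subtype.mk (fun n => g.compAlternatingMap (f.1 n)) fun n hn => by
    have := f.2 n hn
    ext v
    simp [this]

lemma ev_mapCoeff (g : W₁ →ₗ[A] W₂) {k : ℤ} (f : Omega 𝕜 A L W₁ k) (v : List L) :
    (mapCoeff g f).1.ev v = g (f.1.ev v) := rfl

/-- A scalar form as a form with values in scalar endomorphisms. -/
def scalarForm (W : Type*) [AddCommGroup W] [Module A W] [Module 𝕜 W] [IsScalarTower 𝕜 A W]
    {k : ℤ} (h : Omega 𝕜 A L A k) : Omega 𝕜 A L (W →ₗ[A] W) k :=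
  mapCoeff (LinearMap.toSpanSingleton A (W →ₗ[A] W) LinearMap.id) h

lemma ev_scalarForm {k : ℤ} (h : Omega 𝕜 A L A k) (v : List L) (w : W) :
    (scalarForm W h).1.ev v w = h.1.ev v • w := by
  simp [scalarForm, ev_mapCoeff]

/-- Composition of homomorphisms. -/
def compHom (A : Type*) [CommRing A] (W₁ W₂ W₃ : Type*) [AddCommGroup W₁] [Module A W₁]
    [AddCommGroup W₂] [Module A W₂] [AddCommGroup W₃] [Module A W₃] :
    (W₂ →ₗ[A] W₃) →ₗ[A] (W₁ →ₗ[A] W₂) →ₗ[A] (W₁ →ₗ[A] W₃) :=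
  LinearMap.llcomp A W₁ W₂ W₃

lemma rawD_scalar (D : Connection 𝕜 A L W) (φ : List L → A) (v : List L) (w : W) :
    rawD (D.hom D).nab (fun v => LinearMap.toSpanSingleton A (W →ₗ[A] W) LinearMap.id (φ v)) v w =
      rawD (scalarConn 𝕜 A L).nab φ v • w := by
  have hl : ∀ X v (φ : List L → A), rawLie (D.hom D).nab X
      (fun v => LinearMap.toSpanSingleton A (W →ₗ[A] W) LinearMap.id (φ v)) v =
      LinearMap.toSpanSingleton A (W →ₗ[A] W) LinearMap.id (rawLie (scalarConn 𝕜 A L).nab X φ v) := by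
    intro X v
    induction v with
    | nil =>
      intro φ
      ext w
      simp only [rawLie, Connection.hom_nab, LinearMap.toSpanSingleton_apply, LinearMap.smul_apply,
        LinearMap.id_apply, D.isConn.smul]
      change _ = ⁅X, φ []⁆ • w
      abel
    | cons Y v ih =>
      intro φ
      rw [rawLie, rawLie, map_sub]
      exact congrArg (· - _) (ih (rawIota Y φ))
  induction v generalizing φ with
  | nil => simp [rawD]
  | cons X v ih =>
    rw [rawD, rawD, hl, LinearMap.sub_apply, sub_smul]
    exact congrArg₂ (· - ·) (by simp) (ih (rawIota X φ))

lemma d_scalarForm (D : Connection 𝕜 A L W) {k l : ℤ} (h : k + 1 = l) (f : Omega 𝕜 A L A k) :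
    (D.hom D).d h (scalarForm W f) = scalarForm W (extD 𝕜 A L h f) := by
  apply Omega.ext_ev
  rw [Connection.ev_d]
  funext v
  ext w
  rw [ev_scalarForm, extD, Connection.ev_d]
  exact rawD_scalar D f.1.ev v w

lemma iota_three {k : ℤ} (f : Omega 𝕜 A L W k) (hk : k = 2) (X Y Z : L) :
    rawIota Z (rawIota Y (rawIota X f.1.ev)) = 0 := by
  subst hk
  funext v
  exact omega_conc f _ (by simp; omega)

lemma wedge_scalarForm (h : Omega 𝕜 A L A 2) {m k : ℤ} (h₁ : 2 + m = k) (h₂ : m + 2 = k)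
    (f : Omega 𝕜 A L (W₁ →ₗ[A] W₂) m) :
    wedge (compHom A W₁ W₂ W₂) h₁ (scalarForm W₂ h) f =
      wedge (compHom A W₁ W₁ W₂) h₂ f (scalarForm W₁ h) := by
  apply Omega.ext_ev
  rw [ev_wedge, ev_wedge]
  refine wedge_comm_two (toAdd (compHom A W₁ W₁ W₂)) (toAdd (compHom A W₁ W₂ W₂)) f.1.ev
    (omega_conc _ [] (by simp)) (fun X => omega_conc _ [X] (by simp))
    (iota_three _ rfl) (omega_conc _ [] (by simp)) (fun X => omega_conc _ [X] (by simp))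
    (iota_three _ rfl) (fun X Y w => ?_)
  ext s
  simp [toAdd_apply, compHom, ev_scalarForm]

lemma d_hom_wedge (D₁ : Connection 𝕜 A L W₁) (D₂ : Connection 𝕜 A L W₂)
    (D₃ : Connection 𝕜 A L W₃) {m n k m' n' k' : ℤ} (h : m + n = k) (hm : m + 1 = m')
    (hn : n + 1 = n') (hk : k + 1 = k') (h₁ : m' + n = k') (h₂ : m + n' = k')
    (g : Omega 𝕜 A L (W₂ →ₗ[A] W₃) m) (f : Omega 𝕜 A L (W₁ →ₗ[A] W₂) n) :
    (D₁.hom D₃).d hk (wedge (compHom A W₁ W₂ W₃) h g f) =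
      wedge (compHom A W₁ W₂ W₃) h₁ ((D₂.hom D₃).d hm g) f +
      m.negOnePow • wedge (compHom A W₁ W₂ W₃) h₂ g ((D₁.hom D₂).d hn f) := by
  apply Omega.ext_ev
  have hu : ∀ (u : ℤˣ) (x : Omega 𝕜 A L (W₁ →ₗ[A] W₃) k'), (u • x).1.ev = u • x.1.ev :=
    fun u x => rfl
  rw [Omega.ev_add, hu, Connection.ev_d, ev_wedge, ev_wedge, ev_wedge, Connection.ev_d,
    Connection.ev_d, d_wedge (D₂.hom D₃).isConn (D₁.hom D₃).isConn (nab₂ := (D₁.hom D₂).nab),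
    (omega_conc g).sign_eq]
  · congr 1
    refine wedge_smul_left _ (fun u x y => ?_) _ _ _
    rw [Units.smul_def, Units.smul_def, map_zsmul]; rfl
  · intro X x y
    ext s
    simp [toAdd_apply, compHom, Connection.hom_nab]

lemma hom_curv (D₁ : Connection 𝕜 A L W₁) (D₂ : Connection 𝕜 A L W₂) {m n k : ℤ}
    (h : m + 1 = n) (h' : n + 1 = k) (hl : 2 + m = k) (hr : m + 2 = k)
    (f : Omega 𝕜 A L (W₁ →ₗ[A] W₂) m) :
    (D₁.hom D₂).d h' ((D₁.hom D₂).d h f) =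
      wedge (compHom A W₁ W₂ W₂) hl D₂.curv f - wedge (compHom A W₁ W₁ W₂) hr f D₁.curv := by
  apply Omega.ext_ev
  rw [Omega.ev_sub, ev_wedge, ev_wedge, Connection.ev_d, Connection.ev_d,
    d_d (D₁.hom D₂).isConn f.1.isForm]
  refine rawCurv_eq_wedge _ _ (omega_conc _ [] (by simp)) (fun X => omega_conc _ [X] (by simp))
    (iota_three _ rfl) (omega_conc _ [] (by simp)) (fun X => omega_conc _ [X] (by simp))
    (iota_three _ rfl) (fun X Y w => ?_) _
  rw [Connection.ev_curv, Connection.ev_curv]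
  ext s
  simp only [toAdd_apply, compHom, curvAt, Connection.hom_nab, LinearMap.sub_apply,
    LinearMap.llcomp_apply, rawTwo, Connection.curvEnd_apply, D₂.isConn.sub, map_sub]
  abel

/-- The identity as a form of degree zero. -/
def idForm (𝕜 A L W : Type*) [CommRing 𝕜] [CommRing A] [Algebra 𝕜 A] [LieRing L] [Module A L]
    [AddCommGroup W] [Module A W] [Module 𝕜 W] [IsScalarTower 𝕜 A W] :
    Omega 𝕜 A L (W →ₗ[A] W) 0 :=
  Subtype.mk (fun n => match n with
    | 0 => AlternatingMap.constOfIsEmpty A L (Fin 0) LinearMap.id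
    | _ + 1 => 0) fun n hn => by
    cases n with
    | zero => exact absurd rfl hn
    | succ n => rfl

lemma ev_idForm_cons (X : L) : rawIota X (idForm 𝕜 A L W).1.ev = 0 := rfl

end Cat

section Category

universe w a l o g

variable {𝕜 : Type w} {A : Type a} {L : Type l} [CommRing 𝕜] [CommRing A] [Algebra 𝕜 A]
  [LieRing L] [LieAlgebra 𝕜 L] [Module A L] [LieRingModule L A] [LieRinehartRing A L]
  [LieRinehartAlgebra 𝕜 A L] {Obj : Type o} (Γ : Obj → Type g) [∀ E, AddCommGroup (Γ E)]
  [∀ E, Module A (Γ E)] [∀ E, Module 𝕜 (Γ E)] [∀ E, IsScalarTower 𝕜 A (Γ E)]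

/-- The curved category of a family of modules with connection: morphisms of degree `n` are the
`n`-forms with values in homomorphisms, composition is the wedge product, and the curvature is the
curvature of the connection minus the closed two-form `h`. -/
def connCategory (D : ∀ E, Connection 𝕜 A L (Γ E)) (h : closedForms 𝕜 A L 2) :
    DG.CurvedCategory.{w, o, max l g} 𝕜 where
  Obj := Obj
  Hom := fun E F n => Omega 𝕜 A L (Γ E →ₗ[A] Γ F) n
  comp := fun {E F G m n k} hk => wedge (compHom A (Γ E) (Γ F) (Γ G)) hk
  id := fun E => idForm 𝕜 A L (Γ E)
  comp_assoc := fun {E F G H l m n i j k} h₁ h₂ h₃ h₄ e g f => by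
    apply Omega.ext_ev
    simp only [ev_wedge]
    exact wedge_assoc _ _ _ _ (fun x y z => rfl) _ _ _
  id_comp := fun {E F n} hn f => by
    apply Omega.ext_ev
    rw [ev_wedge]
    funext v
    rw [wedge_deg_zero_left _ _ (fun X => ev_idForm_cons X)]
    rfl
  comp_id := fun {E F n} hn f => by
    apply Omega.ext_ev
    rw [ev_wedge]
    funext v
    rw [wedge_deg_zero_right _ _ _ (fun X => ev_idForm_cons X)]
    rfl
  nabla := fun {E F m n} hm => ((D E).hom (D F)).d hm
  curv := fun E => (D E).curv - scalarForm (Γ E) h.1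
  leibniz := fun {E F G m n k m' n' k'} => d_hom_wedge (D E) (D F) (D G)
  nabla_nabla := fun {E F m n k} h₁ h₂ hl hr f => by
    rw [hom_curv _ _ h₁ h₂ hl hr, map_sub, map_sub, LinearMap.sub_apply,
      wedge_scalarForm h.1 hl hr f]
    abel
  nabla_curv := fun {k} hk E => by
    rw [map_sub, Connection.bianchi, d_scalarForm]
    subst hk
    have : extD 𝕜 A L rfl h.1 = 0 := h.2
    rw [this, zero_sub, neg_eq_zero]
    apply Omega.ext_ev
    funext v
    ext w
    rw [ev_scalarForm]
    exact zero_smul A w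

end Category

end Cartan

namespace Geometry

open Bundle VectorField

/-- Real-valued smooth functions. -/
abbrev SmoothFun (d : ℕ) (M : Type*) [TopologicalSpace M]
    [ChartedSpace (EuclideanSpace ℝ (Fin d)) M] : Type _ := C^∞⟮𝓡 d, M; 𝓘(ℝ, ℝ), ℝ⟯

/-- Smooth vector fields. -/
abbrev VecField (d : ℕ) (M : Type*) [TopologicalSpace M]
    [ChartedSpace (EuclideanSpace ℝ (Fin d)) M] [IsManifold (𝓡 d) ∞ M] : Type _ :=
  Cₛ^∞⟮𝓡 d; EuclideanSpace ℝ (Fin d), (TangentSpace (𝓡 d) : M → Type _)⟯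

section Sections

variable {d : ℕ} {M : Type*} [TopologicalSpace M] [ChartedSpace (EuclideanSpace ℝ (Fin d)) M]
  {F : Type*} [NormedAddCommGroup F] [NormedSpace ℝ F] {V : M → Type*}
  [TopologicalSpace (TotalSpace F V)] [∀ x, TopologicalSpace (V x)] [∀ x, AddCommGroup (V x)]
  [∀ x, Module ℝ (V x)] [FiberBundle F V] [VectorBundle ℝ F V]

instance : SMul (SmoothFun d M) Cₛ^∞⟮𝓡 d; F, V⟯ :=
  ⟨fun a s => ⟨fun x => a x • s x, a.contMDiff.smul_section s.contMDiff⟩⟩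

lemma smul_section_apply (a : SmoothFun d M) (s : Cₛ^∞⟮𝓡 d; F, V⟯) (x : M) :
    (a • s) x = a x • s x := rfl

/-- Multiplication of sections by smooth functions. -/
instance : Module (SmoothFun d M) Cₛ^∞⟮𝓡 d; F, V⟯ where
  one_smul := fun s => by ext x; exact one_smul ℝ (s x)
  mul_smul := fun a b s => by ext x; exact mul_smul (a x) (b x) (s x)
  smul_zero := fun a => by ext x; exact smul_zero (a x)
  smul_add := fun a s t => by ext x; exact smul_add (a x) (s x) (t x)
  add_smul := fun a b s => by ext x; exact add_smul (a x) (b x) (s x)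
  zero_smul := fun s => by ext x; exact zero_smul ℝ (s x)

instance : IsScalarTower ℝ (SmoothFun d M) Cₛ^∞⟮𝓡 d; F, V⟯ where
  smul_assoc := fun c a s => by ext x; exact smul_assoc c (a x) (s x)

end Sections

section Tangent

variable {d : ℕ} {M : Type*} [TopologicalSpace M] [ChartedSpace (EuclideanSpace ℝ (Fin d)) M]
  [IsManifold (𝓡 d) ∞ M]

lemma vf_mdiff (X : VecField d M) (x : M) :
    MDifferentiableAt (𝓡 d) (𝓡 d).tangent (fun y => (X y : TangentBundle (𝓡 d) M)) x :=
  X.mdifferentiableAt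

lemma fun_mdiff (a : SmoothFun d M) (x : M) : MDifferentiableAt (𝓡 d) 𝓘(ℝ, ℝ) a x :=
  (a.contMDiff.mdifferentiable (by simp)) x

lemma two_le_infty : (2 : ℕ∞ω) ≤ ∞ := WithTop.coe_le_coe.2 (le_top : (2 : ℕ∞) ≤ ⊤)

lemma three_le_infty : (3 : ℕ∞ω) ≤ ∞ := WithTop.coe_le_coe.2 (le_top : (3 : ℕ∞) ≤ ⊤)

lemma manifold_two : IsManifold (𝓡 d) (minSmoothness ℝ 2) M :=
  IsManifold.of_le (n := ∞) (by simpa using two_le_infty)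

lemma manifold_three : IsManifold (𝓡 d) (minSmoothness ℝ 3) M :=
  IsManifold.of_le (n := ∞) (by simpa using three_le_infty)

/-- The Lie bracket of vector fields. -/
instance : Bracket (VecField d M) (VecField d M) :=
  ⟨fun X Y => ⟨mlieBracket (𝓡 d) X Y, fun x => by
    have : IsManifold (𝓡 d) (((⊤ : ℕ∞) : ℕ∞ω) + 1) M := ‹IsManifold (𝓡 d) ∞ M›
    have : IsManifold (𝓡 d) (minSmoothness ℝ 2) M := manifold_two
    exact ContMDiffAt.mlieBracket_vectorField (m := ⊤) (n := ⊤) (X.contMDiff x) (Y.contMDiff x)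
      (by simp)⟩⟩

lemma bracket_apply (X Y : VecField d M) (x : M) : ⁅X, Y⁆ x = mlieBracket (𝓡 d) X Y x := rfl

/-- The derivative of a function along a vector field. -/
instance : Bracket (VecField d M) (SmoothFun d M) :=
  ⟨fun X a => ⟨fun x => mvfderiv (𝓡 d) a x (X x), by
    have h1 : ContMDiff (𝓡 d).tangent 𝓘(ℝ, ℝ).tangent ∞ (tangentMap (𝓡 d) 𝓘(ℝ, ℝ) a) :=
      a.contMDiff.contMDiff_tangentMap (by simp)
    exact (contMDiff_snd_tangentBundle_modelSpace ℝ 𝓘(ℝ, ℝ)).comp (h1.comp X.contMDiff)⟩⟩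

lemma deriv_apply (X : VecField d M) (a : SmoothFun d M) (x : M) :
    ⁅X, a⁆ x = mvfderiv (𝓡 d) a x (X x) := rfl

instance : LieRing (VecField d M) where
  add_lie := fun X Y Z => by
    ext x
    exact mlieBracket_add_left (vf_mdiff X x) (vf_mdiff Y x)
  lie_add := fun X Y Z => by
    ext x
    exact mlieBracket_add_right (vf_mdiff Y x) (vf_mdiff Z x)
  lie_self := fun X => by
    ext x
    exact congrFun (mlieBracket_self (V := X)) x
  leibniz_lie := fun X Y Z => by
    ext x
    have : IsManifold (𝓡 d) (minSmoothness ℝ 3) M := manifold_three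
    exact congrFun (leibniz_identity_mlieBracket (X.contMDiff.of_le (by simpa using two_le_infty))
      (Y.contMDiff.of_le (by simpa using two_le_infty)) (Z.contMDiff.of_le (by simpa using two_le_infty))) x

instance : LieAlgebra ℝ (VecField d M) where
  lie_smul := fun c X Y => by
    ext x
    exact mlieBracket_const_smul_right (vf_mdiff Y x)

lemma local_product (Y : VecField d M) (a : SmoothFun d M) {Z : ∀ x : M, TangentSpace (𝓡 d) x}
    {x : M} (hZ : MDifferentiableAt (𝓡 d) (𝓡 d).tangent (fun y => (Z y : TangentBundle (𝓡 d) M)) x) :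
    mlieBracket (𝓡 d) Y ((a : M → ℝ) • Z) x =
      (((⁅Y, a⁆ : SmoothFun d M) : M → ℝ) • Z + (a : M → ℝ) • mlieBracket (𝓡 d) Y Z) x :=
  mlieBracket_smul_right (fun_mdiff a x) hZ

/-- `[X, Y] a = X (Y a) - Y (X a)`. -/
lemma deriv_bracket (X Y : VecField d M) (a : SmoothFun d M) :
    ⁅X, ⁅Y, a⁆⁆ = ⁅⁅X, Y⁆, a⁆ + ⁅Y, ⁅X, a⁆⁆ := by
  have : IsManifold (𝓡 d) (minSmoothness ℝ 3) M := manifold_three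
  have : IsManifold (𝓡 d) (minSmoothness ℝ 2) M := manifold_two
  have : IsManifold (𝓡 d) (((⊤ : ℕ∞) : ℕ∞ω) + 1) M := ‹IsManifold (𝓡 d) ∞ M›
  ext x
  by_cases hv : ∀ v : TangentSpace (𝓡 d) x, v = 0
  · have h0 : ∀ (W : VecField d M) (b : SmoothFun d M), ⁅W, b⁆ x = 0 := fun W b => by
      rw [deriv_apply, hv (W x), map_zero]
    change ⁅X, ⁅Y, a⁆⁆ x = ⁅⁅X, Y⁆, a⁆ x + ⁅Y, ⁅X, a⁆⁆ x
    rw [h0, h0, h0, add_zero]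
  push Not at hv
  obtain ⟨v, hv⟩ := hv
  obtain ⟨s, hs, hsm⟩ := FiberBundle.exists_contMDiffOn_extend (k := ∞) (𝓡 d)
    (EuclideanSpace ℝ (Fin d)) v
  set Z : ∀ y : M, TangentSpace (𝓡 d) y := FiberBundle.extend (EuclideanSpace ℝ (Fin d)) v with hZ
  have hZx : Z x = v := FiberBundle.extend_apply_self _ v
  have hZsm : ∀ᶠ y in nhds x, ContMDiffAt (𝓡 d) (𝓡 d).tangent ∞
      (fun y => (Z y : TangentBundle (𝓡 d) M)) y := by
    filter_upwards [eventually_eventually_nhds.2 hs] with y hy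
    exact hsm.contMDiffAt hy
  have hZd : ∀ᶠ y in nhds x, MDifferentiableAt (𝓡 d) (𝓡 d).tangent
      (fun y => (Z y : TangentBundle (𝓡 d) M)) y :=
    hZsm.mono fun y hy => hy.mdifferentiableAt (by simp)
  have hZ0 := hZsm.self_of_nhds
  have hbr : ∀ W : VecField d M, ContMDiffAt (𝓡 d) (𝓡 d).tangent ∞
      (fun y => (mlieBracket (𝓡 d) W Z y : TangentBundle (𝓡 d) M)) x := fun W =>
    ContMDiffAt.mlieBracket_vectorField (m := ⊤) (n := ⊤) (W.contMDiff x) hZ0 (by simp)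
  have expand : ∀ W W' : VecField d M,
      mlieBracket (𝓡 d) W (mlieBracket (𝓡 d) W' ((a : M → ℝ) • Z)) x =
        ⁅W, ⁅W', a⁆⁆ x • v + ⁅W', a⁆ x • mlieBracket (𝓡 d) W Z x +
        (⁅W, a⁆ x • mlieBracket (𝓡 d) W' Z x +
          a x • mlieBracket (𝓡 d) W (mlieBracket (𝓡 d) W' Z) x) := by
    intro W W'
    have he : mlieBracket (𝓡 d) W' ((a : M → ℝ) • Z) =ᶠ[nhds x]
        ((⁅W', a⁆ : SmoothFun d M) : M → ℝ) • Z + (a : M → ℝ) • mlieBracket (𝓡 d) W' Z :=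
      hZd.mono fun y hy => local_product W' a hy
    refine (Filter.EventuallyEq.mlieBracket_vectorField_eq
      (Filter.EventuallyEq.refl _ (W : ∀ y, TangentSpace (𝓡 d) y)) he).trans ?_
    rw [mlieBracket_add_right, local_product _ _ (ContMDiffAt.mdifferentiableAt hZ0 (by simp)),
      local_product _ _ (ContMDiffAt.mdifferentiableAt (hbr W') (by simp))]
    · simp only [Pi.add_apply, Pi.smul_apply', hZx]
    · exact ((ContMDiff.contMDiffAt (⁅W', a⁆ : SmoothFun d M).contMDiff).smul_section
        hZ0).mdifferentiableAt (by simp)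
    · exact ((ContMDiff.contMDiffAt a.contMDiff).smul_section (hbr W')).mdifferentiableAt (by simp)
  have jac : ∀ Z' : ∀ y : M, TangentSpace (𝓡 d) y, ContMDiffAt (𝓡 d) (𝓡 d).tangent ∞
      (fun y => (Z' y : TangentBundle (𝓡 d) M)) x →
      mlieBracket (𝓡 d) X (mlieBracket (𝓡 d) Y Z') x =
        mlieBracket (𝓡 d) (⁅X, Y⁆ : VecField d M) Z' x +
          mlieBracket (𝓡 d) Y (mlieBracket (𝓡 d) X Z') x := fun Z' hZ' =>
    leibniz_identity_mlieBracket_apply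
      ((X.contMDiff x).of_le (by simpa using two_le_infty))
      ((Y.contMDiff x).of_le (by simpa using two_le_infty))
      (hZ'.of_le (by simpa using two_le_infty))
  have h1 := jac _ ((ContMDiff.contMDiffAt a.contMDiff).smul_section hZ0)
  have h2 := jac Z hZ0
  rw [expand, expand, local_product _ _ (ContMDiffAt.mdifferentiableAt hZ0 (by simp)), h2] at h1
  simp only [Pi.add_apply, Pi.smul_apply', hZx, smul_add] at h1
  have h3 : (⁅X, ⁅Y, a⁆⁆ x - (⁅⁅X, Y⁆, a⁆ x + ⁅Y, ⁅X, a⁆⁆ x)) • v = 0 := by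
    rw [sub_smul, add_smul, sub_eq_zero]
    have h4 := sub_eq_zero.2 h1
    rw [← sub_eq_zero, ← h4]
    abel
  exact sub_eq_zero.1 ((smul_eq_zero.1 h3).resolve_right hv)

instance : LieRingModule (VecField d M) (SmoothFun d M) where
  add_lie := fun X Y a => by
    ext x
    exact map_add (mvfderiv (𝓡 d) a x) (X x) (Y x)
  lie_add := fun X a b => by
    ext x
    exact DFunLike.congr_fun (mvfderiv_add (fun_mdiff a x) (fun_mdiff b x)) (X x)
  leibniz_lie := deriv_bracket

lemma deriv_const (X : VecField d M) (c : ℝ) : ⁅X, algebraMap ℝ (SmoothFun d M) c⁆ = 0 := by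
  ext x
  exact DFunLike.congr_fun (mvfderiv_const (I := 𝓡 d) c) (X x)

instance : LieRinehartRing (SmoothFun d M) (VecField d M) where
  lie_smul_eq_mul' := fun a b X => by
    ext x
    exact map_smul (mvfderiv (𝓡 d) b x) (a x) (X x)
  leibniz_mul_right' := fun X a b => by
    ext x
    refine (DFunLike.congr_fun (mvfderiv_mul (fun_mdiff a x) (fun_mdiff b x)) (X x)).trans ?_
    change a x * mvfderiv (𝓡 d) b x (X x) + b x * mvfderiv (𝓡 d) a x (X x) =
      a x * mvfderiv (𝓡 d) b x (X x) + mvfderiv (𝓡 d) a x (X x) * b x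
    ring
  leibniz_smul_right' := fun X Y a => by
    ext x
    refine (mlieBracket_smul_right (fun_mdiff a x) (vf_mdiff Y x)).trans ?_
    exact add_comm _ _

instance : LieRinehartAlgebra ℝ (SmoothFun d M) (VecField d M) where
  smul_lie := fun c X a => by
    ext x
    exact map_smul (mvfderiv (𝓡 d) a x) c (X x)
  lie_smul := fun c X a => by
    rw [← algebraMap_smul (SmoothFun d M) c a, smul_eq_mul,
      LieRinehartRing.leibniz_mul_right, deriv_const, zero_mul, add_zero, algebraMap_smul]

end Tangent
end Geometry

namespace Geometry

open Bundle

variable (d : ℕ) (M : Type u) [TopologicalSpace M] [ChartedSpace (EuclideanSpace ℝ (Fin d)) M]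

/-- A smooth real vector bundle of finite rank on `M`. -/
structure VecBundle where
  model : Type v
  [normed : NormedAddCommGroup model]
  [space : NormedSpace ℝ model]
  [finite : FiniteDimensional ℝ model]
  fiber : M → Type v
  [topTotal : TopologicalSpace (TotalSpace model fiber)]
  [top : ∀ x, TopologicalSpace (fiber x)]
  [group : ∀ x, AddCommGroup (fiber x)]
  [module : ∀ x, Module ℝ (fiber x)]
  [fiberBundle : FiberBundle model fiber]
  [vectorBundle : VectorBundle ℝ model fiber]
  [smooth : ContMDiffVectorBundle ∞ model fiber (𝓡 d)]

attribute [instance] VecBundle.normed VecBundle.space VecBundle.finite VecBundle.topTotal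
  VecBundle.top VecBundle.group VecBundle.module VecBundle.fiberBundle VecBundle.vectorBundle
  VecBundle.smooth

/-- The bundle of rank zero. -/
def zeroBundle : VecBundle.{u, v} d M where
  model := PUnit.{v + 1}
  normed := inferInstance
  fiber := Bundle.Trivial M PUnit.{v + 1}

variable {d M}

/-- The module of smooth sections of a vector bundle. -/
abbrev VecBundle.Sections (E : VecBundle.{u, v} d M) : Type (max u v) :=
  Cₛ^∞⟮𝓡 d; E.model, E.fiber⟯

variable (d M) [IsManifold (𝓡 d) ∞ M]

/-- Real differential forms of degree `k` on `M`, as alternating `C^∞(M)`-multilinear maps from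
vector fields to smooth functions. -/
abbrev DiffForm (k : ℤ) : Type u := Cartan.Omega ℝ (SmoothFun d M) (VecField d M) (SmoothFun d M) k

/-- Closed differential forms. -/
abbrev ClosedForm (k : ℤ) : Submodule ℝ (DiffForm d M k) :=
  Cartan.closedForms ℝ (SmoothFun d M) (VecField d M) k

/-- De Rham cohomology of `M`. -/
abbrev DeRham (k : ℤ) : Type u := Cartan.deRham ℝ (SmoothFun d M) (VecField d M) k

variable {d M}

/-- The class of a closed form. -/
def deRhamClass {k : ℤ} (h : ClosedForm d M k) : DeRham d M k := Submodule.Quotient.mk h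

/-- The `k`-forms on `M` with values in `Hom(E, F)`: alternating `C^∞(M)`-multilinear maps from
vector fields to `C^∞(M)`-linear maps from sections of `E` to sections of `F`. -/
abbrev HomForm (E F : VecBundle.{u, v} d M) (k : ℤ) : Type (max u v) :=
  Cartan.Omega ℝ (SmoothFun d M) (VecField d M) (E.Sections →ₗ[SmoothFun d M] F.Sections) k

variable (d M)

/-- A vector bundle with a connection. -/
structure ConnBundle where
  bundle : VecBundle.{u, v} d M
  conn : Cartan.Connection ℝ (SmoothFun d M) (VecField d M) bundle.Sections

/-- The bundle of rank zero with its connection. -/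
def zeroConnBundle : ConnBundle.{u, v} d M where
  bundle := zeroBundle d M
  conn :=
    { toFun := 0
      leibniz := fun a w X => by
        ext x
        exact Subsingleton.elim (α := PUnit) _ _ }

variable {d M}

/-- The curved dg-category of vector bundles with connection on `M`. -/
def PPre (h : ClosedForm d M 2) : DG.CDGCategory.{0, max u (v + 1), max u v} ℝ where
  toCurvedCategory := Cartan.connCategory (Obj := ConnBundle.{u, v} d M)
    (fun E => E.bundle.Sections) (fun E => E.conn) h
  nonneg := fun E F n hn => by
    have key : ∀ f : HomForm E.bundle F.bundle n, f = 0 := fun f =>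
      Subtype.ext (funext fun m => f.2 m (by omega))
    exact ⟨fun f g => (key f).trans (key g).symm⟩
  pointed := ⟨zeroConnBundle d M, by
    apply Cartan.Omega.ext_ev
    funext l
    ext s x
    exact Subsingleton.elim (α := PUnit) _ _⟩

/-- The dg-category of `h`-curved graded vector bundles on `M`: twisted complexes over `PPre h`. -/
def PInfty (h : ClosedForm d M 2) : DG.DGCategory.{0, max u (v + 1), max u v} ℝ :=
  (PPre.{u, v} h).Tw

end Geometry

end

/-! The case [h] = 0. If h = dα, replacing each connection ∇ by ∇ - α does not change the
connections on the Hom bundles, and it lowers the curvature by dα = h. So (E, ∇) ↦ (E, ∇ - α) is a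
strict functor of curved dg-categories, bijective on morphisms and surjective on objects, and it
passes to twisted complexes (`shiftFunctor`, `CurvedFunctor.isQuasiEquivalence_tw`).

The case [h] ≠ 0. It suffices that every twisted complex is contractible. Auxiliary degrees are
non-negative and the diagonal of 𝔼 vanishes, so 𝔼 consists of maps D : E^p → E^{p+1} of auxiliary
degree zero and of components that strictly lower p. In auxiliary degrees 0, 1 and 2 the
Maurer-Cartan equation says that D² = 0, that D is parallel, and that ∇² = h·id + DU + VD for
suitable U and V (`Tw_diff_comp`, `Tw_diff_parallel`, `Tw_curvEnd`). A parallel map has constant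
rank, so the cohomology of D is a vector bundle, and ∇ induces on it a connection with curvature
h·id. But the trace of the curvature R of a connection on a real bundle is exact: for a metric g one
has d tr(g⁻¹∇g) = -2 tr R (`extD_trace_metricDeriv`). Cohomology of rank c ≠ 0 would make c·h, hence
h, exact. So the cohomology vanishes, and the complex (E, D) has a contraction by bundle maps. Seen
in the twisted complex, this contraction bounds the identity up to an endomorphism which strictly
lowers p and is therefore nilpotent, and then the identity itself is exact
(`id_mem_coboundaries_of_contraction`).

No quotient bundle is ever formed. Constancy of rank enters as the existence of an inner inverse T
with LTL = L of a parallel map L (`exists_inner_inverse`). The cohomology is the range of the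
idempotent `cohomProj` on the module of sections. This range has finite dual bases locally, which is
all that the theory of traces needs. -/

noncomputable section

/-! ### Exactness of identities in dg-categories, and criteria for quasi-equivalences -/

namespace DG

universe w u₁ v₁ u₂ v₂

variable {𝕜 : Type w} [CommRing 𝕜]

namespace DGCategory

variable (C : DGCategory.{w, u₁, v₁} 𝕜)

lemma d_eq_zero_of_mem_cocycles {E F : C.Obj} {m n : ℤ} (h : m + 1 = n) {f : C.Hom E F m}
    (hf : f ∈ C.cocycles E F m) : C.d h f = 0 := by
  subst h
  exact hf

lemma d_mem_coboundaries {E F : C.Obj} {m n : ℤ} (h : m + 1 = n) (f : C.Hom E F m) :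
    C.d h f ∈ C.coboundaries E F n := by
  obtain rfl : m = n - 1 := by omega
  exact ⟨f, rfl⟩

lemma coboundaries_le_cocycles {E F : C.Obj} {n : ℤ} {f : C.Hom E F n}
    (hf : f ∈ C.coboundaries E F n) : f ∈ C.cocycles E F n := by
  obtain ⟨g, rfl⟩ := hf
  exact C.d_d _ _ g

lemma id_mem_cocycles (E : C.Obj) : C.id E ∈ C.cocycles E E 0 := by
  have h := C.d_comp (add_zero 0) (zero_add 1) (zero_add 1) (zero_add 1) (add_zero 1) (zero_add 1)
    (C.id E) (C.id E)
  rw [C.id_comp (add_zero 0), C.comp_id (add_zero 1), C.id_comp (zero_add 1), Int.negOnePow_zero,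
    one_smul, left_eq_add] at h
  exact h

/-- For closed f the Leibniz rule reads d(y ∘ f) = dy ∘ f. -/
lemma comp_mem_coboundaries {E F G : C.Obj} {m n k : ℤ} (h : m + n = k) {g : C.Hom F G m}
    (hg : g ∈ C.coboundaries F G m) {f : C.Hom E F n} (hf : f ∈ C.cocycles E F n) :
    C.comp h g f ∈ C.coboundaries E G k := by
  obtain ⟨y, rfl⟩ := hg
  have e := C.d_comp (show m - 1 + n = k - 1 by omega) (sub_add_cancel m 1) rfl
    (sub_add_cancel k 1) h (by omega) y f
  rw [C.d_eq_zero_of_mem_cocycles rfl hf, map_zero, smul_zero, add_zero] at e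
  rw [← e]
  exact C.d_mem_coboundaries _ _

/-- If id = dy and f is closed of degree n, then d(f ∘ y) = (-1)^n f. -/
lemma mem_coboundaries_of_id {E F : C.Obj} (hE : C.id E ∈ C.coboundaries E E 0) {n : ℤ}
    {f : C.Hom E F n} (hf : f ∈ C.cocycles E F n) : f ∈ C.coboundaries E F n := by
  obtain ⟨y, hy⟩ := hE
  have e := C.d_comp (show n + (0 - 1) = n - 1 by omega) rfl (sub_add_cancel 0 1)
    (sub_add_cancel n 1) (by omega) (add_zero n) f y
  rw [C.d_eq_zero_of_mem_cocycles rfl hf, map_zero, LinearMap.zero_apply, zero_add, hy,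
    C.comp_id] at e
  have h2 := (C.coboundaries E F n).smul_mem ((n.negOnePow : ℤ) : 𝕜)
    (C.d_mem_coboundaries (sub_add_cancel n 1) (C.comp (show n + (0 - 1) = n - 1 by omega) f y))
  rw [e, Int.cast_smul_eq_zsmul, ← Units.smul_def, smul_smul] at h2
  simpa using h2

/-- Powers of an endomorphism of degree zero. -/
def pow {E : C.Obj} (f : C.Hom E E 0) : ℕ → C.Hom E E 0
  | 0 => C.id E
  | k + 1 => C.comp (add_zero 0) (pow f k) f

/-- Induction on id - f^(k+1) = (id - f) + (id - f^k) ∘ f. Applied to a nilpotent f, this makes the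
identity exact. -/
lemma id_sub_pow_mem_coboundaries {E : C.Obj} {f : C.Hom E E 0}
    (hf : C.id E - f ∈ C.coboundaries E E 0) (k : ℕ) :
    C.id E - C.pow f k ∈ C.coboundaries E E 0 := by
  induction k with
  | zero => simp [pow]
  | succ k ih =>
    have hc : f ∈ C.cocycles E E 0 := by
      have := (C.cocycles E E 0).sub_mem (C.id_mem_cocycles E) (C.coboundaries_le_cocycles hf)
      rwa [sub_sub_cancel] at this
    have h := (C.coboundaries E E 0).add_mem hf (C.comp_mem_coboundaries (add_zero 0) ih hc)
    rw [map_sub, LinearMap.sub_apply, C.id_comp] at h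
    simpa [pow] using h

end DGCategory

/-- Exact identities make every closed morphism exact, so all cohomology groups vanish. The object
`E₀` serves essential surjectivity only. -/
lemma QuasiEquivalent.zeroCategory {C : DGCategory.{w, u₁, v₁} 𝕜} (E₀ : C.Obj)
    (hC : ∀ E, C.id E ∈ C.coboundaries E E 0) : QuasiEquivalent C (zeroCategory 𝕜) := by
  let Φ : DGFunctor C (DG.zeroCategory 𝕜) :=
    { obj := fun _ => PUnit.unit
      map := 0
      map_id := fun _ => rfl
      map_comp := fun _ _ _ => rfl
      map_d := fun _ _ => rfl }
  refine ⟨Φ, fun E F n => ⟨?_, ?_⟩, fun Y => ⟨E₀, ?_⟩⟩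
  · intro x y _
    obtain ⟨x, rfl⟩ := Submodule.Quotient.mk_surjective _ x
    obtain ⟨y, rfl⟩ := Submodule.Quotient.mk_surjective _ y
    rw [Submodule.Quotient.eq]
    exact C.mem_coboundaries_of_id (hC E) (x - y).2
  · intro y
    obtain ⟨⟨y, hy⟩, rfl⟩ := Submodule.Quotient.mk_surjective _ y
    exact ⟨0, map_zero _⟩
  · exact ⟨0, 0, Submodule.zero_mem _, Submodule.zero_mem _, Submodule.zero_mem _,
      Submodule.zero_mem _⟩

lemma DGFunctor.isQuasiEquivalence_of_bijective {C : DGCategory.{w, u₁, v₁} 𝕜}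
    {D : DGCategory.{w, u₂, v₂} 𝕜} (Φ : DGFunctor C D)
    (hmap : ∀ (E F : C.Obj) (n : ℤ), Function.Bijective (Φ.map (E := E) (F := F) (n := n)))
    (hobj : Function.Surjective Φ.obj) : Φ.IsQuasiEquivalence where
  bijective E F n := by
    constructor
    · intro x y hxy
      obtain ⟨x, rfl⟩ := Submodule.Quotient.mk_surjective _ x
      obtain ⟨y, rfl⟩ := Submodule.Quotient.mk_surjective _ y
      rw [Submodule.Quotient.eq]
      obtain ⟨z, hz⟩ := (Submodule.Quotient.eq _).1 hxy
      obtain ⟨z, rfl⟩ := (hmap _ _ _).2 z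
      refine ⟨z, (hmap _ _ _).1 ?_⟩
      rw [Φ.map_d, hz]
      exact (map_sub Φ.map x.1 y.1).symm
    · intro y
      obtain ⟨⟨y, hy⟩, rfl⟩ := Submodule.Quotient.mk_surjective _ y
      obtain ⟨x, rfl⟩ := (hmap _ _ _).2 y
      refine ⟨Submodule.Quotient.mk ⟨x, (hmap _ _ _).1 ?_⟩, rfl⟩
      rw [Φ.map_d, map_zero]
      exact hy
  essSurj Y := by
    obtain ⟨X, rfl⟩ := hobj Y
    have hid : ∀ Z, D.comp (add_zero 0) (D.id Z) (D.id Z) - D.id Z ∈ D.coboundaries Z Z 0 :=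
      fun Z => by rw [D.id_comp, sub_self]; exact Submodule.zero_mem _
    exact ⟨X, D.id _, D.id _, D.id_mem_cocycles _, D.id_mem_cocycles _, hid _, hid _⟩

/-! ### Components of morphisms of twisted complexes, and nilpotence -/

namespace CDGCategory

open GradedCategory

variable (C : CDGCategory.{w, u₁, v₁} 𝕜)

/-- The constant sequence on a zero object qualifies: its set of nonzero entries is empty. -/
lemma nonempty_twistedComplex : Nonempty C.Tw.Obj := by
  obtain ⟨Z, hZ⟩ := C.pointed
  have hz : {n : ℤ | ¬ C.IsZero Z} = ∅ := by simp [hZ]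
  let S : Seq C.toGradedCategory := ⟨fun _ => Z, hz ▸ Set.finite_empty⟩
  let m : SeqHom S S 1 := 0
  exact ⟨TwistedComplex.mk S m (fun p => rfl) (funext fun p => funext fun q => hZ.to _)⟩

variable {C}

/-- The sequence of objects of a twisted complex. -/
def Tw.seq (E : C.Tw.Obj) : Seq C.toGradedCategory := TwistedComplex.seq E

/-- The components of the endomorphism of a twisted complex. -/
def Tw.mc (E : C.Tw.Obj) : SeqHom (Tw.seq E) (Tw.seq E) 1 := TwistedComplex.mc E

/-- Morphisms of twisted complexes as families of components. -/
def Tw.equivSeqHom (E F : C.Tw.Obj) (n : ℤ) :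
    C.Tw.Hom E F n ≃ₗ[𝕜] SeqHom (Tw.seq E) (Tw.seq F) n := LinearEquiv.refl 𝕜 _

/-- This and the next lemmas hold by definition. They present the structure of `C.Tw` through
families of components, so that the componentwise formulas can be used for rewriting. -/
lemma Tw.equivSeqHom_comp {E F G : C.Tw.Obj} {m n k : ℤ} (h : m + n = k) (g : C.Tw.Hom F G m)
    (f : C.Tw.Hom E F n) : Tw.equivSeqHom E G k (C.Tw.comp h g f) =
      seqComp h (Tw.equivSeqHom F G m g) (Tw.equivSeqHom E F n f) := rfl

lemma Tw.equivSeqHom_id (E : C.Tw.Obj) :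
    Tw.equivSeqHom E E 0 (C.Tw.id E) = diag fun p => C.id ((Tw.seq E).obj p) := rfl

lemma Tw.equivSeqHom_d {E F : C.Tw.Obj} {m n : ℤ} (h : m + 1 = n) (f : C.Tw.Hom E F m) :
    Tw.equivSeqHom E F n (C.Tw.d h f) = C.seqNabla h (Tw.equivSeqHom E F m f) +
      seqComp (show 1 + m = n by omega) (Tw.mc F) (Tw.equivSeqHom E F m f) -
      m.negOnePow • seqComp h (Tw.equivSeqHom E F m f) (Tw.mc E) := rfl

lemma Tw.mc_self (E : C.Tw.Obj) (p : ℤ) : Tw.mc E p p = 0 := TwistedComplex.mc_diag E p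

lemma Tw.mc_eq (E : C.Tw.Obj) : C.seqNabla (show (1 : ℤ) + 1 = 2 by norm_num) (Tw.mc E) +
    seqComp (show (1 : ℤ) + 1 = 2 by norm_num) (Tw.mc E) (Tw.mc E) +
      diag (fun p => C.curv ((Tw.seq E).obj p)) = 0 := TwistedComplex.mc_eq E

/-- The k-th power lowers the position by at least k, while the nonzero objects occupy a bounded
range of positions. -/
lemma pow_eq_zero_of_lower {E : C.Tw.Obj} {f : C.Tw.Hom E E 0}
    (hf : ∀ p q : ℤ, ¬ q < p → Tw.equivSeqHom E E 0 f p q = 0) :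
    ∃ k, C.Tw.pow f k = 0 := by
  have key : ∀ (k : ℕ) (p q : ℤ), ¬ q + k ≤ p →
      Tw.equivSeqHom E E 0 (C.Tw.pow f k) p q = 0 := by
    intro k
    induction k with
    | zero =>
      intro p q h
      rw [DGCategory.pow, Tw.equivSeqHom_id]
      exact diag_ne _ (by intro e; apply h; simp [e])
    | succ k ih =>
      intro p r h
      rw [DGCategory.pow, Tw.equivSeqHom_comp, seqComp_apply]
      refine Finset.sum_eq_zero fun q _ => ?_
      by_cases h1 : q < p
      · rw [ih q r (by push_cast at h; omega), map_zero, LinearMap.zero_apply, smul_zero]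
      · rw [hf p q h1, map_zero, smul_zero]
  obtain ⟨B, hB⟩ := (Tw.seq E).finite.bddAbove
  obtain ⟨b, hb⟩ := (Tw.seq E).finite.bddBelow
  -- All nonzero objects sit between positions b and B, so a drop by more than B - b starts or ends
  -- at a zero object.
  refine ⟨(B - b).toNat + 1, (Tw.equivSeqHom E E 0).injective ?_⟩
  rw [map_zero]
  funext p q
  by_cases hp : C.IsZero ((Tw.seq E).obj p)
  · exact hp.from _
  by_cases hq : C.IsZero ((Tw.seq E).obj q)
  · exact hq.to _
  have h1 := hB hp
  have h2 := hb hq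
  refine key _ p q ?_
  push_cast
  omega

/-- A twisted complex is contractible as soon as its identity is exact up to strictly decreasing
components. -/
lemma id_mem_coboundaries_of_lower {E : C.Tw.Obj} (s : C.Tw.Hom E E (-1))
    (hs : ∀ p q : ℤ, ¬ q < p → Tw.equivSeqHom E E 0 (C.Tw.d (neg_add_cancel 1) s) p q =
      Tw.equivSeqHom E E 0 (C.Tw.id E) p q) : C.Tw.id E ∈ C.Tw.coboundaries E E 0 := by
  -- Here id - f = ds is exact and f strictly lowers the position. Hence id - f^k is exact for every
  -- k, and f^k = 0 for some k.
  set f : C.Tw.Hom E E 0 := C.Tw.id E - C.Tw.d (neg_add_cancel 1) s with hf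
  have h1 : C.Tw.id E - f ∈ C.Tw.coboundaries E E 0 := by
    rw [hf, sub_sub_cancel]
    exact C.Tw.d_mem_coboundaries _ _
  obtain ⟨k, hk⟩ := pow_eq_zero_of_lower (f := f) fun p q hpq => by
    rw [hf, map_sub, Pi.sub_apply, Pi.sub_apply, hs p q hpq, sub_self]
  have := C.Tw.id_sub_pow_mem_coboundaries h1 k
  rwa [hk, sub_zero] at this

end CDGCategory

end DG

/-! ### Subtracting a scalar one-form from a connection -/

namespace Cartan

section Shift

variable {𝕜 A L W W₂ : Type*} [CommRing 𝕜] [CommRing A] [Algebra 𝕜 A] [LieRing L]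
  [LieAlgebra 𝕜 L] [Module A L] [LieRingModule L A] [LieRinehartRing A L]
  [LieRinehartAlgebra 𝕜 A L]
  [AddCommGroup W] [Module A W] [Module 𝕜 W] [IsScalarTower 𝕜 A W]
  [AddCommGroup W₂] [Module A W₂] [Module 𝕜 W₂] [IsScalarTower 𝕜 A W₂]

/-- The linear map on vectors given by the degree one part of a form. -/
def Omega.toLinear {k : ℤ} (f : Omega 𝕜 A L W k) : L →ₗ[A] W where
  toFun X := f.1.ev [X]
  map_add' X Y := (f.1.isForm []).1 X Y []
  map_smul' a X := (f.1.isForm []).2.1 a X []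

lemma Omega.toLinear_apply {k : ℤ} (f : Omega 𝕜 A L W k) (X : L) : f.toLinear X = f.1.ev [X] := rfl

lemma ev_extD_pair {k l : ℤ} (h : k + 1 = l) (f : Omega 𝕜 A L A k) (X Y : L) :
    (extD 𝕜 A L h f).1.ev [X, Y] =
      ⁅X, f.1.ev [Y]⁆ - ⁅Y, f.1.ev [X]⁆ - f.1.ev [⁅X, Y⁆] := by
  rw [extD, Connection.ev_d]
  simp only [rawD, rawLie, rawIota]
  change ⁅X, f.1.ev [Y]⁆ - f.1.ev [⁅X, Y⁆] - (⁅Y, f.1.ev [X]⁆ - 0) = _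
  abel

lemma Omega.ext_pair {f g : Omega 𝕜 A L W 2} (h : ∀ X Y, f.1.ev [X, Y] = g.1.ev [X, Y]) :
    f = g := by
  apply Omega.ext_ev
  funext v
  by_cases hv : (v.length : ℤ) = 2
  · match v with
    | [] => simp at hv
    | [X] => simp at hv
    | [X, Y] => exact h X Y
    | X :: Y :: Z :: v => simp at hv; omega
  · rw [omega_conc f v hv, omega_conc g v hv]

lemma scalarForm_add {k : ℤ} (f g : Omega 𝕜 A L A k) :
    scalarForm W (f + g) = scalarForm W f + scalarForm W g := by
  apply Omega.ext_ev
  funext v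
  ext w
  rw [Omega.ev_add, Pi.add_apply, LinearMap.add_apply, ev_scalarForm, ev_scalarForm,
    ev_scalarForm, Omega.ev_add, Pi.add_apply, add_smul]

lemma Connection.ext_nab {D D' : Connection 𝕜 A L W} (h : ∀ X w, D.nab X w = D'.nab X w) :
    D = D' := by
  cases D
  cases D'
  congr 1
  ext w X
  exact h X w

/-- The connection `∇ - α`. -/
def Connection.shift (D : Connection 𝕜 A L W) (α : L →ₗ[A] A) : Connection 𝕜 A L W where
  toFun :=
    { toFun := fun w => D.toFun w - α.smulRight w
      map_add' := fun w w' => by ext X; simp; abel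
      map_smul' := fun c w => by ext X; simp [smul_sub, smul_comm (α X) c w] }
  leibniz := fun a w X => by simp [D.leibniz, smul_sub, smul_comm (α X) a w]; abel

lemma Connection.shift_nab (D : Connection 𝕜 A L W) (α : L →ₗ[A] A) (X : L) (w : W) :
    (D.shift α).nab X w = D.nab X w - α X • w := rfl

/-- Scalars commute with homomorphisms, so the two contributions of α cancel. -/
lemma Connection.shift_hom_shift (D : Connection 𝕜 A L W) (D₂ : Connection 𝕜 A L W₂)
    (α : L →ₗ[A] A) : (D.shift α).hom (D₂.shift α) = D.hom D₂ := by
  refine Connection.ext_nab fun X f => ?_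
  ext s
  simp only [hom_nab, shift_nab, map_sub, map_smul]
  abel

lemma Connection.shift_shift_neg (D : Connection 𝕜 A L W) (α : L →ₗ[A] A) :
    (D.shift (-α)).shift α = D := by
  refine Connection.ext_nab fun X w => ?_
  simp [shift_nab]

/-- This is (∇ - α)² = ∇² - dα, where α ∧ α drops out because scalars commute. The degree of α is a
variable k, because exactness of a two-form provides a form of degree `2 - 1`. -/
lemma Connection.shift_curv (D : Connection 𝕜 A L W) {k : ℤ} (h : k + 1 = 2)
    (α : Omega 𝕜 A L A k) :
    (D.shift α.toLinear).curv = D.curv - scalarForm W (extD 𝕜 A L h α) := by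
  apply Omega.ext_pair
  intro X Y
  rw [Omega.ev_sub, Connection.ev_curv, Connection.ev_curv, Pi.sub_apply]
  ext w
  rw [LinearMap.sub_apply, ev_scalarForm, ev_extD_pair]
  simp only [rawTwo, Connection.curvEnd_apply, shift_nab, D.isConn.sub, D.isConn.smul, smul_sub,
    sub_smul, Omega.toLinear_apply, smul_smul, mul_comm]
  abel

lemma Connection.shift_curv_sub (D : Connection 𝕜 A L W) {k : ℤ} (h : k + 1 = 2)
    (α : Omega 𝕜 A L A k) {f g : Omega 𝕜 A L A 2} (hfg : f = g + extD 𝕜 A L h α) :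
    (D.shift α.toLinear).curv - scalarForm W g = D.curv - scalarForm W f := by
  rw [Connection.shift_curv _ h, hfg, scalarForm_add]
  abel

end Shift

end Cartan

/-! ### Strict functors of curved dg-categories and the induced functors on twisted complexes -/

namespace DG

open GradedCategory

universe w u₁ v₁ u₂ v₂

variable {𝕜 : Type w} [CommRing 𝕜]

/-- A strict functor of curved dg-categories. -/
structure CurvedFunctor (C : CurvedCategory.{w, u₁, v₁} 𝕜) (D : CurvedCategory.{w, u₂, v₂} 𝕜) where
  obj : C.Obj → D.Obj
  map : ∀ {E F : C.Obj} {n : ℤ}, C.Hom E F n →ₗ[𝕜] D.Hom (obj E) (obj F) n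
  map_id : ∀ E, map (C.id E) = D.id (obj E)
  map_comp : ∀ {E F G : C.Obj} {m n k : ℤ} (h : m + n = k) (g : C.Hom F G m) (f : C.Hom E F n),
    map (C.comp h g f) = D.comp h (map g) (map f)
  map_nabla : ∀ {E F : C.Obj} {m n : ℤ} (h : m + 1 = n) (f : C.Hom E F m),
    map (C.nabla h f) = D.nabla h (map f)
  map_curv : ∀ E, map (C.curv E) = D.curv (obj E)

namespace CurvedFunctor

section Curved

variable {C : CurvedCategory.{w, u₁, v₁} 𝕜} {D : CurvedCategory.{w, u₂, v₂} 𝕜}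
  (Φ : CurvedFunctor C D)

lemma isZero_obj {E : C.Obj} (hE : C.IsZero E) : D.IsZero (Φ.obj E) := by
  rw [GradedCategory.IsZero, ← Φ.map_id, hE, map_zero]

lemma map_degCast {E F : C.Obj} {m n : ℤ} (h : m = n) (f : C.Hom E F m) :
    Φ.map (degCast h f) = degCast h (Φ.map f) := by
  subst h
  rfl

/-- The image of a bounded sequence. -/
def seqObj (E : Seq C.toGradedCategory) : Seq D.toGradedCategory :=
  ⟨fun p => Φ.obj (E.obj p), E.finite.subset fun _ hp hE => hp (Φ.isZero_obj hE)⟩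

/-- The functor on morphisms of sequences. -/
def seqMap {E F : Seq C.toGradedCategory} {n : ℤ} :
    SeqHom E F n →ₗ[𝕜] SeqHom (Φ.seqObj E) (Φ.seqObj F) n where
  toFun f p q := Φ.map (f p q)
  map_add' f g := by funext p q; exact map_add _ _ _
  map_smul' c f := by funext p q; exact map_smul _ _ _

lemma seqMap_apply {E F : Seq C.toGradedCategory} {n : ℤ} (f : SeqHom E F n) (p q : ℤ) :
    Φ.seqMap f p q = Φ.map (f p q) := rfl

lemma seqMap_diag {E : Seq C.toGradedCategory} {n : ℤ} (x : ∀ p, C.Hom (E.obj p) (E.obj p) n) :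
    Φ.seqMap (diag x) = diag (E := Φ.seqObj E) fun p => Φ.map (x p) := by
  funext p q
  by_cases h : p = q
  · subst h
    exact (congrArg Φ.map (diag_self x p)).trans
      ((Φ.map_degCast _ _).trans (diag_self (E := Φ.seqObj E) (fun p => Φ.map (x p)) p).symm)
  · exact (congrArg Φ.map (diag_ne x h)).trans
      ((map_zero _).trans (diag_ne (E := Φ.seqObj E) _ h).symm)

lemma seqMap_comp {E F G : Seq C.toGradedCategory} {m n k : ℤ} (h : m + n = k) (g : SeqHom F G m)
    (f : SeqHom E F n) : Φ.seqMap (seqComp h g f) = seqComp h (Φ.seqMap g) (Φ.seqMap f) := by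
  funext p r
  rw [seqMap_apply, seqComp_apply, seqComp_apply, map_sum]
  symm
  -- Composition sums over the nonzero middle objects, and Φ may send a nonzero object to zero. So
  -- the sum in the target runs over a possibly smaller set of indices; the additional terms factor
  -- through zero objects.
  refine (Finset.sum_subset ?_ ?_).trans (Finset.sum_congr rfl fun q _ => ?_)
  · intro q hq
    rw [Set.Finite.mem_toFinset] at hq ⊢
    exact fun hz => hq (Φ.isZero_obj hz)
  · intro q _ hq
    rw [Set.Finite.mem_toFinset, Set.mem_ofPred_eq, not_not] at hq
    rw [hq.to (Φ.seqMap f p q), map_zero, smul_zero]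
  · rw [smul_map_unit, Φ.map_comp]
    rfl

lemma seqMap_nabla {E F : Seq C.toGradedCategory} {m n : ℤ} (h : m + 1 = n) (f : SeqHom E F m) :
    Φ.seqMap (C.seqNabla h f) = D.seqNabla h (Φ.seqMap f) := by
  funext p q
  exact Φ.map_nabla _ _

end Curved

variable {C : CDGCategory.{w, u₁, v₁} 𝕜} {D : CDGCategory.{w, u₂, v₂} 𝕜}
  (Φ : CurvedFunctor C.toCurvedCategory D.toCurvedCategory)

open CDGCategory

/-- The functor on twisted complexes. -/
def twObj (E : C.Tw.Obj) : D.Tw.Obj :=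
  TwistedComplex.mk (Φ.seqObj (Tw.seq E)) (Φ.seqMap (Tw.mc E))
    (fun p => by
      rw [seqMap_apply, Tw.mc_self]
      exact map_zero _)
    (by
      have h := congrArg Φ.seqMap (Tw.mc_eq E)
      rw [map_add, map_add, seqMap_comp, seqMap_nabla, seqMap_diag, map_zero] at h
      simp only [Φ.map_curv] at h
      exact h)

/-- The dg-functor of categories of twisted complexes induced by a functor of curved
dg-categories. -/
def tw : DGFunctor C.Tw D.Tw where
  obj := Φ.twObj
  map := Φ.seqMap
  map_id E := by
    refine (Φ.seqMap_diag _).trans ?_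
    simp only [Φ.map_id]
    rfl
  map_comp h g f := Φ.seqMap_comp h _ _
  map_d {E F m n} h f := by
    have e := congrArg Φ.seqMap (Tw.equivSeqHom_d h f)
    rw [map_sub, map_add, smul_map_unit, seqMap_comp, seqMap_comp, seqMap_nabla] at e
    exact e

lemma isQuasiEquivalence_tw
    (hmap : ∀ (E F : C.Obj) (n : ℤ), Function.Bijective (Φ.map (E := E) (F := F) (n := n)))
    (hobj : Function.Surjective Φ.obj) : Φ.tw.IsQuasiEquivalence := by
  have hmap' : ∀ (E F : Seq C.toGradedCategory) (n : ℤ),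
      Function.Bijective (Φ.seqMap (E := E) (F := F) (n := n)) := by
    refine fun E F n => ⟨fun f g hfg => ?_, fun g => ?_⟩
    · funext p q
      exact (hmap _ _ _).1 (congrFun (congrFun hfg p) q)
    · choose f hf using fun p q => (hmap (E.obj p) (F.obj q) (n - (q - p))).2 (g p q)
      exact ⟨f, funext fun p => funext fun q => hf p q⟩
  refine DGFunctor.isQuasiEquivalence_of_bijective _ (fun E F n => hmap' _ _ n) ?_
  rintro ⟨⟨obj, hfin⟩, m, h1, h2⟩
  -- Replacing the objects by literal images lets the lifted twisted complex map to the given one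
  -- definitionally.
  obtain ⟨X, rfl⟩ : ∃ X : ℤ → C.Obj, obj = fun p => Φ.obj (X p) := by
    choose X hX using hobj
    exact ⟨fun p => X (obj p), funext fun p => (hX (obj p)).symm⟩
  -- A functor that is injective on morphisms of degree zero reflects zero objects.
  have hfin' : {p | ¬ C.IsZero (X p)}.Finite := by
    refine hfin.subset fun p hp hz => hp ((hmap _ _ 0).1 ?_)
    rw [Φ.map_id, map_zero]
    exact hz
  -- The endomorphism lifts by surjectivity on morphisms. Its vanishing diagonal and the
  -- Maurer-Cartan equation lift by injectivity.
  obtain ⟨m, rfl⟩ := (hmap' ⟨X, hfin'⟩ ⟨X, hfin'⟩ 1).2 m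
  refine ⟨TwistedComplex.mk ⟨X, hfin'⟩ m (fun p => (hmap _ _ _).1 ?_) ((hmap' _ _ _).1 ?_), rfl⟩
  · exact (h1 p).trans (map_zero _).symm
  · have e : Φ.seqMap (C.seqNabla (show (1 : ℤ) + 1 = 2 by norm_num) m +
        seqComp (show (1 : ℤ) + 1 = 2 by norm_num) m m +
          diag (E := ⟨X, hfin'⟩) (fun p => C.curv (X p))) = Φ.seqMap 0 := by
      rw [map_add, map_add, seqMap_comp, seqMap_nabla, seqMap_diag, map_zero]
      simp only [Φ.map_curv]
      exact h2
    exact e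

end CurvedFunctor

end DG

/-! ### The functor (E, ∇) ↦ (E, ∇ - α) and the case of an exact two-form -/

namespace Geometry

open DG GradedCategory CDGCategory

variable {d : ℕ} {M : Type u} [TopologicalSpace M] [ChartedSpace (EuclideanSpace ℝ (Fin d)) M]
  [IsManifold (𝓡 d) ∞ M]

/-- Subtraction of a one-form from the connection. -/
def ConnBundle.shift (E : ConnBundle.{u, v} d M) (α : VecField d M →ₗ[SmoothFun d M] SmoothFun d M) :
    ConnBundle.{u, v} d M := ⟨E.bundle, E.conn.shift α⟩

lemma ConnBundle.shift_shift_neg (E : ConnBundle.{u, v} d M)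
    (α : VecField d M →ₗ[SmoothFun d M] SmoothFun d M) : (E.shift (-α)).shift α = E := by
  cases E with
  | mk B D => exact congrArg (ConnBundle.mk B) (D.shift_shift_neg α)

/-- This and the next three lemmas hold by definition. They express the structure of `PPre h` by
forms; composition and identities visibly do not depend on h or on the connections. -/
lemma PPre_comp (h : ClosedForm d M 2) {E F G : ConnBundle.{u, v} d M} {m n k : ℤ}
    (hk : m + n = k) (g : HomForm F.bundle G.bundle m) (f : HomForm E.bundle F.bundle n) :
    (PPre.{u, v} h).comp (E := E) (F := F) (G := G) hk g f =
      Cartan.wedge (Cartan.compHom (SmoothFun d M) E.bundle.Sections F.bundle.Sections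
        G.bundle.Sections) hk g f := rfl

lemma PPre_id (h : ClosedForm d M 2) (E : ConnBundle.{u, v} d M) :
    (PPre.{u, v} h).id E =
      Cartan.idForm ℝ (SmoothFun d M) (VecField d M) E.bundle.Sections := rfl

lemma PPre_nabla (h : ClosedForm d M 2) {E F : ConnBundle.{u, v} d M} {m n : ℤ}
    (hm : m + 1 = n) (f : HomForm E.bundle F.bundle m) :
    (PPre.{u, v} h).nabla (E := E) (F := F) hm f = (E.conn.hom F.conn).d hm f := rfl

lemma PPre_curv (h : ClosedForm d M 2) (E : ConnBundle.{u, v} d M) :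
    (PPre.{u, v} h).curv E =
      E.conn.curv - Cartan.scalarForm E.bundle.Sections h.1 := rfl

/-- The bundle with connection underlying an object of `PPre h`. -/
def PPre_conn {h : ClosedForm d M 2} (E : (PPre.{u, v} h).Obj) : ConnBundle.{u, v} d M := E

/-- Morphisms of `PPre h` as forms. -/
def PPre_equiv {h : ClosedForm d M 2} (E F : (PPre.{u, v} h).Obj) (n : ℤ) :
    (PPre.{u, v} h).Hom E F n ≃ₗ[ℝ] HomForm (PPre_conn E).bundle (PPre_conn F).bundle n :=
  LinearEquiv.refl ℝ _

/-- Subtraction of a one-form from the connection, as a map of objects. -/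
def PPre_shift {h : ClosedForm d M 2} (h' : ClosedForm d M 2)
    (α : VecField d M →ₗ[SmoothFun d M] SmoothFun d M)
    (E : (PPre.{u, v} h).Obj) : (PPre.{u, v} h').Obj := (PPre_conn E).shift α

/-- The bijection on morphisms given by the change of connections. -/
def PPre_shiftEquiv {h : ClosedForm d M 2} (h' : ClosedForm d M 2)
    (α : VecField d M →ₗ[SmoothFun d M] SmoothFun d M) (E F : (PPre.{u, v} h).Obj) (n : ℤ) :
    (PPre.{u, v} h).Hom E F n ≃ₗ[ℝ]
      (PPre.{u, v} h').Hom (PPre_shift h' α E) (PPre_shift h' α F) n :=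
  (PPre_equiv E F n).trans (PPre_equiv (PPre_shift h' α E) (PPre_shift h' α F) n).symm

lemma PPre_shiftEquiv_id {h : ClosedForm d M 2} (h' : ClosedForm d M 2)
    (α : VecField d M →ₗ[SmoothFun d M] SmoothFun d M) (E : (PPre.{u, v} h).Obj) :
    PPre_shiftEquiv h' α E E 0 ((PPre.{u, v} h).id E) =
      (PPre.{u, v} h').id (PPre_shift h' α E) :=
  (PPre_id h' (PPre_conn (PPre_shift h' α E))).symm

lemma PPre_shiftEquiv_comp {h : ClosedForm d M 2} (h' : ClosedForm d M 2)
    (α : VecField d M →ₗ[SmoothFun d M] SmoothFun d M) {E F G : (PPre.{u, v} h).Obj} {m n k : ℤ}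
    (hk : m + n = k) (g : (PPre.{u, v} h).Hom F G m) (f : (PPre.{u, v} h).Hom E F n) :
    PPre_shiftEquiv h' α E G k ((PPre.{u, v} h).comp hk g f) =
      (PPre.{u, v} h').comp hk (PPre_shiftEquiv h' α F G m g) (PPre_shiftEquiv h' α E F n f) :=
  (PPre_comp h' (E := PPre_shift h' α E) (F := PPre_shift h' α F) (G := PPre_shift h' α G) hk
    (PPre_equiv F G m g) (PPre_equiv E F n f)).symm

lemma PPre_shiftEquiv_nabla {h : ClosedForm d M 2} (h' : ClosedForm d M 2)
    (α : VecField d M →ₗ[SmoothFun d M] SmoothFun d M) {E F : (PPre.{u, v} h).Obj} {m n : ℤ}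
    (hm : m + 1 = n) (f : (PPre.{u, v} h).Hom E F m) :
    PPre_shiftEquiv h' α E F n ((PPre.{u, v} h).nabla hm f) =
      (PPre.{u, v} h').nabla hm (PPre_shiftEquiv h' α E F m f) := by
    refine Eq.trans ?_ (PPre_nabla h' (E := PPre_shift h' α E) (F := PPre_shift h' α F) hm
      (PPre_equiv E F m f)).symm
    exact congrArg (fun D => Cartan.Connection.d D hm (PPre_equiv E F m f))
      (Cartan.Connection.shift_hom_shift (PPre_conn E).conn (PPre_conn F).conn α).symm

lemma PPre_shiftEquiv_curv {h : ClosedForm d M 2} (h' : ClosedForm d M 2)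
    {k : ℤ} (hk : k + 1 = 2) (α : DiffForm d M k)
    (hα : h.1 = h'.1 + Cartan.extD ℝ (SmoothFun d M) (VecField d M) hk α)
    (E : (PPre.{u, v} h).Obj) :
    PPre_shiftEquiv h' α.toLinear E E 2 ((PPre.{u, v} h).curv E) =
      (PPre.{u, v} h').curv (PPre_shift h' α.toLinear E) := by
    refine Eq.trans ?_ (PPre_curv h' (PPre_shift h' α.toLinear E)).symm
    exact (Cartan.Connection.shift_curv_sub (PPre_conn E).conn hk α hα).symm

/-- The functor `(E, ∇) ↦ (E, ∇ - α)`. -/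
def shiftFunctor {h h' : ClosedForm d M 2} {k : ℤ} (hk : k + 1 = 2) (α : DiffForm d M k)
    (hα : h.1 = h'.1 + Cartan.extD ℝ (SmoothFun d M) (VecField d M) hk α) :
    CurvedFunctor (PPre.{u, v} h).toCurvedCategory (PPre.{u, v} h').toCurvedCategory where
  obj := PPre_shift h' α.toLinear
  map {E F n} := (PPre_shiftEquiv h' α.toLinear E F n).toLinearMap
  map_id E := PPre_shiftEquiv_id h' α.toLinear E
  map_comp hk g f := PPre_shiftEquiv_comp h' α.toLinear hk g f
  map_nabla hm f := PPre_shiftEquiv_nabla h' α.toLinear hm f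
  map_curv E := PPre_shiftEquiv_curv h' hk α hα E

lemma quasiEquivalent_of_deRhamClass_eq_zero (h : ClosedForm d M 2) (hh : deRhamClass h = 0) :
    QuasiEquivalent (PInfty.{u, v} h) (PInfty.{u, v} (0 : ClosedForm d M 2)) := by
  obtain ⟨α, hα⟩ := (Submodule.Quotient.mk_eq_zero _).1 hh
  have hα' : h.1 = (0 : ClosedForm d M 2).1 +
      Cartan.extD ℝ (SmoothFun d M) (VecField d M) (sub_add_cancel 2 1) α := by
    rw [hα]
    exact (zero_add h.1).symm
  -- On morphisms the functor is the identity of forms. It is surjective on objects because adding α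
  -- back undoes it.
  refine ⟨(shiftFunctor (sub_add_cancel 2 1) α hα').tw, CurvedFunctor.isQuasiEquivalence_tw _
    (fun E F n => (PPre_shiftEquiv 0 α.toLinear E F n).bijective)
    fun E => ⟨PPre_shift h (-α.toLinear) E, (PPre_conn E).shift_shift_neg α.toLinear⟩⟩

end Geometry

/-! ### Traces over smooth functions by means of local dual bases -/

namespace Geometry

variable {d : ℕ} {M : Type u} [TopologicalSpace M] [ChartedSpace (EuclideanSpace ℝ (Fin d)) M]

section Trace

variable {W W' : Type*} [AddCommGroup W] [Module (SmoothFun d M) W]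
  [AddCommGroup W'] [Module (SmoothFun d M) W']

/-- A finite dual basis of `W` on the set where `f` does not vanish. -/
def IsDualBasis {n : ℕ} (s : Fin n → W) (φ : Fin n → W →ₗ[SmoothFun d M] SmoothFun d M)
    (f : SmoothFun d M) : Prop := ∀ w, f • w = f • ∑ i, φ i w • s i

variable (W) in
/-- Modules with finite dual bases around every point. -/
class LocallyProjective : Prop where
  exists_dualBasis : ∀ x : M, ∃ (n : ℕ) (s : Fin n → W)
    (φ : Fin n → W →ₗ[SmoothFun d M] SmoothFun d M) (f : SmoothFun d M), f x ≠ 0 ∧ IsDualBasis s φ f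

lemma IsDualBasis.apply {n : ℕ} {s : Fin n → W} {φ : Fin n → W →ₗ[SmoothFun d M] SmoothFun d M}
    {f : SmoothFun d M} (h : IsDualBasis s φ f) (ψ : W →ₗ[SmoothFun d M] W') (w : W) :
    f • ψ w = f • ∑ i, φ i w • ψ (s i) := by
  rw [← map_smul, h w, map_smul, map_sum]
  simp only [map_smul]

/-- Expanding S(s_i) in the second dual basis and T(s'_j) in the first turns both sides into the
double sum of φ'_j(S s_i) φ_i(T s'_j). For S = id this says that the trace is independent of the
dual basis, and in general that tr(TS) = tr(ST). -/
lemma IsDualBasis.sum_comm {n n' : ℕ} {s : Fin n → W}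
    {φ : Fin n → W →ₗ[SmoothFun d M] SmoothFun d M} {f : SmoothFun d M} (h : IsDualBasis s φ f)
    {s' : Fin n' → W'} {φ' : Fin n' → W' →ₗ[SmoothFun d M] SmoothFun d M} {f' : SmoothFun d M}
    (h' : IsDualBasis s' φ' f') (S : W →ₗ[SmoothFun d M] W') (T : W' →ₗ[SmoothFun d M] W) :
    f * f' * ∑ i, φ i (T (S (s i))) = f * f' * ∑ j, φ' j (S (T (s' j))) := by
  have h1 : f' * ∑ i, φ i (T (S (s i))) = f' * ∑ i, ∑ j, φ' j (S (s i)) * φ i (T (s' j)) := by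
    rw [Finset.mul_sum, Finset.mul_sum]
    refine Finset.sum_congr rfl fun i _ => ?_
    have := h'.apply (φ i ∘ₗ T) (S (s i))
    simpa only [smul_eq_mul, LinearMap.comp_apply] using this
  have h2 : f * ∑ j, φ' j (S (T (s' j))) = f * ∑ j, ∑ i, φ i (T (s' j)) * φ' j (S (s i)) := by
    rw [Finset.mul_sum, Finset.mul_sum]
    refine Finset.sum_congr rfl fun j _ => ?_
    have := h.apply (φ' j ∘ₗ S) (T (s' j))
    simpa only [smul_eq_mul, LinearMap.comp_apply] using this
  rw [mul_assoc, h1, mul_comm f f', mul_assoc f', h2, Finset.sum_comm, mul_left_comm]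
  simp only [mul_comm (φ _ _)]

lemma IsDualBasis.sum_comm_apply {n n' : ℕ} {s : Fin n → W}
    {φ : Fin n → W →ₗ[SmoothFun d M] SmoothFun d M} {f : SmoothFun d M} (h : IsDualBasis s φ f)
    {s' : Fin n' → W'} {φ' : Fin n' → W' →ₗ[SmoothFun d M] SmoothFun d M} {f' : SmoothFun d M}
    (h' : IsDualBasis s' φ' f') (S : W →ₗ[SmoothFun d M] W') (T : W' →ₗ[SmoothFun d M] W)
    {x : M} (hf : f x ≠ 0) (hf' : f' x ≠ 0) :
    (∑ i, φ i (T (S (s i)))) x = (∑ j, φ' j (S (T (s' j)))) x := by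
  have := DFunLike.congr_fun (h.sum_comm h' S T) x
  exact mul_left_cancel₀ (mul_ne_zero hf hf') this

variable [hW : LocallyProjective (d := d) (M := M) W] [hW' : LocallyProjective (d := d) (M := M) W']

/-- The trace of an endomorphism, as a function. -/
def traceAux (T : W →ₗ[SmoothFun d M] W) (x : M) : ℝ :=
  (∑ i, (hW.exists_dualBasis x).choose_spec.choose_spec.choose i
    (T ((hW.exists_dualBasis x).choose_spec.choose i))) x

lemma traceAux_eq (T : W →ₗ[SmoothFun d M] W) {n : ℕ} {s : Fin n → W}
    {φ : Fin n → W →ₗ[SmoothFun d M] SmoothFun d M} {f : SmoothFun d M} (h : IsDualBasis s φ f)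
    {x : M} (hx : f x ≠ 0) : traceAux T x = (∑ i, φ i (T (s i))) x := by
  obtain ⟨h1, h2⟩ := (hW.exists_dualBasis x).choose_spec.choose_spec.choose_spec.choose_spec
  exact h2.sum_comm_apply h LinearMap.id T h1 hx

lemma contMDiff_traceAux (T : W →ₗ[SmoothFun d M] W) :
    ContMDiff (𝓡 d) 𝓘(ℝ, ℝ) ∞ (traceAux T) := by
  intro x
  obtain ⟨n, s, φ, f, hf, h⟩ := hW.exists_dualBasis x
  refine ((∑ i, φ i (T (s i)) : SmoothFun d M).contMDiff x).congr_of_eventuallyEq ?_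
  filter_upwards [f.contMDiff.continuous.continuousAt.eventually_ne hf] with y hy
  exact traceAux_eq T h hy

variable (W) in
/-- The trace of endomorphisms of a locally projective module. -/
def trace : (W →ₗ[SmoothFun d M] W) →ₗ[SmoothFun d M] SmoothFun d M where
  toFun T := ⟨traceAux T, contMDiff_traceAux T⟩
  map_add' S T := by
    ext x
    obtain ⟨n, s, φ, f, hf, h⟩ := hW.exists_dualBasis x
    change traceAux _ x = traceAux _ x + traceAux _ x
    rw [traceAux_eq _ h hf, traceAux_eq _ h hf, traceAux_eq _ h hf]
    simp only [LinearMap.add_apply, map_add, Finset.sum_add_distrib]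
    rfl
  map_smul' a T := by
    ext x
    obtain ⟨n, s, φ, f, hf, h⟩ := hW.exists_dualBasis x
    change traceAux _ x = a x * traceAux _ x
    rw [traceAux_eq _ h hf, traceAux_eq _ h hf]
    simp only [LinearMap.smul_apply, map_smul, ← Finset.smul_sum]
    rfl

lemma trace_apply (T : W →ₗ[SmoothFun d M] W) {n : ℕ} {s : Fin n → W}
    {φ : Fin n → W →ₗ[SmoothFun d M] SmoothFun d M} {f : SmoothFun d M} (h : IsDualBasis s φ f)
    {x : M} (hx : f x ≠ 0) : trace W T x = (∑ i, φ i (T (s i))) x := traceAux_eq T h hx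

/-- The factor f turns the pointwise formula into an identity of global functions, which can be
differentiated. -/
lemma mul_trace (T : W →ₗ[SmoothFun d M] W) {n : ℕ} {s : Fin n → W}
    {φ : Fin n → W →ₗ[SmoothFun d M] SmoothFun d M} {f : SmoothFun d M} (h : IsDualBasis s φ f) :
    f * trace W T = f * ∑ i, φ i (T (s i)) := by
  ext x
  change f x * trace W T x = f x * (∑ i, φ i (T (s i)) : SmoothFun d M) x
  by_cases hx : f x = 0
  · rw [hx, zero_mul, zero_mul]
  · rw [trace_apply T h hx]

lemma trace_comp_comm (S : W →ₗ[SmoothFun d M] W') (T : W' →ₗ[SmoothFun d M] W) :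
    trace W (T ∘ₗ S) = trace W' (S ∘ₗ T) := by
  ext x
  obtain ⟨n, s, φ, f, hf, h⟩ := hW.exists_dualBasis x
  obtain ⟨n', s', φ', f', hf', h'⟩ := hW'.exists_dualBasis x
  rw [trace_apply _ h hf, trace_apply _ h' hf']
  exact h.sum_comm_apply h' S T hf hf'

lemma trace_smulRight (ψ : W →ₗ[SmoothFun d M] SmoothFun d M) (w : W) :
    trace W (ψ.smulRight w) = ψ w := by
  ext x
  obtain ⟨n, s, φ, f, hf, h⟩ := hW.exists_dualBasis x
  rw [trace_apply _ h hf]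
  refine mul_left_cancel₀ hf ?_
  have := DFunLike.congr_fun (h.apply ψ w) x
  simp only [smul_eq_mul] at this
  refine Eq.trans ?_ this.symm
  simp only [LinearMap.smulRight_apply, map_smul, smul_eq_mul, mul_comm]
  rfl

end Trace

/-! ### Covariant derivatives and the trace -/

section Deriv

variable [IsManifold (𝓡 d) ∞ M] {W : Type*} [AddCommGroup W] [Module (SmoothFun d M) W]
  [Module ℝ W] [IsScalarTower ℝ (SmoothFun d M) W]

/-- The derivative of functions along vector fields as a connection. -/
abbrev funConn (d : ℕ) (M : Type*) [TopologicalSpace M]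
    [ChartedSpace (EuclideanSpace ℝ (Fin d)) M] [IsManifold (𝓡 d) ∞ M] :
    Cartan.Connection ℝ (SmoothFun d M) (VecField d M) (SmoothFun d M) :=
  Cartan.scalarConn ℝ (SmoothFun d M) (VecField d M)

lemma funConn_nab (X : VecField d M) (a : SmoothFun d M) : (funConn d M).nab X a = ⁅X, a⁆ := rfl

lemma nab_sum (D : Cartan.Connection ℝ (SmoothFun d M) (VecField d M) W) (X : VecField d M)
    {ι : Type*} [Fintype ι] (w : ι → W) : D.nab X (∑ i, w i) = ∑ i, D.nab X (w i) := by
  simp [Cartan.Connection.nab, map_sum, LinearMap.sum_apply]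

/-- Locality of connections in algebraic form. Differentiating f w = 0 and multiplying by f leaves
f² ∇_X w, because the term f (X f) w vanishes. -/
lemma sq_smul_nab (D : Cartan.Connection ℝ (SmoothFun d M) (VecField d M) W) (X : VecField d M)
    {f : SmoothFun d M} {w : W} (h : f • w = 0) : (f * f) • D.nab X w = 0 := by
  have h1 := D.isConn.smul X f w
  rw [h, D.nab_zero] at h1
  have h2 := congrArg (f • ·) h1
  simp only [smul_zero, smul_add, smul_smul] at h2
  rw [mul_comm f ⁅X, f⁆, mul_smul ⁅X, f⁆, h, smul_zero, add_zero] at h2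
  exact h2.symm

/-- Where f does not vanish, ∑ φ_i ⊗ s_i is the identity endomorphism, and the identity is parallel.
-/
lemma IsDualBasis.smul_nab {D : Cartan.Connection ℝ (SmoothFun d M) (VecField d M) W}
    {n : ℕ} {s : Fin n → W} {φ : Fin n → W →ₗ[SmoothFun d M] SmoothFun d M}
    {f : SmoothFun d M} (h : IsDualBasis s φ f) (X : VecField d M) (w : W) :
    (f * f) • ∑ i, ((D.hom (funConn d M)).nab X (φ i) w • s i + φ i w • D.nab X (s i)) = 0 := by
  have h1 : f • (w - ∑ i, φ i w • s i) = 0 := by rw [smul_sub, ← h w, sub_self]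
  have h2 := sq_smul_nab D X h1
  have h3 : D.nab X w - D.nab X (∑ i, φ i w • s i) = (D.nab X w - ∑ i, φ i (D.nab X w) • s i) -
      ∑ i, ((D.hom (funConn d M)).nab X (φ i) w • s i + φ i w • D.nab X (s i)) := by
    rw [nab_sum, sub_sub, ← Finset.sum_add_distrib]
    congr 1
    refine Finset.sum_congr rfl fun i _ => ?_
    rw [D.isConn.smul, Cartan.Connection.hom_nab, funConn_nab, sub_smul]
    abel
  rw [D.isConn.sub, h3, smul_sub, sub_eq_zero, mul_smul, smul_sub, ← h, sub_self, smul_zero] at h2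
  exact h2.symm

variable [hW : LocallyProjective (d := d) (M := M) W]

/-- Differentiating ∑ φ_i(T s_i) produces ∑ φ_i((∇_X T) s_i) and the terms in which φ_i or s_i is
differentiated. The latter cancel because the identity is parallel. -/
lemma lie_trace (D : Cartan.Connection ℝ (SmoothFun d M) (VecField d M) W) (X : VecField d M)
    (T : W →ₗ[SmoothFun d M] W) : ⁅X, trace W T⁆ = trace W ((D.hom D).nab X T) := by
  ext x
  obtain ⟨n, s, φ, f, hf, h⟩ := hW.exists_dualBasis x
  have h1 : f • (trace W T - ∑ i, φ i (T (s i))) = 0 := by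
    rw [smul_eq_mul, mul_sub, mul_trace T h, sub_self]
  have h2 := sq_smul_nab (funConn d M) X h1
  rw [funConn_nab, lie_sub, smul_sub, sub_eq_zero] at h2
  have h3 : ⁅X, ∑ i, φ i (T (s i))⁆ = (∑ i, φ i ((D.hom D).nab X T (s i))) +
      ∑ i, ((D.hom (funConn d M)).nab X (φ i) (T (s i)) + φ i (T (D.nab X (s i)))) := by
    rw [← Finset.sum_add_distrib, ← funConn_nab, nab_sum]
    refine Finset.sum_congr rfl fun i _ => ?_
    rw [Cartan.Connection.hom_nab, Cartan.Connection.hom_nab, map_sub]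
    abel
  -- The error term is the trace of T ∘ ∇_X(∑ φ_i ⊗ s_i), written as a sum of rank-one
  -- endomorphisms.
  have h4 : (f * f) * ∑ i, ((D.hom (funConn d M)).nab X (φ i) (T (s i)) +
      φ i (T (D.nab X (s i)))) = 0 := by
    have h5 : (f * f) • ∑ i, (((D.hom (funConn d M)).nab X (φ i)).smulRight (T (s i)) +
        (φ i).smulRight (T (D.nab X (s i)))) = 0 := by
      ext1 w
      have := congrArg T (h.smul_nab (D := D) X w)
      simp only [map_smul, map_zero, map_sum, map_add] at this
      simpa only [LinearMap.smul_apply, LinearMap.sum_apply, LinearMap.add_apply,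
        LinearMap.smulRight_apply, LinearMap.zero_apply] using this
    have h6 := congrArg (trace W) h5
    simp only [map_smul, map_zero, map_sum, map_add, trace_smulRight] at h6
    exact h6
  have hff : f x * f x ≠ 0 := mul_ne_zero hf hf
  refine mul_left_cancel₀ hff ?_
  rw [h3, smul_add, smul_eq_mul, smul_eq_mul, smul_eq_mul, h4, add_zero] at h2
  refine (DFunLike.congr_fun h2 x).trans ?_
  rw [trace_apply _ h hf]
  rfl

end Deriv

/-! ### Exactness of the trace of the curvature -/

section Metric

variable {W : Type*} [AddCommGroup W] [Module (SmoothFun d M) W]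

/-- The adjoint with respect to a pairing. -/
def adj (G : W ≃ₗ[SmoothFun d M] (W →ₗ[SmoothFun d M] SmoothFun d M))
    (T : W →ₗ[SmoothFun d M] W) : W →ₗ[SmoothFun d M] W :=
  G.symm.toLinearMap ∘ₗ T.lcomp (SmoothFun d M) (SmoothFun d M) ∘ₗ G.toLinearMap

lemma adj_apply (G : W ≃ₗ[SmoothFun d M] (W →ₗ[SmoothFun d M] SmoothFun d M))
    (T : W →ₗ[SmoothFun d M] W) (s t : W) : G (adj G T s) t = G s (T t) := by
  simp [adj]

variable [hW : LocallyProjective (d := d) (M := M) W]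

/-- By symmetry, the elements G⁻¹(φ_i) with the functionals G(s_i) form a dual basis again. The
trace of T in it is, term by term, the trace of the adjoint in the original one. -/
lemma trace_adj {G : W ≃ₗ[SmoothFun d M] (W →ₗ[SmoothFun d M] SmoothFun d M)}
    (hG : ∀ s t, G s t = G t s) (T : W →ₗ[SmoothFun d M] W) :
    trace W (adj G T) = trace W T := by
  ext x
  obtain ⟨n, s, φ, f, hf, h⟩ := hW.exists_dualBasis x
  have h' : IsDualBasis (fun i => G.symm (φ i)) (fun i => G (s i)) f := by
    intro w
    apply G.injective
    ext1 v
    have := h.apply (G w) v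
    simp only [map_smul, map_sum, LinearEquiv.apply_symm_apply, LinearMap.smul_apply,
      LinearMap.sum_apply]
    rw [this]
    congr 1
    refine Finset.sum_congr rfl fun i _ => ?_
    rw [hG w, smul_eq_mul, smul_eq_mul, mul_comm]
  rw [trace_apply _ h hf, trace_apply _ h' hf]
  congr 1
  refine Finset.sum_congr rfl fun i _ => ?_
  have e := adj_apply G T (s i) (G.symm (φ i))
  rw [hG, LinearEquiv.apply_symm_apply] at e
  exact e

variable [IsManifold (𝓡 d) ∞ M] [Module ℝ W] [IsScalarTower ℝ (SmoothFun d M) W]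

/-- The connection on bilinear forms. -/
abbrev bilinConn (D : Cartan.Connection ℝ (SmoothFun d M) (VecField d M) W) :=
  D.hom (D.hom (funConn d M))

/-- The endomorphism corresponding to the covariant derivative of a pairing. -/
def metricDeriv (G : W ≃ₗ[SmoothFun d M] (W →ₗ[SmoothFun d M] SmoothFun d M))
    (D : Cartan.Connection ℝ (SmoothFun d M) (VecField d M) W) (X : VecField d M) :
    W →ₗ[SmoothFun d M] W := G.symm.toLinearMap ∘ₗ (bilinConn D).nab X G.toLinearMap

lemma comp_metricDeriv (G : W ≃ₗ[SmoothFun d M] (W →ₗ[SmoothFun d M] SmoothFun d M))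
    (D : Cartan.Connection ℝ (SmoothFun d M) (VecField d M) W) (X : VecField d M) :
    G.toLinearMap ∘ₗ metricDeriv G D X = (bilinConn D).nab X G.toLinearMap := by
  ext1 w
  simp [metricDeriv]

/-- Both sides are G⁻¹ applied to the curvature of the connection on bilinear forms, evaluated at
the form G. With θ_X = G⁻¹∇_X G, the left side computes it from the second covariant derivatives of
G; the right side is its natural action -G(R s, t) - G(s, R t). -/
lemma metricDeriv_curv (G : W ≃ₗ[SmoothFun d M] (W →ₗ[SmoothFun d M] SmoothFun d M))
    (D : Cartan.Connection ℝ (SmoothFun d M) (VecField d M) W) (X Y : VecField d M) :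
    metricDeriv G D X ∘ₗ metricDeriv G D Y - metricDeriv G D Y ∘ₗ metricDeriv G D X +
      (D.hom D).nab X (metricDeriv G D Y) - (D.hom D).nab Y (metricDeriv G D X) -
      metricDeriv G D ⁅X, Y⁆ = -D.curvEnd X Y - adj G (D.curvEnd X Y) := by
  have hinj : ∀ S T : W →ₗ[SmoothFun d M] W, G.toLinearMap ∘ₗ S = G.toLinearMap ∘ₗ T → S = T := by
    intro S T h
    ext1 w
    exact G.injective (LinearMap.congr_fun h w)
  -- The product rule applied to ∇_Y G = G θ_Y.
  have hleib : ∀ X Y, (bilinConn D).nab X ((bilinConn D).nab Y G.toLinearMap) =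
      G.toLinearMap ∘ₗ (metricDeriv G D X ∘ₗ metricDeriv G D Y +
        (D.hom D).nab X (metricDeriv G D Y)) := by
    intro X Y
    rw [LinearMap.comp_add, ← LinearMap.comp_assoc, comp_metricDeriv, ← comp_metricDeriv G D Y]
    refine LinearMap.ext fun w => LinearMap.ext fun t => ?_
    simp only [Cartan.Connection.hom_nab, LinearMap.comp_apply, LinearMap.add_apply,
      LinearMap.sub_apply, map_sub]
    abel
  apply hinj
  have hsplit : G.toLinearMap ∘ₗ (metricDeriv G D X ∘ₗ metricDeriv G D Y -
      metricDeriv G D Y ∘ₗ metricDeriv G D X + (D.hom D).nab X (metricDeriv G D Y) -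
      (D.hom D).nab Y (metricDeriv G D X) - metricDeriv G D ⁅X, Y⁆) =
      (bilinConn D).curvEnd X Y G.toLinearMap := by
    rw [Cartan.Connection.curvEnd_apply, hleib, hleib, ← comp_metricDeriv]
    simp only [LinearMap.comp_add, LinearMap.comp_sub]
    abel
  rw [hsplit]
  refine LinearMap.ext fun s => LinearMap.ext fun t => ?_
  have h1 : ∀ a : SmoothFun d M, ⁅⁅X, Y⁆, a⁆ = ⁅X, ⁅Y, a⁆⁆ - ⁅Y, ⁅X, a⁆⁆ := fun a => lie_lie X Y a
  have h2 := adj_apply G (D.curvEnd X Y) s t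
  simp only [Cartan.Connection.curvEnd_apply, Cartan.Connection.hom_nab, LinearMap.comp_apply,
    LinearMap.sub_apply, LinearMap.neg_apply, LinearEquiv.coe_coe, map_sub, map_neg, h1, h2,
    funConn_nab, lie_sub]
  abel

/-- Taking traces in `metricDeriv_curv` removes the commutator, turns covariant derivatives into
derivatives of traces, and identifies the traces of R and of its adjoint. The left side is d(tr
θ)(X, Y). -/
lemma extD_trace_metricDeriv {G : W ≃ₗ[SmoothFun d M] (W →ₗ[SmoothFun d M] SmoothFun d M)}
    (hG : ∀ s t, G s t = G t s)
    (D : Cartan.Connection ℝ (SmoothFun d M) (VecField d M) W) (X Y : VecField d M) :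
    ⁅X, trace W (metricDeriv G D Y)⁆ - ⁅Y, trace W (metricDeriv G D X)⁆ -
      trace W (metricDeriv G D ⁅X, Y⁆) = (-2 : ℝ) • trace W (D.curvEnd X Y) := by
  have h := congrArg (trace W) (metricDeriv_curv G D X Y)
  rw [map_sub, map_sub, map_add, map_sub, map_sub, map_neg, trace_adj hG,
    trace_comp_comm (metricDeriv G D X), sub_self, zero_add, ← lie_trace, ← lie_trace] at h
  rw [h, neg_smul, two_smul]
  abel

/-- A linear map on vector fields as a one-form. -/
def oneForm (α : VecField d M →ₗ[SmoothFun d M] SmoothFun d M) : DiffForm d M 1 :=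
  Subtype.mk (fun n => match n with
    | 1 => AlternatingMap.ofSubsingleton (SmoothFun d M) (VecField d M) (SmoothFun d M) (0 : Fin 1) α
    | _ => 0) fun n hn => by
      match n with
      | 0 => rfl
      | 1 => exact absurd rfl hn
      | n + 2 => rfl

lemma ev_oneForm (α : VecField d M →ₗ[SmoothFun d M] SmoothFun d M) (X : VecField d M) :
    (oneForm α).1.ev [X] = α X := rfl

/-- The linear map `X ↦ c tr (g⁻¹ ∇_X g)`. -/
def traceMetricDeriv (G : W ≃ₗ[SmoothFun d M] (W →ₗ[SmoothFun d M] SmoothFun d M))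
    (D : Cartan.Connection ℝ (SmoothFun d M) (VecField d M) W) (c : ℝ) :
    VecField d M →ₗ[SmoothFun d M] SmoothFun d M where
  toFun X := c • trace W (metricDeriv G D X)
  map_add' X Y := by
    rw [metricDeriv, (bilinConn D).isConn.add_vec, LinearMap.comp_add, map_add, smul_add]
    rfl
  map_smul' a X := by
    rw [metricDeriv, (bilinConn D).isConn.smul_vec, LinearMap.comp_smul, map_smul, smul_comm]
    rfl

/-- If a locally projective module of constant nonzero rank with a perfect symmetric pairing has a
connection with scalar curvature `h`, then `h` is exact. -/
lemma exists_extD_eq_of_curvEnd {G : W ≃ₗ[SmoothFun d M] (W →ₗ[SmoothFun d M] SmoothFun d M)}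
    (hG : ∀ s t, G s t = G t s)
    (D : Cartan.Connection ℝ (SmoothFun d M) (VecField d M) W) (h : DiffForm d M 2) {c : ℝ}
    (hc : c ≠ 0) (htr : trace W LinearMap.id = algebraMap ℝ (SmoothFun d M) c)
    (hcurv : ∀ X Y, D.curvEnd X Y = h.1.ev [X, Y] • LinearMap.id) :
    ∃ α : DiffForm d M 1, Cartan.extD ℝ (SmoothFun d M) (VecField d M) one_add_one_eq_two α = h := by
  -- The factor is forced by d tr(g⁻¹∇g) = -2 tr R = -2c·h.
  refine ⟨oneForm (traceMetricDeriv G D (-(2 * c)⁻¹)), Cartan.Omega.ext_pair fun X Y => ?_⟩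
  rw [Cartan.ev_extD_pair, ev_oneForm, ev_oneForm, ev_oneForm]
  have e := extD_trace_metricDeriv hG D X Y
  rw [hcurv, map_smul, htr] at e
  change ⁅X, (-(2 * c)⁻¹) • trace W (metricDeriv G D Y)⁆ -
    ⁅Y, (-(2 * c)⁻¹) • trace W (metricDeriv G D X)⁆ -
    (-(2 * c)⁻¹) • trace W (metricDeriv G D ⁅X, Y⁆) = _
  rw [lie_smul, lie_smul, ← smul_sub, ← smul_sub, e]
  ext x
  change -(2 * c)⁻¹ * (-2 * (h.1.ev [X, Y] x * c)) = h.1.ev [X, Y] x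
  field_simp

end Metric

end Geometry

/-! ### Bump functions and local frames by global sections -/

namespace Geometry

open Bundle Filter Topology

section Bump

variable {d : ℕ} {M : Type*} [TopologicalSpace M] [ChartedSpace (EuclideanSpace ℝ (Fin d)) M]
  [IsManifold (𝓡 d) ∞ M] [T2Space M]

lemma exists_bump {x : M} {U : Set M} (hU : U ∈ 𝓝 x) :
    ∃ χ : SmoothFun d M, χ =ᶠ[𝓝 x] 1 ∧ tsupport χ ⊆ U ∧ ∀ y, χ y ≤ 1 := by
  obtain ⟨f, -, hf⟩ := (SmoothBumpFunction.nhds_basis_tsupport (I := 𝓡 d) x).mem_iff.1 hU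
  exact ⟨⟨f, f.contMDiff⟩, f.eventuallyEq_one, hf, fun y => f.le_one⟩

/-- The function b = a / (a² + 1 - χ), with a bump function χ ≤ 1 supported where a ≠ 0, is smooth
everywhere and equals 1/a where χ = 1. -/
lemma exists_eventually_mul_eq_one {a : SmoothFun d M} {x : M} (ha : a x ≠ 0) :
    ∃ b : SmoothFun d M, a * b =ᶠ[𝓝 x] 1 := by
  have hc : Continuous a := a.contMDiff.continuous
  obtain ⟨χ, h1, h2, h3⟩ := exists_bump (d := d) (hc.continuousAt.eventually_ne ha)
  have hpos : ∀ y, 0 < a y * a y + (1 - χ y) := by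
    intro y
    by_cases hy : a y = 0
    · have : χ y = 0 := by
        by_contra hχ
        exact h2 (subset_tsupport _ hχ) hy
      simp [hy, this]
    · have := mul_self_pos.2 hy
      linarith [h3 y]
  refine ⟨⟨fun y => a y / (a y * a y + (1 - χ y)), a.contMDiff.div₀
    ((a.contMDiff.mul a.contMDiff).add (contMDiff_const.sub χ.contMDiff))
    fun y => (hpos y).ne'⟩, ?_⟩
  filter_upwards [h1] with y hy
  change a y * (a y / (a y * a y + (1 - χ y))) = 1
  have := hpos y
  rw [hy] at this ⊢
  simp only [Pi.one_apply, sub_self, add_zero] at this ⊢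
  rw [← mul_div_assoc, div_self this.ne']

variable {F : Type*} [NormedAddCommGroup F] [NormedSpace ℝ F] {V : M → Type*}
  [TopologicalSpace (TotalSpace F V)] [∀ x, TopologicalSpace (V x)] [∀ x, AddCommGroup (V x)]
  [∀ x, Module ℝ (V x)] [FiberBundle F V] [VectorBundle ℝ F V]

lemma sum_section_apply {ι : Type*} (S : Finset ι) (t : ι → Cₛ^∞⟮𝓡 d; F, V⟯) (y : M) :
    (∑ i ∈ S, t i) y = ∑ i ∈ S, t i y :=
  (congrFun (map_sum (ContMDiffSection.coeAddHom (𝓡 d) F ∞ V) t S) y).trans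
    (Finset.sum_apply y S fun i => ⇑(t i))

lemma sum_fun_apply {ι : Type*} (S : Finset ι) (t : ι → SmoothFun d M) (y : M) :
    (∑ i ∈ S, t i) y = ∑ i ∈ S, t i y :=
  (congrFun (map_sum (ContMDiffMap.coeFnAddMonoidHom (I := 𝓡 d) (I' := 𝓘(ℝ, ℝ)) (n := ∞)) t S)
    y).trans (Finset.sum_apply y S fun i => ⇑(t i))

/-- Local sections extend, after shrinking their domain. -/
lemma exists_section_eventuallyEq {ι : Type*} {x : M} {U : Set M} (hU : IsOpen U) (hx : x ∈ U)
    {t : ι → ∀ y, V y}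
    (ht : ∀ i, ContMDiffOn (𝓡 d) ((𝓡 d).prod 𝓘(ℝ, F)) ∞ (fun y => TotalSpace.mk' F y (t i y)) U) :
    ∃ s : ι → Cₛ^∞⟮𝓡 d; F, V⟯, ∀ᶠ y in 𝓝 x, ∀ i, s i y = t i y := by
  obtain ⟨χ, h1, h2, -⟩ := exists_bump (d := d) (hU.mem_nhds hx)
  refine ⟨fun i => ⟨fun y => χ y • t i y,
    ContMDiffOn.smul_section_of_tsupport χ.contMDiff.contMDiffOn hU h2 (ht i)⟩, ?_⟩
  filter_upwards [h1] with y hy i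
  change χ y • t i y = t i y
  rw [hy, Pi.one_apply, one_smul]

/-- This converts local equality into an equality of global sections, to which linear maps and
connections can be applied. -/
lemma smul_eq_smul_of_eqOn {χ : SmoothFun d M} {s t : Cₛ^∞⟮𝓡 d; F, V⟯} {U : Set M}
    (hχ : tsupport χ ⊆ U) (h : ∀ y ∈ U, s y = t y) : χ • s = χ • t := by
  ext y
  change χ y • s y = χ y • t y
  by_cases hy : χ y = 0
  · rw [hy, zero_smul, zero_smul]
  · rw [h y (hχ (subset_tsupport _ hy))]

/-- A frame of a vector bundle around a point, in terms of global sections. -/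
structure FrameAt (d : ℕ) {M : Type*} [TopologicalSpace M]
    [ChartedSpace (EuclideanSpace ℝ (Fin d)) M] (F : Type*) [NormedAddCommGroup F]
    [NormedSpace ℝ F] (V : M → Type*)
    [TopologicalSpace (TotalSpace F V)] [∀ x, TopologicalSpace (V x)] [∀ x, AddCommGroup (V x)]
    [∀ x, Module ℝ (V x)] [FiberBundle F V] [VectorBundle ℝ F V] (x : M) where
  n : ℕ
  s : Fin n → Cₛ^∞⟮𝓡 d; F, V⟯
  φ : Fin n → Cₛ^∞⟮𝓡 d; F, V⟯ →ₗ[SmoothFun d M] SmoothFun d M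
  f : SmoothFun d M
  f_eq : f =ᶠ[𝓝 x] 1
  dual : IsDualBasis s φ f
  mul_apply : ∀ i j, f * φ i (s j) = if i = j then f else 0
  apply_eq_zero : ∀ i w y, w y = 0 → φ i w y = 0

lemma nonempty_frameAt [FiniteDimensional ℝ F] [ContMDiffVectorBundle ∞ F V (𝓡 d)] (x : M) :
    Nonempty (FrameAt d F V x) := by
  have : ContMDiffVectorBundle 1 F V (𝓡 d) := ContMDiffVectorBundle.of_le (n := ∞) (by simp)
  set e := trivializationAt F V x
  let b := Module.finBasis ℝ F
  have hx : x ∈ e.baseSet := mem_baseSet_trivializationAt F V x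
  obtain ⟨s, hs⟩ := exists_section_eventuallyEq (d := d) e.open_baseSet hx
    (fun i => e.contMDiffOn_localFrame_baseSet ∞ b i)
  -- The coefficient functionals of the frame exist only over the trivializing set, so they are cut
  -- off by χ.
  obtain ⟨χ, h1, h2, -⟩ := exists_bump (d := d) (e.open_baseSet.mem_nhds hx)
  let φ : Fin (Module.finrank ℝ F) → Cₛ^∞⟮𝓡 d; F, V⟯ →ₗ[SmoothFun d M] SmoothFun d M := fun i =>
    { toFun := fun w => ⟨fun y => χ y * e.localFrameCoeff (𝓡 d) b i y (w y), by
        refine contMDiff_of_tsupport fun y hy => ?_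
        have hy' : y ∈ e.baseSet := h2 (closure_mono (Function.support_mul_subset_left _ _) hy)
        exact (χ.contMDiff y).mul (contMDiffAt_localFrameCoeff b hy' (w.contMDiff y) i)⟩
      map_add' := fun w w' => by
        ext y
        change χ y * e.localFrameCoeff (𝓡 d) b i y (w y + w' y) =
          χ y * e.localFrameCoeff (𝓡 d) b i y (w y) + χ y * e.localFrameCoeff (𝓡 d) b i y (w' y)
        rw [map_add, mul_add]
      map_smul' := fun a w => by
        ext y
        change χ y * e.localFrameCoeff (𝓡 d) b i y (a y • w y) =
          a y * (χ y * e.localFrameCoeff (𝓡 d) b i y (w y))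
        rw [map_smul, smul_eq_mul, mul_left_comm] }
  have hφ : ∀ i w y, φ i w y = χ y * e.localFrameCoeff (𝓡 d) b i y (w y) := fun _ _ _ => rfl
  -- A second bump function, supported where the sections s agree with the frame and where χ = 1.
  -- There the cut-off data are an honest frame and its dual.
  obtain ⟨f, hf1, hf2, -⟩ := exists_bump (d := d)
    (hs.and (h1.and (e.open_baseSet.mem_nhds hx)))
  have key : ∀ y, f y ≠ 0 → (∀ i, s i y = e.localFrame b i y) ∧ χ y = 1 ∧ y ∈ e.baseSet :=
    fun y hy => hf2 (subset_tsupport _ hy)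
  refine ⟨⟨Module.finrank ℝ F, s, φ, f, hf1, fun w => ?_, fun i j => ?_, fun i w y hw => ?_⟩⟩
  · ext y
    change f y • w y = f y • (∑ i, φ i w • s i) y
    by_cases hy : f y = 0
    · rw [hy, zero_smul, zero_smul]
    obtain ⟨k1, k2, k3⟩ := key y hy
    congr 1
    rw [e.eq_sum_localFrameCoeff_smul (I := 𝓡 d) (b := b) (s := w) k3,
      sum_section_apply]
    refine Finset.sum_congr rfl fun i _ => ?_
    change _ = φ i w y • s i y
    rw [hφ, k1, k2, one_mul]
  · ext y
    change f y * φ i (s j) y = _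
    by_cases hy : f y = 0
    · rw [hy, zero_mul]
      split_ifs
      · exact hy.symm
      · rfl
    obtain ⟨k1, k2, k3⟩ := key y hy
    rw [hφ, k1, k2, one_mul, e.localFrameCoeff_apply_of_mem_baseSet b k3 (e.localFrame b j),
      e.localFrame_apply_of_mem_baseSet b k3, Module.Basis.repr_self, Finsupp.single_apply]
    simp only [eq_comm (a := j)]
    split_ifs
    · exact mul_one _
    · exact mul_zero _
  · rw [hφ, hw, map_zero, mul_zero]

instance [FiniteDimensional ℝ F] [ContMDiffVectorBundle ∞ F V (𝓡 d)] :
    LocallyProjective (d := d) (M := M) Cₛ^∞⟮𝓡 d; F, V⟯ where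
  exists_dualBasis x := by
    obtain ⟨e⟩ := nonempty_frameAt (d := d) (F := F) (V := V) x
    refine ⟨e.n, e.s, e.φ, e.f, ?_, e.dual⟩
    rw [e.f_eq.self_of_nhds]
    exact one_ne_zero

lemma FrameAt.f_self {x : M} (e : FrameAt d F V x) : e.f x = 1 := e.f_eq.self_of_nhds

lemma FrameAt.apply_s {x : M} (e : FrameAt d F V x) {y : M} (hy : e.f y = 1) (i j : Fin e.n) :
    e.φ i (e.s j) y = if i = j then 1 else 0 := by
  have := DFunLike.congr_fun (e.mul_apply i j) y
  change e.f y * _ = _ at this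
  rw [hy, one_mul] at this
  rw [this]
  split_ifs
  · exact hy
  · rfl

lemma FrameAt.linear_apply {x : M} (e : FrameAt d F V x) {y : M} (hy : e.f y = 1)
    (L : Cₛ^∞⟮𝓡 d; F, V⟯ →ₗ[SmoothFun d M] SmoothFun d M) (w : Cₛ^∞⟮𝓡 d; F, V⟯) :
    L w y = ∑ i, e.φ i w y * L (e.s i) y := by
  have := DFunLike.congr_fun (e.dual.apply L w) y
  change e.f y * _ = e.f y * (∑ i, e.φ i w * L (e.s i) : SmoothFun d M) y at this
  rw [hy, one_mul, one_mul, sum_fun_apply] at this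
  exact this

variable [FiniteDimensional ℝ F] [ContMDiffVectorBundle ∞ F V (𝓡 d)]

/-- Functionals that are linear over smooth functions are tensorial: in a frame, the value at y
involves w only through its coefficients at y. -/
lemma linear_apply_eq_zero (L : Cₛ^∞⟮𝓡 d; F, V⟯ →ₗ[SmoothFun d M] SmoothFun d M)
    {w : Cₛ^∞⟮𝓡 d; F, V⟯} {y : M} (hw : w y = 0) : L w y = 0 := by
  obtain ⟨e⟩ := nonempty_frameAt (d := d) (F := F) (V := V) y
  rw [e.linear_apply e.f_self]
  exact Finset.sum_eq_zero fun i _ => by rw [e.apply_eq_zero i w y hw, zero_mul]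

end Bump

end Geometry

/-! ### Gluing by partitions of unity -/

namespace Geometry

open Bundle Filter Topology

variable {d : ℕ} {M : Type*} [TopologicalSpace M] [ChartedSpace (EuclideanSpace ℝ (Fin d)) M]
  [IsManifold (𝓡 d) ∞ M] [T2Space M]
  {F : Type*} [NormedAddCommGroup F] [NormedSpace ℝ F] {V : M → Type*}
  [TopologicalSpace (TotalSpace F V)] [∀ x, TopologicalSpace (V x)] [∀ x, AddCommGroup (V x)]
  [∀ x, Module ℝ (V x)] [FiberBundle F V] [VectorBundle ℝ F V]
  {F' : Type*} [NormedAddCommGroup F'] [NormedSpace ℝ F'] {V' : M → Type*}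
  [TopologicalSpace (TotalSpace F' V')] [∀ x, TopologicalSpace (V' x)] [∀ x, AddCommGroup (V' x)]
  [∀ x, Module ℝ (V' x)] [FiberBundle F' V'] [VectorBundle ℝ F' V']

section Glue

variable (ρ : SmoothPartitionOfUnity M (𝓡 d) M Set.univ)

/-- Gluing functions with a partition of unity. -/
def glueFun : (M → SmoothFun d M) →ₗ[SmoothFun d M] SmoothFun d M where
  toFun a := ⟨fun y => ∑ c ∈ ρ.finsupport y, ρ c y * a c y, by
    refine ContMDiff.congr (ρ.contMDiff_finsum_smul (g := fun c => a c)
      fun c y _ => (a c).contMDiff y) fun y => ?_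
    exact ρ.sum_finsupport_smul_eq_finsum y fun c => a c⟩
  map_add' a b := by
    ext y
    change ∑ c ∈ ρ.finsupport y, ρ c y * (a c y + b c y) =
      ∑ c ∈ ρ.finsupport y, ρ c y * a c y + ∑ c ∈ ρ.finsupport y, ρ c y * b c y
    simp only [mul_add, Finset.sum_add_distrib]
  map_smul' k a := by
    ext y
    change ∑ c ∈ ρ.finsupport y, ρ c y * (k y * a c y) = k y * ∑ c ∈ ρ.finsupport y, ρ c y * a c y
    simp only [mul_left_comm _ (k y), Finset.mul_sum]

lemma glueFun_apply (a : M → SmoothFun d M) (y : M) :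
    glueFun ρ a y = ∑ c ∈ ρ.finsupport y, ρ c y * a c y := rfl

/-- Gluing sections with a partition of unity. -/
def glueSec : (M → Cₛ^∞⟮𝓡 d; F, V⟯) →ₗ[SmoothFun d M] Cₛ^∞⟮𝓡 d; F, V⟯ where
  toFun t := ⟨fun y => ∑ c ∈ ρ.finsupport y, ρ c y • t c y, by
    have h : ContMDiff (𝓡 d) ((𝓡 d).prod 𝓘(ℝ, F)) ∞
        (fun y => TotalSpace.mk' F y (∑ᶠ c, ρ c y • t c y)) := by
      refine ContMDiff.finsum_section_of_locallyFinite ?_ fun c => (ρ c • t c).contMDiff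
      exact ρ.locallyFinite.subset fun c y hy => left_ne_zero_of_smul hy
    refine h.congr fun y => ?_
    congr 1
    refine (finsum_eq_sum_of_support_subset _ fun c hc => ?_).symm
    rw [ρ.coe_finsupport]
    exact left_ne_zero_of_smul hc⟩
  map_add' a b := by
    ext y
    change ∑ c ∈ ρ.finsupport y, ρ c y • (a c y + b c y) =
      ∑ c ∈ ρ.finsupport y, ρ c y • a c y + ∑ c ∈ ρ.finsupport y, ρ c y • b c y
    simp only [smul_add, Finset.sum_add_distrib]
  map_smul' k a := by
    ext y
    change ∑ c ∈ ρ.finsupport y, ρ c y • (k y • a c y) = k y • ∑ c ∈ ρ.finsupport y, ρ c y • a c y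
    simp only [smul_comm _ (k y), Finset.smul_sum]

lemma glueSec_apply (t : M → Cₛ^∞⟮𝓡 d; F, V⟯) (y : M) :
    glueSec ρ t y = ∑ c ∈ ρ.finsupport y, ρ c y • t c y := rfl

lemma glueSec_congr {s t : M → Cₛ^∞⟮𝓡 d; F, V⟯} (h : ∀ c, ∀ y ∈ tsupport (ρ c), s c y = t c y) :
    glueSec ρ s = glueSec ρ t := by
  ext y
  rw [glueSec_apply, glueSec_apply]
  refine Finset.sum_congr rfl fun c hc => ?_
  rw [h c y (subset_tsupport _ (by simpa using hc))]

lemma glueSec_const (t : Cₛ^∞⟮𝓡 d; F, V⟯) : glueSec ρ (fun _ => t) = t := by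
  ext y
  rw [glueSec_apply, ← Finset.sum_smul, ρ.sum_finsupport y (Set.mem_univ y), one_smul]

/-- Near y a fixed finite set of indices suffices, so the glued section is locally a finite
combination of global sections. -/
lemma eventually_glueSec_eq (y : M) : ∀ᶠ z in 𝓝 y, ∀ t : M → Cₛ^∞⟮𝓡 d; F, V⟯,
    glueSec ρ t z = (∑ c ∈ ρ.fintsupport y, ρ c • t c) z := by
  filter_upwards [ρ.eventually_finsupport_subset y] with z hz t
  rw [glueSec_apply, sum_section_apply]
  refine Finset.sum_subset hz fun c _ hc => ?_
  rw [ρ.mem_finsupport, Function.mem_support, not_not] at hc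
  rw [hc, zero_smul]

/-- Multiplication by a bump function at y replaces both glued sections by finite sums, with which L
commutes. -/
lemma map_glueSec (L : Cₛ^∞⟮𝓡 d; F, V⟯ →ₗ[SmoothFun d M] Cₛ^∞⟮𝓡 d; F', V'⟯)
    (t : M → Cₛ^∞⟮𝓡 d; F, V⟯) : L (glueSec ρ t) = glueSec ρ fun c => L (t c) := by
  ext y
  obtain ⟨χ, h1, h2, -⟩ := exists_bump (d := d)
    ((eventually_glueSec_eq ρ y (F := F) (V := V)).and
      (eventually_glueSec_eq ρ y (F := F') (V := V')))
  have e1 := smul_eq_smul_of_eqOn h2 fun z hz => hz.1 t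
  have e2 := smul_eq_smul_of_eqOn h2 fun z hz => hz.2 fun c => L (t c)
  have e3 := congrArg L e1
  simp only [map_smul, map_sum] at e3
  have e4 := DFunLike.congr_fun (e3.trans e2.symm) y
  simpa only [smul_section_apply, h1.self_of_nhds, Pi.one_apply, one_smul] using e4

lemma exists_partition [SigmaCompactSpace M] {P : M → M → Prop} (hP : ∀ x, ∀ᶠ y in 𝓝 x, P x y) :
    ∃ ρ : SmoothPartitionOfUnity M (𝓡 d) M Set.univ, ∀ c, ∀ y ∈ tsupport (ρ c), P c y := by
  obtain ⟨ρ, hρ⟩ := SmoothPartitionOfUnity.exists_isSubordinate (𝓡 d) isClosed_univ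
    (fun x => interior {y | P x y}) (fun x => isOpen_interior)
    fun x _ => Set.mem_iUnion_of_mem x (mem_interior_iff_mem_nhds.2 (hP x))
  exact ⟨ρ, fun c y hy => interior_subset (hρ c hy)⟩

end Glue

/-! ### Metrics and the representation of functionals -/

section Metric

variable [FiniteDimensional ℝ F] [ContMDiffVectorBundle ∞ F V (𝓡 d)]

variable (d F V) in
-- The standard inner products ∑ φ_i ⊗ φ_i of local frames, glued by a partition of unity.
lemma exists_metric [SigmaCompactSpace M] :
    ∃ g : Cₛ^∞⟮𝓡 d; F, V⟯ →ₗ[SmoothFun d M] Cₛ^∞⟮𝓡 d; F, V⟯ →ₗ[SmoothFun d M] SmoothFun d M,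
      (∀ s t, g s t = g t s) ∧ ∀ w y, w y ≠ 0 → 0 < g w w y := by
  let e := fun x => (nonempty_frameAt (d := d) (F := F) (V := V) x).some
  obtain ⟨ρ, hρ⟩ := exists_partition (d := d) fun x => (e x).f_eq
  refine ⟨LinearMap.mk₂ _ (fun s t => glueFun ρ fun c => ∑ i, (e c).φ i s * (e c).φ i t)
    (fun s s' t => ?_) (fun k s t => ?_) (fun s t t' => ?_) (fun k s t => ?_),
    fun s t => ?_, fun w y hw => ?_⟩
  · rw [← map_add]
    congr 1
    funext c
    simp only [map_add, add_mul, Finset.sum_add_distrib, Pi.add_apply]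
  · rw [← map_smul]
    congr 1
    funext c
    simp only [map_smul, smul_mul_assoc, ← Finset.smul_sum, Pi.smul_apply]
  · rw [← map_add]
    congr 1
    funext c
    simp only [map_add, mul_add, Finset.sum_add_distrib, Pi.add_apply]
  · rw [← map_smul]
    congr 1
    funext c
    simp only [map_smul, mul_smul_comm, ← Finset.smul_sum, Pi.smul_apply]
  · simp only [LinearMap.mk₂_apply, mul_comm]
  · rw [LinearMap.mk₂_apply, glueFun_apply]
    have hsq : ∀ c, (∑ i, (e c).φ i w * (e c).φ i w) y = ∑ i, (e c).φ i w y * (e c).φ i w y :=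
      fun c => sum_fun_apply _ _ _
    obtain ⟨c, hc⟩ := ρ.exists_pos_of_mem (Set.mem_univ y)
    refine Finset.sum_pos' (fun c _ => mul_nonneg (ρ.nonneg c y) ?_) ⟨c, ?_, mul_pos hc ?_⟩
    · rw [hsq]
      exact Finset.sum_nonneg fun i _ => mul_self_nonneg _
    · simpa using hc.ne'
    · rw [hsq]
      refine (Finset.sum_nonneg fun i _ => mul_self_nonneg _).lt_of_ne' fun h0 => hw ?_
      rw [Finset.sum_eq_zero_iff_of_nonneg fun i _ => mul_self_nonneg _] at h0
      -- Since ρ_c(y) > 0, the point y lies where the frame at c is valid. If all coefficients of w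
      -- vanish at y, then so does w.
      have hf : (e c).f y = 1 := hρ c y (subset_tsupport _ hc.ne')
      have h2 := DFunLike.congr_fun ((e c).dual w) y
      rw [smul_section_apply, smul_section_apply, hf, one_smul, one_smul, sum_section_apply] at h2
      rw [h2]
      refine Finset.sum_eq_zero fun i hi => ?_
      rw [smul_section_apply, mul_self_eq_zero.1 (h0 i hi), zero_smul]

/-- Evaluation of functions at a point. -/
def evalHom (x : M) : SmoothFun d M →+* ℝ :=
  (Pi.evalRingHom (fun _ : M => ℝ) x).comp ContMDiffMap.coeFnRingHom

lemma evalHom_apply (x : M) (a : SmoothFun d M) : evalHom x a = a x := rfl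

variable {g : Cₛ^∞⟮𝓡 d; F, V⟯ →ₗ[SmoothFun d M] Cₛ^∞⟮𝓡 d; F, V⟯ →ₗ[SmoothFun d M] SmoothFun d M}
  (hg : ∀ w y, w y ≠ 0 → 0 < g w w y)

include hg

/-- Positivity makes the Gram matrix of a frame invertible at x: a vector v with v G(x) = 0 gives w
= ∑ v_i s_i with g(w, w)(x) = 0. The coefficients of the representing section then solve a linear
system with this matrix near x. -/
lemma exists_eventually_metric_eq (ψ : Cₛ^∞⟮𝓡 d; F, V⟯ →ₗ[SmoothFun d M] SmoothFun d M) (x : M) :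
    ∃ w, ∀ᶠ y in 𝓝 x, ∀ u, g w u y = ψ u y := by
  obtain ⟨e⟩ := nonempty_frameAt (d := d) (F := F) (V := V) x
  let G : Matrix (Fin e.n) (Fin e.n) (SmoothFun d M) := .of fun i j => g (e.s i) (e.s j)
  have hdet : G.det x ≠ 0 := by
    rw [← evalHom_apply, RingHom.map_det]
    intro h0
    obtain ⟨v, hv, hv0⟩ := Matrix.exists_vecMul_eq_zero_iff.2 h0
    let w := ∑ i, algebraMap ℝ (SmoothFun d M) (v i) • e.s i
    have hφ : ∀ j, e.φ j w x = v j := by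
      intro j
      simp only [w, map_sum, map_smul]
      rw [sum_fun_apply]
      refine (Finset.sum_congr rfl fun i _ => ?_).trans (Finset.sum_eq_single j
        (f := fun i => v i * if j = i then 1 else 0) ?_ ?_) |>.trans ?_
      · change v i * e.φ j (e.s i) x = _
        rw [e.apply_s e.f_self]
      · intro i _ hi
        simp [hi.symm]
      · simp
      · simp
    have hw : w x ≠ 0 := by
      intro h
      apply hv
      funext j
      rw [← hφ j, e.apply_eq_zero j w x h, Pi.zero_apply]
    refine (hg w x hw).ne' ?_
    rw [e.linear_apply e.f_self]
    refine Finset.sum_eq_zero fun j _ => ?_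
    have h1 : g w (e.s j) x = (Matrix.vecMul v ((evalHom x).mapMatrix G)) j := by
      simp only [w, map_sum, map_smul, LinearMap.sum_apply, LinearMap.smul_apply]
      rw [sum_fun_apply]
      rfl
    rw [h1, hv0, Pi.zero_apply, mul_zero]
  obtain ⟨b, hb⟩ := exists_eventually_mul_eq_one hdet
  -- Cramer's rule, where b is an inverse of the determinant near x.
  let a : Fin e.n → SmoothFun d M := b • Matrix.vecMul (fun j => ψ (e.s j)) G.adjugate
  have ha : Matrix.vecMul a G = (G.det * b) • fun j => ψ (e.s j) := by
    rw [Matrix.smul_vecMul, Matrix.vecMul_vecMul, Matrix.adjugate_mul, Matrix.vecMul_smul,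
      Matrix.vecMul_one, smul_smul, mul_comm]
  refine ⟨∑ i, a i • e.s i, ?_⟩
  filter_upwards [hb, e.f_eq] with y hy hf u
  rw [e.linear_apply hf, e.linear_apply hf ψ]
  refine Finset.sum_congr rfl fun j _ => ?_
  congr 1
  have h1 : g (∑ i, a i • e.s i) (e.s j) = Matrix.vecMul a G j := by
    simp only [map_sum, map_smul, LinearMap.sum_apply, LinearMap.smul_apply]
    rfl
  rw [h1, ha]
  change (G.det * b) y * ψ (e.s j) y = _
  rw [hy, Pi.one_apply, one_mul]

/-- Representing ψ at y is a convex condition on the value of the section at y, so the local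
solutions can be glued to a global one. That only this value matters is tensoriality. -/
lemma exists_metric_eq [SigmaCompactSpace M]
    (ψ : Cₛ^∞⟮𝓡 d; F, V⟯ →ₗ[SmoothFun d M] SmoothFun d M) : ∃ w, g w = ψ := by
  choose w₀ hw₀ using exists_eventually_metric_eq hg ψ
  have hconv : ∀ y, Convex ℝ {v : V y | ∃ w : Cₛ^∞⟮𝓡 d; F, V⟯, w y = v ∧ ∀ u, g w u y = ψ u y} := by
    rintro y _ ⟨w, rfl, hw⟩ _ ⟨w', rfl, hw'⟩ a b - - hab
    refine ⟨algebraMap ℝ (SmoothFun d M) a • w + algebraMap ℝ (SmoothFun d M) b • w', rfl,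
      fun u => ?_⟩
    rw [map_add, map_smul, map_smul]
    change a * g w u y + b * g w' u y = _
    rw [hw, hw', ← add_mul, hab, one_mul]
  obtain ⟨w, hw⟩ := exists_contMDiffSection_forall_mem_convex_of_local (𝓡 d) V
    (n := ⊤) (fun y => {v | ∃ w : Cₛ^∞⟮𝓡 d; F, V⟯, w y = v ∧ ∀ u, g w u y = ψ u y})
    hconv fun x => ⟨_, hw₀ x, w₀ x, (w₀ x).contMDiff.contMDiffOn, fun y hy => ⟨w₀ x, rfl, hy⟩⟩
  refine ⟨w, ?_⟩
  ext u y
  obtain ⟨w', h1, h2⟩ := hw y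
  rw [← h2]
  have h3 := linear_apply_eq_zero (g.flip u) (w := w - w') (y := y) (sub_eq_zero.2 h1.symm)
  rw [map_sub] at h3
  exact sub_eq_zero.1 h3

lemma metric_nonneg (w : Cₛ^∞⟮𝓡 d; F, V⟯) (y : M) : 0 ≤ g w w y := by
  by_cases h : w y = 0
  · exact (linear_apply_eq_zero (g w) h).ge
  · exact (hg w y h).le

end Metric

end Geometry

/-! ### Ranges of idempotents on modules of sections -/

namespace Geometry

open Bundle Filter Topology

variable {d : ℕ} {M : Type*} [TopologicalSpace M] [ChartedSpace (EuclideanSpace ℝ (Fin d)) M]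

/-- The trace of an idempotent is its rank. -/
lemma exists_nat_trace_eq {n : ℕ} {P : Matrix (Fin n) (Fin n) ℝ} (h : P * P = P) :
    ∃ k : ℕ, P.trace = k := by
  have h' : IsIdempotentElem (Matrix.toLin' P) := by
    rw [IsIdempotentElem, Module.End.mul_eq_comp, ← Matrix.toLin'_mul, h]
  exact ⟨_, (Matrix.trace_toLin'_eq P).symm.trans
    (LinearMap.IsIdempotentElem.isProj_range _ h').trace⟩

lemma eq_zero_of_trace_eq_zero {n : ℕ} {P : Matrix (Fin n) (Fin n) ℝ} (h : P * P = P)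
    (h0 : P.trace = 0) : P = 0 := by
  have h' : IsIdempotentElem (Matrix.toLin' P) := by
    rw [IsIdempotentElem, Module.End.mul_eq_comp, ← Matrix.toLin'_mul, h]
  rw [← Matrix.trace_toLin'_eq] at h0
  exact (map_eq_zero_iff _ Matrix.toLin'.injective).1
    (LinearMap.IsIdempotentElem.eq_zero_of_trace_eq_zero h' h0)

section Range

variable {Γ : Type*} [AddCommGroup Γ] [Module (SmoothFun d M) Γ]
  {e : Γ →ₗ[SmoothFun d M] Γ} (he : ∀ w, e (e w) = e w)

include he in
lemma apply_mem_range (w : LinearMap.range e) : e w = (w : Γ) := by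
  obtain ⟨_, v, rfl⟩ := w
  exact he v

include he in
-- Apply e to the expansion of w = e w. The new elements e(s_i) need not be independent, which the
-- notion of dual basis allows.
lemma IsDualBasis.range {n : ℕ} {s : Fin n → Γ} {φ : Fin n → Γ →ₗ[SmoothFun d M] SmoothFun d M}
    {f : SmoothFun d M} (h : IsDualBasis s φ f) :
    IsDualBasis (fun i => e.rangeRestrict (s i)) (fun i => (φ i).domRestrict (LinearMap.range e))
      f := by
  intro w
  apply Subtype.ext
  have := h.apply e (w : Γ)
  rw [apply_mem_range he] at this
  simpa using this

include he in
lemma locallyProjective_range [hΓ : LocallyProjective (d := d) (M := M) Γ] :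
    LocallyProjective (d := d) (M := M) (LinearMap.range e) where
  exists_dualBasis x := by
    obtain ⟨n, s, φ, f, hf, h⟩ := hΓ.exists_dualBasis x
    exact ⟨n, _, _, f, hf, h.range he⟩

variable [IsManifold (𝓡 d) ∞ M] [Module ℝ Γ] [IsScalarTower ℝ (SmoothFun d M) Γ]

/-- The compression of a connection to the range of an endomorphism. -/
def compress (D : Cartan.Connection ℝ (SmoothFun d M) (VecField d M) Γ)
    (he : ∀ w, e (e w) = e w) :
    Cartan.Connection ℝ (SmoothFun d M) (VecField d M) (LinearMap.range e) where
  toFun :=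
    { toFun := fun w => e.rangeRestrict ∘ₗ D.toFun w
      map_add' := fun v w => by
        ext X
        simp
      map_smul' := fun c w => by
        ext X
        simp }
  leibniz a w X := by
    apply Subtype.ext
    have := D.leibniz a w X
    change e (D.toFun (a • w) X) = a • e (D.toFun w X) + ⁅X, a⁆ • (w : Γ)
    rw [this, map_add, map_smul, map_smul, apply_mem_range he]

end Range

variable [IsManifold (𝓡 d) ∞ M] [T2Space M]
  {F : Type*} [NormedAddCommGroup F] [NormedSpace ℝ F] {V : M → Type*}
  [TopologicalSpace (TotalSpace F V)] [∀ x, TopologicalSpace (V x)] [∀ x, AddCommGroup (V x)]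
  [∀ x, Module ℝ (V x)] [FiberBundle F V] [VectorBundle ℝ F V]
  [FiniteDimensional ℝ F] [ContMDiffVectorBundle ∞ F V (𝓡 d)]
  {e : Cₛ^∞⟮𝓡 d; F, V⟯ →ₗ[SmoothFun d M] Cₛ^∞⟮𝓡 d; F, V⟯} (he : ∀ w, e (e w) = e w)

include he

/-- The range of an idempotent carries a perfect symmetric pairing. -/
lemma exists_perfect_range [SigmaCompactSpace M] :
    ∃ G : LinearMap.range e ≃ₗ[SmoothFun d M] (LinearMap.range e →ₗ[SmoothFun d M] SmoothFun d M),
      ∀ s t, G s t = G t s := by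
  obtain ⟨g, hs, hg⟩ := exists_metric d F V
  -- The metric g' makes the range and the kernel of e orthogonal and agrees with g on the range. If
  -- w represents ψ ∘ e with respect to g', then e w represents ψ with respect to g. Injectivity is
  -- positivity of g.
  let g' := g.compl₁₂ e e + g.compl₁₂ (LinearMap.id - e) (LinearMap.id - e)
  have hg'a : ∀ s t, g' s t = g (e s) (e t) + g (s - e s) (t - e t) := fun _ _ => rfl
  have hg' : ∀ w y, w y ≠ 0 → 0 < g' w w y := by
    intro w y hw
    rw [hg'a]
    change 0 < g (e w) (e w) y + g (w - e w) (w - e w) y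
    have h1 := metric_nonneg hg (e w) y
    have h2 := metric_nonneg hg (w - e w) y
    by_cases h3 : e w y = 0
    · have h4 : (w - e w) y ≠ 0 := by
        change w y - e w y ≠ 0
        rwa [h3, sub_zero]
      have := hg _ _ h4
      linarith
    · have := hg _ _ h3
      linarith
  let G₀ : LinearMap.range e →ₗ[SmoothFun d M] (LinearMap.range e →ₗ[SmoothFun d M] SmoothFun d M) :=
    g.domRestrict₁₂ _ _
  have hG₀ : ∀ s t, G₀ s t = g s t := fun _ _ => rfl
  have hinj : Function.Injective G₀ := by
    rw [← LinearMap.ker_eq_bot, LinearMap.ker_eq_bot']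
    intro w hw
    have h1 : g w w = 0 := (hG₀ w w).symm.trans (by rw [hw]; rfl)
    apply Subtype.ext
    ext y
    by_contra hy
    have h2 := hg w y hy
    rw [h1] at h2
    exact lt_irrefl _ h2
  have hsurj : Function.Surjective G₀ := by
    intro ψ
    obtain ⟨w, hw⟩ := exists_metric_eq hg' (ψ ∘ₗ e.rangeRestrict)
    refine ⟨e.rangeRestrict w, ?_⟩
    ext1 t
    have h1 := LinearMap.congr_fun hw (t : Cₛ^∞⟮𝓡 d; F, V⟯)
    rw [hg'a, apply_mem_range he, sub_self, map_zero, add_zero] at h1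
    refine h1.trans ?_
    rw [LinearMap.comp_apply]
    congr 1
    exact Subtype.ext (apply_mem_range he t)
  exact ⟨LinearEquiv.ofBijective G₀ ⟨hinj, hsurj⟩, fun s t => hs _ _⟩

/-- At each point the trace is that of the idempotent matrix of e in a frame, hence a natural
number, and by continuity it is constant on the connected M. If it were zero, these matrices would
all vanish, and e with them. -/
lemma exists_trace_id_range_eq [PreconnectedSpace M] (hne : e ≠ 0) :
    haveI := locallyProjective_range (d := d) (M := M) he
    ∃ c : ℝ, c ≠ 0 ∧
      trace (LinearMap.range e) LinearMap.id = algebraMap ℝ (SmoothFun d M) c := by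
  have := locallyProjective_range (d := d) (M := M) he
  let τ : SmoothFun d M := trace (LinearMap.range e) LinearMap.id
  have key : ∀ x, ∃ (E : FrameAt d F V x) (P : Matrix (Fin E.n) (Fin E.n) ℝ), P * P = P ∧
      τ x = P.trace ∧ P = .of fun i j => E.φ i (e (E.s j)) x := by
    intro x
    obtain ⟨E⟩ := nonempty_frameAt (d := d) (F := F) (V := V) x
    refine ⟨E, _, ?_, ?_, rfl⟩
    · ext i j
      have h1 := E.linear_apply E.f_self (E.φ i ∘ₗ e) (e (E.s j))
      simp only [LinearMap.comp_apply, he] at h1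
      rw [Matrix.mul_apply, Matrix.of_apply, h1]
      exact Finset.sum_congr rfl fun k _ => mul_comm _ _
    · rw [trace_apply _ (E.dual.range he) (x := x) (by rw [E.f_self]; exact one_ne_zero),
        sum_fun_apply]
      rfl
  have hnat : ∀ x, τ x ∈ Set.range ((↑) : ℕ → ℝ) := by
    intro x
    obtain ⟨E, P, hP, hτ, -⟩ := key x
    obtain ⟨k, hk⟩ := exists_nat_trace_eq hP
    exact ⟨k, by rw [hτ, hk]⟩
  have hconst : ∀ x y, τ x = τ y := fun x y =>
    -- The natural numbers form a discrete subset of the reals.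
    isPreconnected_univ.constant_of_mapsTo (T := Set.range ((↑) : ℕ → ℝ))
      (isDiscrete_iff_discreteTopology.2
        Nat.isClosedEmbedding_coe_real.isEmbedding.toHomeomorph.symm.isEmbedding.discreteTopology)
      τ.contMDiff.continuous.continuousOn (fun x _ => hnat x) (Set.mem_univ x) (Set.mem_univ y)
  obtain ⟨x, hx⟩ : ∃ x, τ x ≠ 0 := by
    by_contra! h0
    apply hne
    ext w x
    obtain ⟨E, P, hP, hτ, hPE⟩ := key x
    have hP0 := eq_zero_of_trace_eq_zero hP (hτ.symm.trans (h0 x))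
    have h1 := DFunLike.congr_fun (E.dual.apply e w) x
    have h2 : ∀ j, e (E.s j) x = 0 := by
      intro j
      have h3 := DFunLike.congr_fun (E.dual (e (E.s j))) x
      rw [smul_section_apply, smul_section_apply, E.f_self, one_smul, one_smul,
        sum_section_apply] at h3
      rw [h3]
      refine Finset.sum_eq_zero fun i _ => ?_
      have h4 := congrFun (congrFun hPE i) j
      rw [hP0] at h4
      rw [smul_section_apply, ← Matrix.of_apply (fun i j => E.φ i (e (E.s j)) x) i j, ← h4]
      exact zero_smul ℝ _
    rw [smul_section_apply, smul_section_apply, E.f_self, one_smul, one_smul,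
      sum_section_apply] at h1
    rw [h1]
    refine Finset.sum_eq_zero fun i _ => ?_
    rw [smul_section_apply, h2, smul_zero]
  refine ⟨τ x, hx, ?_⟩
  ext y
  exact hconst y x

/-- If the compression of a connection to the range of a nonzero idempotent has scalar curvature
`h`, then `h` is exact. -/
lemma exists_extD_eq_of_idempotent [SigmaCompactSpace M] [PreconnectedSpace M] (hne : e ≠ 0)
    (D : Cartan.Connection ℝ (SmoothFun d M) (VecField d M) Cₛ^∞⟮𝓡 d; F, V⟯) (h : DiffForm d M 2)
    (hcurv : ∀ X Y w, e w = w → e (D.nab X (e (D.nab Y w))) - e (D.nab Y (e (D.nab X w))) -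
      e (D.nab ⁅X, Y⁆ w) = h.1.ev [X, Y] • w) :
    ∃ α : DiffForm d M 1,
      Cartan.extD ℝ (SmoothFun d M) (VecField d M) one_add_one_eq_two α = h := by
  have := locallyProjective_range (d := d) (M := M) he
  obtain ⟨G, hG⟩ := exists_perfect_range he
  obtain ⟨c, hc, htr⟩ := exists_trace_id_range_eq he hne
  refine exists_extD_eq_of_curvEnd hG (compress D he) h hc htr fun X Y => ?_
  ext1 w
  apply Subtype.ext
  exact hcurv X Y w (apply_mem_range he w)

end Geometry

/-! ### Uniqueness for linear differential systems -/

namespace Geometry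

open Bundle Filter Topology

variable {d : ℕ} {M : Type*} [TopologicalSpace M] [ChartedSpace (EuclideanSpace ℝ (Fin d)) M]
  [IsManifold (𝓡 d) ∞ M]

/-- The derivatives of a function in a chart are its derivatives along the coordinate fields. -/
lemma hasFDerivAt_comp_extChartAt_symm (u : SmoothFun d M) {x : M} {z : EuclideanSpace ℝ (Fin d)}
    (hz : z ∈ (extChartAt (𝓡 d) x).target) :
    ∃ L : EuclideanSpace ℝ (Fin d) →L[ℝ] ℝ,
      HasFDerivAt (fun z => u ((extChartAt (𝓡 d) x).symm z)) L z ∧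
      ∀ v, L v = mvfderiv (𝓡 d) u ((extChartAt (𝓡 d) x).symm z)
        ((trivializationAt (EuclideanSpace ℝ (Fin d)) (TangentSpace (𝓡 d)) x).symmL ℝ
          ((extChartAt (𝓡 d) x).symm z) v) := by
  have hI : Set.range (𝓡 d) = Set.univ := (𝓡 d).range_eq_univ
  have : IsManifold (𝓡 d) 1 M := IsManifold.of_le (n := ∞) (by simp)
  have h1 := mdifferentiableWithinAt_extChartAt_symm hz
  rw [hI] at h1
  have h2 := (fun_mdiff u ((extChartAt (𝓡 d) x).symm z)).hasMFDerivAt.comp_hasMFDerivWithinAt z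
    h1.hasMFDerivWithinAt
  rw [hasMFDerivWithinAt_univ, hasMFDerivAt_iff_hasFDerivAt] at h2
  refine ⟨_, h2, fun v => ?_⟩
  have hs : (extChartAt (𝓡 d) x).symm z ∈ (chartAt (EuclideanSpace ℝ (Fin d)) x).source := by
    rw [← extChartAt_source (𝓡 d)]
    exact (extChartAt (𝓡 d) x).map_target hz
  rw [TangentBundle.symmL_trivializationAt hs, (extChartAt (𝓡 d) x).right_inv hz, hI]
  rfl

variable [T2Space M]

/-- Grönwall's inequality along straight segments from x in a chart. Only the finitely many
coordinate fields, extended to global vector fields, are needed. -/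
lemma eventually_eq_zero_of_abs_lie_le {u : SmoothFun d M} {x : M} (h0 : u x = 0)
    (h : ∀ X : VecField d M, ∃ K : ℝ, ∀ᶠ y in 𝓝 x, |⁅X, u⁆ y| ≤ K * |u y|) : u =ᶠ[𝓝 x] 0 := by
  let b := (EuclideanSpace.basisFun (Fin d) ℝ).toBasis
  set e := trivializationAt (EuclideanSpace ℝ (Fin d)) (TangentSpace (𝓡 d) : M → Type _) x
  have hx : x ∈ e.baseSet := mem_baseSet_trivializationAt _ _ x
  obtain ⟨X, hX⟩ := exists_section_eventuallyEq (d := d) e.open_baseSet hx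
    (fun i => e.contMDiffOn_localFrame_baseSet ∞ b i)
  choose K hK using fun i => h (X i)
  have hX' : ∀ᶠ y in 𝓝 x, ∀ i, |mvfderiv (𝓡 d) u y (e.symmL ℝ y (b i))| ≤ K i * |u y| := by
    filter_upwards [hX, eventually_all.2 hK, e.open_baseSet.mem_nhds hx] with y h1 h2 h3 i
    have h4 := h2 i
    rw [deriv_apply, h1 i, e.localFrame_apply_of_mem_baseSet b h3] at h4
    rw [e.symmL_apply h3]
    exact h4
  set φ := extChartAt (𝓡 d) x
  have hφ : Tendsto φ.symm (𝓝 (φ x)) (𝓝 x) := by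
    have := continuousAt_extChartAt_symm (I := 𝓡 d) x
    rwa [ContinuousAt, extChartAt_to_inv] at this
  obtain ⟨r, hr, hball⟩ := Metric.eventually_nhds_iff_ball.1
    ((hφ.eventually hX').and (extChartAt_target_mem_nhds (I := 𝓡 d) x))
  have hU : ∀ z ∈ Metric.ball (φ x) r, u (φ.symm z) = 0 := by
    intro z hz
    have hseg : ∀ t ∈ Set.Icc (0 : ℝ) 1, φ x + t • (z - φ x) ∈ Metric.ball (φ x) r := by
      intro t ht
      rw [mem_ball_iff_norm] at hz ⊢
      rw [add_sub_cancel_left, norm_smul, Real.norm_of_nonneg ht.1]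
      exact (mul_le_of_le_one_left (norm_nonneg _) ht.2).trans_lt hz
    choose! L hL hL' using fun z hz => hasFDerivAt_comp_extChartAt_symm u (x := x) (z := z) hz
    have hd : ∀ t ∈ Set.Icc (0 : ℝ) 1, HasDerivAt (fun t => u (φ.symm (φ x + t • (z - φ x))))
        (L (φ x + t • (z - φ x)) (z - φ x)) t := by
      intro t ht
      have hpath : HasDerivAt (fun t : ℝ => φ x + t • (z - φ x)) (z - φ x) t := by
        simpa using ((hasDerivAt_id t).smul_const (z - φ x)).const_add (φ x)
      exact (hL _ (hball _ (hseg t ht)).2).comp_hasDerivAt t hpath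
    -- The constant comes from expanding the direction z - φ x of the segment in the coordinate
    -- basis.
    have := eq_zero_of_abs_deriv_le_mul_abs_self_of_eq_zero_right
      (K := ∑ i, |b.repr (z - φ x) i| * K i)
      (fun t ht => (hd t ht).continuousAt.continuousWithinAt)
      (fun t ht => (hd t ⟨ht.1, ht.2.le⟩).hasDerivWithinAt)
      (by simpa [φ] using h0)
      (fun t ht => ?_) 1 (by simp)
    · simpa using this
    · have hmem := hball _ (hseg t ⟨ht.1, ht.2.le⟩)
      conv_lhs => rw [← b.sum_repr (z - φ x), map_sum]
      rw [Finset.sum_mul]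
      refine (norm_sum_le _ _).trans (Finset.sum_le_sum fun i _ => ?_)
      rw [b.sum_repr, map_smul, smul_eq_mul, norm_mul, Real.norm_eq_abs, Real.norm_eq_abs, mul_assoc,
        hL' _ hmem.2]
      exact mul_le_mul_of_nonneg_left (hmem.1 i) (abs_nonneg _)
  filter_upwards [(continuousAt_extChartAt (I := 𝓡 d) x).eventually (Metric.ball_mem_nhds _ hr),
    extChartAt_source_mem_nhds (I := 𝓡 d) x] with y h1 h2
  rw [← φ.left_inv h2]
  exact hU _ h1

/-- Functions solving a homogeneous linear differential system vanish around their common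
zeros. -/
lemma eventually_eq_zero_of_lie_eq_sum {ι : Type*} [Fintype ι] {a : ι → SmoothFun d M} {x : M}
    (h0 : ∀ k, a k x = 0) (h : ∀ X : VecField d M, ∃ c : ι → ι → SmoothFun d M,
      ∀ k, ∀ᶠ y in 𝓝 x, ⁅X, a k⁆ y = ∑ l, c k l y * a l y) : ∀ᶠ y in 𝓝 x, ∀ k, a k y = 0 := by
  -- The sum of squares u dominates every |a_k a_l|, so X u = 2 ∑ c_kl a_k a_l is bounded by a
  -- multiple of u near x.
  let u : SmoothFun d M := ∑ k, a k * a k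
  have hu : ∀ y, u y = ∑ k, a k y * a k y := fun y => sum_fun_apply _ _ y
  have hle : ∀ k y, a k y * a k y ≤ u y := fun k y => by
    rw [hu]
    exact Finset.single_le_sum (f := fun k => a k y * a k y) (fun k _ => mul_self_nonneg _)
      (Finset.mem_univ k)
  have hnonneg : ∀ y, 0 ≤ u y := fun y => by
    rw [hu]
    exact Finset.sum_nonneg fun k _ => mul_self_nonneg _
  have : u =ᶠ[𝓝 x] 0 := by
    refine eventually_eq_zero_of_abs_lie_le ?_ fun X => ?_
    · rw [hu]
      exact Finset.sum_eq_zero fun k _ => by rw [h0, zero_mul]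
    obtain ⟨c, hc⟩ := h X
    have hcb : ∀ k l, ∀ᶠ y in 𝓝 x, |c k l y| ≤ |c k l x| + 1 := fun k l =>
      ((c k l).contMDiff.continuous.abs.continuousAt.eventually
        (gt_mem_nhds (lt_add_one |c k l x|))).mono fun y hy => hy.le
    refine ⟨∑ k, ∑ l, 2 * (|c k l x| + 1), ?_⟩
    filter_upwards [eventually_all.2 hc, eventually_all.2 fun k => eventually_all.2 (hcb k)]
      with y h1 h2
    have h3 : ⁅X, u⁆ y = ∑ k, ∑ l, 2 * (c k l y * (a k y * a l y)) := by
      have : ⁅X, u⁆ = ∑ k, (2 : ℝ) • (a k * ⁅X, a k⁆) := by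
        rw [← funConn_nab, show u = ∑ k, a k * a k from rfl, nab_sum]
        refine Finset.sum_congr rfl fun k _ => ?_
        rw [funConn_nab, LieRinehartRing.leibniz_mul_right, two_smul, mul_comm ⁅X, a k⁆,
          smul_eq_mul]
      rw [this, sum_fun_apply]
      refine Finset.sum_congr rfl fun k _ => ?_
      change 2 * (a k y * ⁅X, a k⁆ y) = _
      rw [h1 k, Finset.mul_sum, Finset.mul_sum]
      exact Finset.sum_congr rfl fun l _ => by ring
    rw [h3, abs_of_nonneg (hnonneg y), Finset.sum_mul]
    refine (Finset.abs_sum_le_sum_abs _ _).trans (Finset.sum_le_sum fun k _ => ?_)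
    rw [Finset.sum_mul]
    refine (Finset.abs_sum_le_sum_abs _ _).trans (Finset.sum_le_sum fun l _ => ?_)
    rw [abs_mul, abs_mul, abs_of_pos (two_pos (α := ℝ)), mul_assoc]
    refine mul_le_mul_of_nonneg_left ?_ two_pos.le
    refine mul_le_mul (h2 k l) ?_ (abs_nonneg _) (by positivity)
    rw [abs_le]
    have e1 := hle k y
    have e2 := hle l y
    constructor <;> nlinarith [mul_self_nonneg (a k y + a l y), mul_self_nonneg (a k y - a l y)]
  filter_upwards [this] with y hy k
  have h1 := hle k y
  rw [hy, Pi.zero_apply] at h1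
  exact mul_self_eq_zero.1 (le_antisymm h1 (mul_self_nonneg _))

end Geometry

/-! ### Inner inverses of parallel homomorphisms -/

namespace Geometry

open Bundle Filter Topology

section Matrix

variable {m n : Type*} [Fintype m] [Fintype n] [DecidableEq m] [DecidableEq n]

/-- Every real matrix has a reflexive generalized inverse. -/
lemma exists_generalized_inverse (C : Matrix m n ℝ) :
    ∃ T : Matrix n m ℝ, T * C * T = T ∧ C * T * C = C := by
  obtain ⟨g, hg⟩ := (Matrix.toLin' C).rangeRestrict.exists_rightInverse_of_surjective
    (LinearMap.range_rangeRestrict _)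
  obtain ⟨g', hg'⟩ := g.exists_extend
  have h1 : Matrix.toLin' C ∘ₗ g' ∘ₗ Matrix.toLin' C = Matrix.toLin' C := by
    refine LinearMap.ext fun v => ?_
    have h2 := LinearMap.congr_fun hg' ((Matrix.toLin' C).rangeRestrict v)
    have h3 := LinearMap.congr_fun hg ((Matrix.toLin' C).rangeRestrict v)
    have h4 := congrArg Subtype.val h3
    rw [LinearMap.comp_apply, ← h2] at h4
    exact h4
  have h2 : C * LinearMap.toMatrix' g' * C = C := by
    apply Matrix.toLin'.injective
    rw [Matrix.toLin'_mul, Matrix.toLin'_mul, Matrix.toLin'_toMatrix', LinearMap.comp_assoc, h1]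
  generalize LinearMap.toMatrix' g' = G at h2
  have h3 : ∀ X : Matrix n m ℝ, C * (G * (C * X)) = C * X := fun X => by
    rw [← Matrix.mul_assoc G, ← Matrix.mul_assoc C, ← Matrix.mul_assoc C, h2]
  -- From an inner inverse G alone, G C G is also an outer inverse.
  refine ⟨G * C * G, ?_, ?_⟩
  · simp only [Matrix.mul_assoc, h3]
  · simp only [Matrix.mul_assoc] at h2 ⊢
    rw [h2, h2]

/-- Write T(C + N) = (TC - 1) + (1 + TN). Since (TC - 1)T = 0, one has (TC - 1)(1 + TN) = TC - 1,
hence also (TC - 1)v = TC - 1. So an outer inverse of C deforms to one of C + N, whatever happens to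
the rank. -/
lemma perturbed_inverse {C N : Matrix m n ℝ} {T : Matrix n m ℝ} (hT : T * C * T = T)
    {v : Matrix n n ℝ} (hv : (1 + T * N) * v = 1) :
    v * T * (C + N) * (v * T) = v * T := by
  have h1 : (T * C - 1) * (1 + T * N) = T * C - 1 := by
    rw [Matrix.mul_add, Matrix.mul_one, ← Matrix.mul_assoc, Matrix.sub_mul, hT, Matrix.one_mul,
      sub_self, Matrix.zero_mul, add_zero]
  have h2 : (T * C - 1) * v = T * C - 1 := by
    have := congrArg (· * v) h1
    simp only [Matrix.mul_assoc, hv, Matrix.mul_one] at this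
    exact this.symm
  have h3 : T * (C + N) = (T * C - 1) + (1 + T * N) := by
    rw [Matrix.mul_add]
    abel
  rw [Matrix.mul_assoc v T, h3, ← Matrix.mul_assoc, Matrix.mul_assoc v, Matrix.add_mul, h2, hv,
    Matrix.mul_assoc, Matrix.add_mul, Matrix.sub_mul, hT, Matrix.one_mul, sub_self, zero_add]

end Matrix

variable {d : ℕ} {M : Type*} [TopologicalSpace M] [ChartedSpace (EuclideanSpace ℝ (Fin d)) M]
  [IsManifold (𝓡 d) ∞ M] [T2Space M]
  {F : Type*} [NormedAddCommGroup F] [NormedSpace ℝ F] {V : M → Type*}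
  [TopologicalSpace (TotalSpace F V)] [∀ x, TopologicalSpace (V x)] [∀ x, AddCommGroup (V x)]
  [∀ x, Module ℝ (V x)] [FiberBundle F V] [VectorBundle ℝ F V]
  {F' : Type*} [NormedAddCommGroup F'] [NormedSpace ℝ F'] {V' : M → Type*}
  [TopologicalSpace (TotalSpace F' V')] [∀ x, TopologicalSpace (V' x)] [∀ x, AddCommGroup (V' x)]
  [∀ x, Module ℝ (V' x)] [FiberBundle F' V'] [VectorBundle ℝ F' V']

section Frames

lemma FrameAt.section_apply {x : M} (e : FrameAt d F V x) {y : M} (hy : e.f y = 1)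
    (L : Cₛ^∞⟮𝓡 d; F, V⟯ →ₗ[SmoothFun d M] Cₛ^∞⟮𝓡 d; F', V'⟯) (w : Cₛ^∞⟮𝓡 d; F, V⟯) :
    L w y = ∑ i, e.φ i w y • L (e.s i) y := by
  have := DFunLike.congr_fun (e.dual.apply L w) y
  rw [smul_section_apply, smul_section_apply, hy, one_smul, one_smul, sum_section_apply] at this
  exact this

lemma FrameAt.ext_apply {x : M} (e : FrameAt d F V x) (e' : FrameAt d F' V' x) {y : M}
    (hy : e.f y = 1) (hy' : e'.f y = 1)
    {P Q : Cₛ^∞⟮𝓡 d; F, V⟯ →ₗ[SmoothFun d M] Cₛ^∞⟮𝓡 d; F', V'⟯}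
    (h : ∀ j i, e'.φ j (P (e.s i)) y = e'.φ j (Q (e.s i)) y) (w : Cₛ^∞⟮𝓡 d; F, V⟯) :
    P w y = Q w y := by
  rw [e.section_apply hy, e.section_apply hy]
  refine Finset.sum_congr rfl fun i _ => ?_
  congr 1
  refine (e'.section_apply hy' LinearMap.id _).trans
    (Eq.trans ?_ (e'.section_apply hy' LinearMap.id _).symm)
  exact Finset.sum_congr rfl fun j _ => congrArg (· • _) (h j i)

variable [FiniteDimensional ℝ F] [ContMDiffVectorBundle ∞ F V (𝓡 d)]

lemma linear_apply_congr (L : Cₛ^∞⟮𝓡 d; F, V⟯ →ₗ[SmoothFun d M] SmoothFun d M)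
    {s t : Cₛ^∞⟮𝓡 d; F, V⟯} {y : M} (h : s y = t y) : L s y = L t y := by
  have := linear_apply_eq_zero L (w := s - t) (sub_eq_zero.2 h)
  rw [map_sub] at this
  exact sub_eq_zero.1 this

lemma section_apply_congr (L : Cₛ^∞⟮𝓡 d; F, V⟯ →ₗ[SmoothFun d M] Cₛ^∞⟮𝓡 d; F', V'⟯)
    {s t : Cₛ^∞⟮𝓡 d; F, V⟯} {y : M} (h : s y = t y) : L s y = L t y := by
  obtain ⟨e⟩ := nonempty_frameAt (d := d) (F := F) (V := V) y
  rw [e.section_apply e.f_self, e.section_apply e.f_self]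
  exact Finset.sum_congr rfl fun i _ => by rw [linear_apply_congr _ h]

end Frames

section Nab

/-- Covariant derivatives of a family of locally vanishing sections vanish locally. -/
lemma eventually_nab_eq_zero
    (D : Cartan.Connection ℝ (SmoothFun d M) (VecField d M) Cₛ^∞⟮𝓡 d; F, V⟯)
    {ι : Type*} {s : ι → Cₛ^∞⟮𝓡 d; F, V⟯} {x : M} (h : ∀ᶠ y in 𝓝 x, ∀ i, s i y = 0)
    (X : VecField d M) : ∀ᶠ y in 𝓝 x, ∀ i, D.nab X (s i) y = 0 := by
  obtain ⟨χ, h1, h2, -⟩ := exists_bump (d := d) h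
  filter_upwards [h1] with y hy i
  have h3 : χ • s i = 0 := by
    rw [← smul_zero χ]
    exact smul_eq_smul_of_eqOn h2 fun z hz => hz i
  have h4 := DFunLike.congr_fun (sq_smul_nab D X h3) y
  rw [smul_section_apply] at h4
  change (χ y * χ y) • D.nab X (s i) y = 0 at h4
  rwa [hy, Pi.one_apply, one_mul, one_smul] at h4

end Nab

variable [FiniteDimensional ℝ F] [ContMDiffVectorBundle ∞ F V (𝓡 d)]
  [FiniteDimensional ℝ F'] [ContMDiffVectorBundle ∞ F' V' (𝓡 d)]

/-- A homomorphism has a smooth family of outer inverses around every point which is an inner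
inverse at that point. -/
lemma exists_local_outer_inverse
    (L : Cₛ^∞⟮𝓡 d; F, V⟯ →ₗ[SmoothFun d M] Cₛ^∞⟮𝓡 d; F', V'⟯) (x : M) :
    ∃ T : Cₛ^∞⟮𝓡 d; F', V'⟯ →ₗ[SmoothFun d M] Cₛ^∞⟮𝓡 d; F, V⟯,
      (∀ᶠ y in 𝓝 x, ∀ w, T (L (T w)) y = T w y) ∧ ∀ w, L (T (L w)) x = L w x := by
  obtain ⟨e⟩ := nonempty_frameAt (d := d) (F := F) (V := V) x
  obtain ⟨e'⟩ := nonempty_frameAt (d := d) (F := F') (V := V') x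
  let K : Matrix (Fin e'.n) (Fin e.n) (SmoothFun d M) := .of fun j i => e'.φ j (L (e.s i))
  let K' : M → Matrix (Fin e'.n) (Fin e.n) ℝ := fun y => K.map (evalHom y)
  obtain ⟨C', hC1, hC2⟩ := exists_generalized_inverse (K' x)
  let c : ℝ →+* SmoothFun d M := algebraMap ℝ (SmoothFun d M)
  -- The matrix 1 + TN of `perturbed_inverse`, with T = C' and N the deviation of the matrix of L
  -- from its value at x. It is the identity at x, hence invertible nearby, and v is its inverse
  -- there.
  let U : Matrix (Fin e.n) (Fin e.n) (SmoothFun d M) := 1 + C'.map c * (K - (K' x).map c)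
  have hc : ∀ {k l : Type} (P : Matrix k l ℝ) (y : M), (P.map c).map (evalHom y) = P :=
    fun P y => by
      ext i j
      rfl
  have hU : ∀ y, U.map (evalHom y) = 1 + C' * (K' y - K' x) := by
    intro y
    have h1 := RingHom.map_one (evalHom (d := d) y).mapMatrix
      (α := Matrix (Fin e.n) (Fin e.n) (SmoothFun d M))
    rw [Matrix.map_add _ (map_add _), Matrix.map_mul, hc, Matrix.map_sub _ (map_sub _), hc]
    congr 1
  have hdet : U.det x ≠ 0 := by
    rw [← evalHom_apply, RingHom.map_det]
    change (U.map (evalHom x)).det ≠ 0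
    rw [hU, sub_self, Matrix.mul_zero, add_zero, Matrix.det_one]
    exact one_ne_zero
  obtain ⟨b, hb⟩ := exists_eventually_mul_eq_one hdet
  let v : Matrix (Fin e.n) (Fin e.n) (SmoothFun d M) := b • U.adjugate
  have hv : ∀ y, (U.det * b) y = 1 → (1 + C' * (K' y - K' x)) * v.map (evalHom y) = 1 := by
    intro y hy
    have h1 : U * v = (U.det * b) • (1 : Matrix (Fin e.n) (Fin e.n) (SmoothFun d M)) := by
      rw [Matrix.mul_smul, Matrix.mul_adjugate, smul_smul, mul_comm]
    rw [← hU, ← Matrix.map_mul, h1]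
    ext i j
    change (U.det * b) y * ((1 : Matrix (Fin e.n) (Fin e.n) (SmoothFun d M)) i j) y = _
    rw [hy, one_mul, Matrix.one_apply, Matrix.one_apply]
    split_ifs <;> rfl
  let t : Matrix (Fin e.n) (Fin e'.n) (SmoothFun d M) := v * C'.map c
  have ht : ∀ y, t.map (evalHom y) = v.map (evalHom y) * C' := by
    intro y
    rw [Matrix.map_mul, hc]
  let T : Cₛ^∞⟮𝓡 d; F', V'⟯ →ₗ[SmoothFun d M] Cₛ^∞⟮𝓡 d; F, V⟯ :=
    ∑ i, ∑ j, t i j • (e'.φ j).smulRight (e.s i)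
  have hT : ∀ y, e.f y = 1 → e'.f y = 1 → ∀ i j, e.φ i (T (e'.s j)) y = t.map (evalHom y) i j := by
    intro y hy hy' i j
    have h1 : e.φ i (T (e'.s j)) = ∑ k, ∑ l, t k l * (e'.φ l (e'.s j) * e.φ i (e.s k)) := by
      simp only [T, LinearMap.sum_apply, LinearMap.smul_apply, LinearMap.smulRight_apply, map_sum,
        map_smul, smul_eq_mul]
    rw [h1, sum_fun_apply, Finset.sum_eq_single i]
    · rw [sum_fun_apply, Finset.sum_eq_single j]
      · change t i j y * (e'.φ j (e'.s j) y * e.φ i (e.s i) y) = t i j y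
        rw [e.apply_s hy, e'.apply_s hy', if_pos rfl, if_pos rfl, one_mul, mul_one]
      · intro l _ hl
        change t i l y * (e'.φ l (e'.s j) y * e.φ i (e.s i) y) = 0
        rw [e'.apply_s hy', if_neg hl, zero_mul, mul_zero]
      · simp
    · intro k _ hk
      rw [sum_fun_apply]
      refine Finset.sum_eq_zero fun l _ => ?_
      change t k l y * (e'.φ l (e'.s j) y * e.φ i (e.s k) y) = 0
      rw [e.apply_s hy, if_neg hk.symm, mul_zero, mul_zero]
    · simp
  have hL : ∀ y, e.f y = 1 → ∀ j w, e'.φ j (L w) y = ∑ i, K' y j i * e.φ i w y := by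
    intro y hy j w
    refine (e.linear_apply hy (e'.φ j ∘ₗ L) w).trans ?_
    exact Finset.sum_congr rfl fun i _ => mul_comm _ _
  have hT' : ∀ y, e.f y = 1 → e'.f y = 1 → ∀ i w,
      e.φ i (T w) y = ∑ j, t.map (evalHom y) i j * e'.φ j w y := by
    intro y hy hy' i w
    refine (e'.linear_apply hy' (e.φ i ∘ₗ T) w).trans ?_
    refine Finset.sum_congr rfl fun j _ => ?_
    rw [LinearMap.comp_apply, hT y hy hy', mul_comm]
  refine ⟨T, ?_, fun w => ?_⟩
  · filter_upwards [hb, e.f_eq, e'.f_eq] with y h1 h2 h3 w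
    refine e'.ext_apply e h3 h2 (P := T ∘ₗ L ∘ₗ T) (Q := T) (fun i j => ?_) w
    -- The matrix t = v C' of T is an outer inverse of the matrix of L at y.
    have h4 := perturbed_inverse hC1 (hv y h1)
    rw [add_sub_cancel, ← ht] at h4
    have h5 := congrFun (congrFun h4 i) j
    rw [hT y h2 h3, ← h5, LinearMap.comp_apply, hT' y h2 h3, Matrix.mul_assoc, Matrix.mul_apply]
    refine Finset.sum_congr rfl fun k _ => ?_
    rw [LinearMap.comp_apply, hL y h2, Matrix.mul_apply]
    congr 1
    exact Finset.sum_congr rfl fun l _ => by rw [hT y h2 h3]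
  · refine e.ext_apply e' e.f_self e'.f_self (P := L ∘ₗ T ∘ₗ L) (Q := L) (fun j i => ?_) w
    -- At x itself v = 1, so T has the matrix C', which is also an inner inverse.
    have h1 : t.map (evalHom x) = C' := by
      have := hv x hb.self_of_nhds
      rw [sub_self, Matrix.mul_zero, add_zero, Matrix.one_mul] at this
      rw [ht, this, Matrix.one_mul]
    have h5 := congrFun (congrFun hC2 j) i
    rw [LinearMap.comp_apply, hL x e.f_self]
    refine Eq.trans ?_ h5
    rw [Matrix.mul_assoc, Matrix.mul_apply]
    refine Finset.sum_congr rfl fun k _ => ?_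
    rw [LinearMap.comp_apply, hT' x e.f_self e'.f_self, h1, Matrix.mul_apply]
    rfl

/-- A parallel homomorphism has an inner inverse around every point. -/
lemma exists_local_inner_inverse
    (D₁ : Cartan.Connection ℝ (SmoothFun d M) (VecField d M) Cₛ^∞⟮𝓡 d; F, V⟯)
    (D₂ : Cartan.Connection ℝ (SmoothFun d M) (VecField d M) Cₛ^∞⟮𝓡 d; F', V'⟯)
    {L : Cₛ^∞⟮𝓡 d; F, V⟯ →ₗ[SmoothFun d M] Cₛ^∞⟮𝓡 d; F', V'⟯}
    (hL : ∀ X w, D₂.nab X (L w) = L (D₁.nab X w)) (x : M) :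
    ∃ T : Cₛ^∞⟮𝓡 d; F', V'⟯ →ₗ[SmoothFun d M] Cₛ^∞⟮𝓡 d; F, V⟯,
      ∀ᶠ y in 𝓝 x, ∀ w, L (T (L w)) y = L w y := by
  obtain ⟨T, hT1, hT2⟩ := exists_local_outer_inverse L x
  refine ⟨T, ?_⟩
  obtain ⟨e⟩ := nonempty_frameAt (d := d) (F := F) (V := V) x
  obtain ⟨e'⟩ := nonempty_frameAt (d := d) (F := F') (V := V') x
  -- S vanishes at x and measures the failure of T to be an inner inverse. It satisfies a
  -- homogeneous linear differential system, so it vanishes near x. This is where the constancy of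
  -- the rank of a parallel map enters.
  let S : Cₛ^∞⟮𝓡 d; F, V⟯ →ₗ[SmoothFun d M] Cₛ^∞⟮𝓡 d; F', V'⟯ := L - L ∘ₗ T ∘ₗ L
  have hS : ∀ w, S w = L w - L (T (L w)) := fun _ => rfl
  have hS' : ∀ w, L (T (L w)) = L w - S w := fun w => by rw [hS, sub_sub_cancel]
  have main : ∀ X : VecField d M, ∀ᶠ y in 𝓝 x, ∀ w,
      D₂.nab X (S w) y = (S (D₁.nab X w) - L ((D₂.hom D₁).nab X T (S w)) -
        S ((D₂.hom D₁).nab X T (L w))) y := by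
    intro X
    set T' := (D₂.hom D₁).nab X T
    have hT' : ∀ w, T' w = D₁.nab X (T w) - T (D₂.nab X w) := fun _ => rfl
    have h1 := eventually_nab_eq_zero D₁ (s := fun w => T (L (T w)) - T w) (x := x)
      (hT1.mono fun y hy w => sub_eq_zero.2 (hy w)) X
    filter_upwards [h1, hT1] with y h2 h3 w
    -- The derivative of TLT = T near x, with L parallel. Applied to L w and composed with L, it
    -- gives L T' L = L T' S + S T' L, where T' is the covariant derivative of T; on the other hand
    -- ∇_X(S w) = S(∇_X w) - L T' L w.
    have h4 : ∀ w, T' w y = (T' (L (T w)) + T (L (T' w))) y := by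
      intro w
      have e1 := h2 w
      have e2 := h3 (D₂.nab X w)
      have e3 : T' w - (T' (L (T w)) + T (L (T' w))) =
          (T (L (T (D₂.nab X w))) - T (D₂.nab X w)) - D₁.nab X (T (L (T w)) - T w) := by
        rw [D₁.isConn.sub, hT', hT', hL, map_sub, map_sub]
        abel
      have e4 := DFunLike.congr_fun e3 y
      refine sub_eq_zero.1 (e4.trans ?_)
      change (T (L (T (D₂.nab X w))) y - T (D₂.nab X w) y) -
        D₁.nab X (T (L (T w)) - T w) y = 0
      rw [e2, e1, sub_self, sub_self]
    have h5 := section_apply_congr L (h4 (L w))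
    rw [map_add, hS', hS', map_sub, map_sub] at h5
    have h6 : D₂.nab X (S w) - (S (D₁.nab X w) - L (T' (S w)) - S (T' (L w))) =
        L (T' (L w)) - ((L (T' (L w)) - L (T' (S w))) + (L (T' (L w)) - S (T' (L w)))) := by
      have e5 : D₂.nab X (S w) = S (D₁.nab X w) - L (T' (L w)) := by
        rw [hS, D₂.isConn.sub, hL, hL, hS, hT', hL, map_sub]
        abel
      rw [e5]
      abel
    have h7 := DFunLike.congr_fun h6 y
    refine sub_eq_zero.1 (h7.trans ?_)
    exact sub_eq_zero.2 h5
  have hzero := eventually_eq_zero_of_lie_eq_sum (x := x)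
    (a := fun k : Fin e'.n × Fin e.n => e'.φ k.1 (S (e.s k.2))) (fun k => ?_) fun X => ?_
  · filter_upwards [hzero, e.f_eq, e'.f_eq] with y h1 h2 h3 w
    have h4 := e.ext_apply e' h2 h3 (P := S) (Q := 0) (fun j i => ?_) w
    · exact (sub_eq_zero.1 (h4 : (L w - L (T (L w))) y = 0)).symm
    · rw [h1 (j, i), LinearMap.zero_apply, map_zero]
      rfl
  · refine (linear_apply_congr (e'.φ k.1) (t := 0) ?_).trans (by rw [map_zero]; rfl)
    exact sub_eq_zero.2 (hT2 _).symm
  · set T' := (D₂.hom D₁).nab X T with hT'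
    -- By `main`, X(φ'_j(S s_i)) = α_j(S s_i) + φ'_j(S v_i). Expanding in the two frames expresses
    -- this through the matrix entries of S, which gives the coefficients of the system.
    let α : Fin e'.n → Cₛ^∞⟮𝓡 d; F', V'⟯ →ₗ[SmoothFun d M] SmoothFun d M := fun j =>
      (D₂.hom (funConn d M)).nab X (e'.φ j) - e'.φ j ∘ₗ L ∘ₗ T'
    let v : Fin e.n → Cₛ^∞⟮𝓡 d; F, V⟯ := fun i => D₁.nab X (e.s i) - T' (L (e.s i))
    refine ⟨fun k l => (if l.2 = k.2 then α k.1 (e'.s l.1) else 0) +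
      if l.1 = k.1 then e.φ l.2 (v k.2) else 0, ?_⟩
    rintro ⟨j, i⟩
    filter_upwards [main X, e.f_eq, e'.f_eq] with y h1 h2 h3
    have h4 : ⁅X, e'.φ j (S (e.s i))⁆ =
        (D₂.hom (funConn d M)).nab X (e'.φ j) (S (e.s i)) + e'.φ j (D₂.nab X (S (e.s i))) := by
      rw [Cartan.Connection.hom_nab, funConn_nab, sub_add_cancel]
    have h5 := linear_apply_congr (e'.φ j) (h1 (e.s i))
    have h6 := e'.linear_apply h3 (α j) (S (e.s i))
    have h7 := e.linear_apply h2 (e'.φ j ∘ₗ S) (v i)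
    have h8 : ⁅X, e'.φ j (S (e.s i))⁆ y = α j (S (e.s i)) y + e'.φ j (S (v i)) y := by
      rw [h4]
      have : (D₂.hom (funConn d M)).nab X (e'.φ j) (S (e.s i)) +
          e'.φ j (S (D₁.nab X (e.s i)) - L (T' (S (e.s i))) - S (T' (L (e.s i)))) =
          α j (S (e.s i)) + e'.φ j (S (v i)) := by
        simp only [α, v, map_sub, LinearMap.sub_apply, LinearMap.comp_apply]
        abel
      exact (congrArg (fun r : ℝ => (D₂.hom (funConn d M)).nab X (e'.φ j) (S (e.s i)) y + r)
        h5).trans (DFunLike.congr_fun this y)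
    have h9 : ∀ (p : Prop) [Decidable p] (a : SmoothFun d M),
        (if p then a else 0) y = if p then a y else 0 := by
      intro p _ a
      split_ifs <;> rfl
    rw [h8, h6]
    refine (congrArg₂ (· + ·) rfl h7).trans ?_
    rw [Fintype.sum_prod_type]
    change _ = ∑ j', ∑ i', ((if i' = i then α j (e'.s j') else 0) y +
      (if j' = j then e.φ i' (v i) else 0) y) * e'.φ j' (S (e.s i')) y
    simp only [h9, add_mul, Finset.sum_add_distrib, ite_mul, zero_mul, Finset.sum_ite_eq',
      Finset.mem_univ, if_true]
    congr 1
    · exact Finset.sum_congr rfl fun k _ => mul_comm _ _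
    · rw [Finset.sum_comm]
      simp only [Finset.sum_ite_eq', Finset.mem_univ, if_true]
      rfl

/-- A parallel homomorphism has an inner inverse. -/
lemma exists_inner_inverse [SigmaCompactSpace M]
    (D₁ : Cartan.Connection ℝ (SmoothFun d M) (VecField d M) Cₛ^∞⟮𝓡 d; F, V⟯)
    (D₂ : Cartan.Connection ℝ (SmoothFun d M) (VecField d M) Cₛ^∞⟮𝓡 d; F', V'⟯)
    {L : Cₛ^∞⟮𝓡 d; F, V⟯ →ₗ[SmoothFun d M] Cₛ^∞⟮𝓡 d; F', V'⟯}
    (hL : ∀ X w, D₂.nab X (L w) = L (D₁.nab X w)) :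
    ∃ T : Cₛ^∞⟮𝓡 d; F', V'⟯ →ₗ[SmoothFun d M] Cₛ^∞⟮𝓡 d; F, V⟯, ∀ w, L (T (L w)) = L w := by
  choose T₀ hT₀ using exists_local_inner_inverse D₁ D₂ hL
  obtain ⟨ρ, hρ⟩ := exists_partition (d := d) hT₀
  -- The condition LTL = L is affine in T, so it survives gluing by a partition of unity.
  refine ⟨glueSec ρ ∘ₗ LinearMap.pi T₀, fun w => ?_⟩
  rw [LinearMap.comp_apply, map_glueSec]
  refine (glueSec_congr ρ fun c y hy => ?_).trans (glueSec_const ρ (L w))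
  exact hρ c y hy w

end Geometry

/-! ### From a contraction in auxiliary degree zero to one of the twisted complex -/

namespace DG

universe w u₁ v₁

variable {𝕜 : Type w} [CommRing 𝕜]

namespace GradedCategory

variable {C : GradedCategory.{w, u₁, v₁} 𝕜}

lemma degCast_comp {E F G : C.Obj} {m n k k' : ℤ} (e : k = k') (h : m + n = k) (h' : m + n = k')
    (g : C.Hom F G m) (f : C.Hom E F n) : degCast e (C.comp h g f) = C.comp h' g f := by
  subst e
  rfl

lemma degCast_add {E F : C.Obj} {m n : ℤ} (e : m = n) (f g : C.Hom E F m) :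
    degCast e (f + g) = degCast e f + degCast e g := by
  subst e
  rfl

/-- The position q need not belong to the index set of the sum: if its object is zero, the term
vanishes anyway. -/
lemma seqComp_eq_single {E F G : Seq C} {m n k : ℤ} (h : m + n = k) (g : SeqHom F G m)
    (f : SeqHom E F n) (p r q : ℤ) (h0 : ∀ q', q' ≠ q → g q' r = 0 ∨ f p q' = 0) :
    seqComp h g f p r = ((r - q) * (n - (q - p))).negOnePow •
      C.comp (show m - (r - q) + (n - (q - p)) = k - (r - p) by omega) (g q r) (f p q) := by
  rw [seqComp_apply]
  refine Finset.sum_eq_single q (fun q' _ hq' => ?_) fun hq => ?_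
  · rcases h0 q' hq' with h | h
    · rw [h, map_zero, LinearMap.zero_apply, smul_zero]
    · rw [h, map_zero, smul_zero]
  · rw [Set.Finite.mem_toFinset, Set.mem_ofPred_eq, not_not] at hq
    rw [hq.to (f p q), map_zero, smul_zero]

end GradedCategory

namespace CDGCategory

open GradedCategory

variable {C : CDGCategory.{w, u₁, v₁} 𝕜}

lemma eq_zero_of_neg {E F : C.Obj} {n : ℤ} (hn : n < 0) (f : C.Hom E F n) : f = 0 :=
  (C.nonneg E F n hn).elim _ _

/-- A twisted complex is contractible as soon as its underlying complex of auxiliary degree zero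
is. -/
lemma id_mem_coboundaries_of_contraction {E : C.Tw.Obj}
    (s : ∀ p q : ℤ, C.Hom ((Tw.seq E).obj p) ((Tw.seq E).obj q) 0)
    (hs : ∀ (p q r : ℤ) (hq : q + 1 = p) (hr : p + 1 = r),
      C.comp (show 1 - (p - q) + 0 = 0 by omega) (Tw.mc E q p) (s p q) +
        C.comp (show 0 + (1 - (r - p)) = 0 by omega) (s r p) (Tw.mc E p r) =
      C.id ((Tw.seq E).obj p)) :
    C.Tw.id E ∈ C.Tw.coboundaries E E 0 := by
  let s' : SeqHom (Tw.seq E) (Tw.seq E) (-1) := fun p q =>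
    if hq : q + 1 = p then degCast (show (0 : ℤ) = -1 - (q - p) by omega) (s p q) else 0
  have hs' : ∀ p q, q + 1 ≠ p → s' p q = 0 := fun p q hq => dif_neg hq
  have hs'' : ∀ p q (hq : q + 1 = p),
      s' p q = degCast (show (0 : ℤ) = -1 - (q - p) by omega) (s p q) := fun p q hq => dif_pos hq
  -- It is enough to compare components p → q with q ≥ p. The term ∇s' lowers the position, so it
  -- does not contribute.
  refine id_mem_coboundaries_of_lower ((Tw.equivSeqHom E E (-1)).symm s') fun p q hpq => ?_
  rw [Tw.equivSeqHom_d, LinearEquiv.apply_symm_apply, Tw.equivSeqHom_id, Pi.sub_apply,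
    Pi.sub_apply, Pi.add_apply, Pi.add_apply, Pi.smul_apply, Pi.smul_apply,
    CurvedCategory.seqNabla_apply, hs' p q (by omega), map_zero, zero_add, Int.negOnePow_neg,
    Int.negOnePow_one, Units.neg_smul, one_smul, sub_neg_eq_add,
    seqComp_eq_single _ _ _ p q (p - 1) fun q' hq' => Or.inr (hs' p q' (by omega)),
    seqComp_eq_single _ _ _ p q (q + 1) fun q' hq' => Or.inl (hs' q' q (by omega)),
    hs'' p (p - 1) (by omega), hs'' (q + 1) q rfl]
  by_cases h : q = p
  · subst h
    rw [diag_self, ← hs q (q - 1) (q + 1) (by omega) rfl, degCast_add,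
      degCast_comp _ _ (by omega), degCast_comp _ _ (by omega),
      comp_degCast_right _ _ (by omega), comp_degCast_left _ _ (by omega),
      show (q - (q - 1)) * (-1 - (q - 1 - q)) = 0 by ring,
      show (q - (q + 1)) * (1 - (q + 1 - q)) = 0 by ring, Int.negOnePow_zero, one_smul, one_smul]
  -- For q > p the components of 𝔼 involved would raise the position by at least two, so their
  -- auxiliary degree is negative.
  · rw [diag_ne _ (Ne.symm h), eq_zero_of_neg (show 1 - (q - (p - 1)) < 0 by omega) (Tw.mc E (p - 1) q),
      eq_zero_of_neg (show 1 - (q + 1 - p) < 0 by omega) (Tw.mc E p (q + 1))]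
    simp

end CDGCategory

end DG

/-! ### Forms of degree zero and evaluation of morphisms on vector fields -/

namespace Cartan

section Eval

variable {𝕜 A L W W' : Type*} [CommRing 𝕜] [CommRing A] [Algebra 𝕜 A] [LieRing L]
  [Module A L] [AddCommGroup W] [Module A W] [Module 𝕜 W] [IsScalarTower 𝕜 A W]
  [AddCommGroup W'] [Module A W'] [Module 𝕜 W'] [IsScalarTower 𝕜 A W']

variable (A) in
/-- A homomorphism as a form of degree zero. -/
def zeroForm (f : W →ₗ[A] W') : Omega 𝕜 A L (W →ₗ[A] W') 0 :=
  mapCoeff (compHom A W W W' f) (idForm 𝕜 A L W)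

lemma ev_zeroForm (f : W →ₗ[A] W') : (zeroForm (𝕜 := 𝕜) (L := L) A f).1.ev [] = f := rfl

lemma Omega.ext_nil {f g : Omega 𝕜 A L W 0} (h : f.1.ev [] = g.1.ev []) : f = g := by
  refine Omega.ext_ev (funext fun v => ?_)
  match v with
  | [] => exact h
  | X :: v =>
    have h0 : ((X :: v).length : ℤ) ≠ 0 := by
      rw [List.length_cons]
      omega
    rw [omega_conc f _ h0, omega_conc g _ h0]

end Eval

end Cartan

namespace Geometry

open DG GradedCategory

variable {d : ℕ} {M : Type u} [TopologicalSpace M] [ChartedSpace (EuclideanSpace ℝ (Fin d)) M]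
  [IsManifold (𝓡 d) ∞ M]

section Eval

variable {h : ClosedForm d M 2}

/-- The sections of an object of `PPre h`. -/
abbrev PPre_sections (E : (PPre.{u, v} h).Obj) : Type (max u v) := (PPre_conn E).bundle.Sections

/-- Evaluation of a morphism of `PPre h` on a list of vector fields. -/
def PPre_ev {E F : (PPre.{u, v} h).Obj} {n : ℤ} (l : List (VecField d M)) :
    (PPre.{u, v} h).Hom E F n →ₗ[ℝ]
      (PPre_sections E →ₗ[SmoothFun d M] PPre_sections F) where
  toFun f := (PPre_equiv E F n f).1.ev l
  map_add' f g := by rw [map_add, Cartan.Omega.ev_add]; rfl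
  map_smul' c f := by rw [map_smul, Cartan.Omega.ev_smul]; rfl

lemma PPre_ev_apply {E F : (PPre.{u, v} h).Obj} {n : ℤ} (l : List (VecField d M))
    (f : (PPre.{u, v} h).Hom E F n) : PPre_ev l f = (PPre_equiv E F n f).1.ev l := rfl

lemma PPre_ev_eq_zero {E F : (PPre.{u, v} h).Obj} {n : ℤ} (l : List (VecField d M))
    (hl : (l.length : ℤ) ≠ n) (f : (PPre.{u, v} h).Hom E F n) : PPre_ev l f = 0 :=
  Cartan.omega_conc (PPre_equiv E F n f) l hl

lemma PPre_ev_comp {E F G : (PPre.{u, v} h).Obj} {m n k : ℤ} (hk : m + n = k)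
    (g : (PPre.{u, v} h).Hom F G m) (f : (PPre.{u, v} h).Hom E F n) (l : List (VecField d M)) :
    PPre_ev l ((PPre.{u, v} h).comp hk g f) = Cartan.rawWedge (Cartan.toAdd
      (Cartan.compHom (SmoothFun d M) (PPre_sections E) (PPre_sections F) (PPre_sections G)))
      (PPre_equiv F G m g).1.ev (PPre_equiv E F n f).1.ev l :=
  congrFun (Cartan.ev_wedge (Cartan.compHom (SmoothFun d M) (PPre_sections E) (PPre_sections F)
    (PPre_sections G)) hk (PPre_equiv F G m g) (PPre_equiv E F n f)) l

lemma PPre_ev_comp_nil {E F G : (PPre.{u, v} h).Obj} {m n k : ℤ} (hk : m + n = k)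
    (g : (PPre.{u, v} h).Hom F G m) (f : (PPre.{u, v} h).Hom E F n) :
    PPre_ev [] ((PPre.{u, v} h).comp hk g f) = PPre_ev [] g ∘ₗ PPre_ev [] f :=
  PPre_ev_comp hk g f []

lemma PPre_ev_comp_two {E F G : (PPre.{u, v} h).Obj} {m n k : ℤ} (hk : m + n = k)
    (g : (PPre.{u, v} h).Hom F G m) (f : (PPre.{u, v} h).Hom E F n) (X Y : VecField d M) :
    PPre_ev [X, Y] ((PPre.{u, v} h).comp hk g f) =
      PPre_ev [X, Y] g ∘ₗ PPre_ev [] f + PPre_ev [X] g ∘ₗ PPre_ev [Y] f +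
        (-(PPre_ev [Y] g ∘ₗ PPre_ev [X] f) + PPre_ev [] g ∘ₗ PPre_ev [X, Y] f) := by
  rw [PPre_ev_comp]
  simp only [Cartan.rawWedge, Cartan.rawIota, Cartan.rawSign, List.length_nil, List.length_cons,
    pow_zero, one_smul, zero_add, pow_one, neg_smul, map_neg, AddMonoidHom.neg_apply]
  rfl

lemma PPre_ev_nabla_one {E F : (PPre.{u, v} h).Obj} {m n : ℤ} (hm : m + 1 = n)
    (f : (PPre.{u, v} h).Hom E F m) (X : VecField d M) :
    PPre_ev [X] ((PPre.{u, v} h).nabla hm f) =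
      ((PPre_conn E).conn.hom (PPre_conn F).conn).nab X (PPre_ev [] f) := by
  refine (congrFun (Cartan.Connection.ev_d ((PPre_conn E).conn.hom (PPre_conn F).conn) hm
    (PPre_equiv E F m f)) [X]).trans ?_
  simp only [Cartan.rawD, Cartan.rawLie, sub_zero]
  rfl

lemma PPre_ev_nabla_nil {E F : (PPre.{u, v} h).Obj} {m n : ℤ} (hm : m + 1 = n)
    (f : (PPre.{u, v} h).Hom E F m) : PPre_ev [] ((PPre.{u, v} h).nabla hm f) = 0 :=
  congrFun (Cartan.Connection.ev_d ((PPre_conn E).conn.hom (PPre_conn F).conn) hm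
    (PPre_equiv E F m f)) []

lemma PPre_ev_curv_two (E : (PPre.{u, v} h).Obj) (X Y : VecField d M) :
    PPre_ev [X, Y] ((PPre.{u, v} h).curv E) =
      (PPre_conn E).conn.curvEnd X Y - h.1.1.ev [X, Y] • LinearMap.id := by
  have h1 : PPre_equiv E E 2 ((PPre.{u, v} h).curv E) =
      (PPre_conn E).conn.curv - Cartan.scalarForm (PPre_sections E) h.1 := PPre_curv h (PPre_conn E)
  rw [PPre_ev_apply, h1, Cartan.Omega.ev_sub, Pi.sub_apply, Cartan.Connection.ev_curv]
  rfl

lemma PPre_ev_id (E : (PPre.{u, v} h).Obj) : PPre_ev [] ((PPre.{u, v} h).id E) = LinearMap.id :=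
  congrArg (fun f : HomForm (PPre_conn E).bundle (PPre_conn E).bundle 0 => f.1.ev [])
    (PPre_id h (PPre_conn E))

lemma PPre_ext_nil {E F : (PPre.{u, v} h).Obj} {f g : (PPre.{u, v} h).Hom E F 0}
    (hfg : PPre_ev [] f = PPre_ev [] g) : f = g :=
  (PPre_equiv E F 0).injective (Cartan.Omega.ext_nil hfg)

lemma PPre_ev_degCast {E F : (PPre.{u, v} h).Obj} {m n : ℤ} (e : m = n)
    (f : (PPre.{u, v} h).Hom E F m) (l : List (VecField d M)) :
    PPre_ev l (degCast e f) = PPre_ev l f := by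
  subst e
  rfl

/-- A homomorphism of sections as a morphism of degree zero. -/
def PPre_zeroForm {E F : (PPre.{u, v} h).Obj}
    (f : PPre_sections E →ₗ[SmoothFun d M] PPre_sections F) : (PPre.{u, v} h).Hom E F 0 :=
  (PPre_equiv E F 0).symm (Cartan.zeroForm (SmoothFun d M) f)

lemma PPre_ev_zeroForm {E F : (PPre.{u, v} h).Obj}
    (f : PPre_sections E →ₗ[SmoothFun d M] PPre_sections F) : PPre_ev [] (PPre_zeroForm f) = f := by
  rw [PPre_ev_apply, PPre_zeroForm, LinearEquiv.apply_symm_apply, Cartan.ev_zeroForm]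

end Eval

/-! ### The Maurer-Cartan equation in auxiliary degrees zero, one and two -/

section Twisted

variable {h : ClosedForm d M 2} (E : (PPre.{u, v} h).Tw.Obj)

/-- The sections of the components of a twisted complex. -/
abbrev Tw_sections (p : ℤ) : Type (max u v) := PPre_sections ((CDGCategory.Tw.seq E).obj p)

/-- The connections on the components of a twisted complex. -/
abbrev Tw_conn (p : ℤ) :
    Cartan.Connection ℝ (SmoothFun d M) (VecField d M) (Tw_sections E p) :=
  (PPre_conn ((CDGCategory.Tw.seq E).obj p)).conn

/-- The part of auxiliary degree zero of the endomorphism of a twisted complex. -/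
def Tw_diff (p q : ℤ) : Tw_sections E p →ₗ[SmoothFun d M] Tw_sections E q :=
  PPre_ev [] (CDGCategory.Tw.mc E p q)

lemma Tw_mc_eq_apply (p r : ℤ) (l : List (VecField d M)) :
    PPre_ev l ((PPre.{u, v} h).nabla (show 1 - (r - p) + 1 = 2 - (r - p) by omega)
      (CDGCategory.Tw.mc E p r)) +
    PPre_ev l (seqComp (show (1 : ℤ) + 1 = 2 by norm_num) (CDGCategory.Tw.mc E)
      (CDGCategory.Tw.mc E) p r) +
    PPre_ev l (diag (fun p => (PPre.{u, v} h).curv ((CDGCategory.Tw.seq E).obj p)) p r) = 0 := by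
  have h1 := congrFun (congrFun (CDGCategory.Tw.mc_eq E) p) r
  have h2 := congrArg (PPre_ev l) h1
  rw [Pi.add_apply, Pi.add_apply, Pi.add_apply, Pi.add_apply, map_add, map_add] at h2
  exact h2.trans (map_zero _)

/-- A component raising the position by more than one has negative auxiliary degree; the diagonal
vanishes by definition. -/
lemma Tw_mc_eq_zero {p q : ℤ} (hpq : ¬ q ≤ p + 1 ∨ q = p) : CDGCategory.Tw.mc E p q = 0 := by
  rcases hpq with hpq | rfl
  · exact CDGCategory.eq_zero_of_neg (by omega) _
  · exact CDGCategory.Tw.mc_self E q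

/-- The component p → p + 2 of the equation: the only path of two nonzero components goes through p
+ 1, and curvature is diagonal. -/
lemma Tw_diff_comp (p q r : ℤ) (hq : p + 1 = q) (hr : q + 1 = r) :
    Tw_diff E q r ∘ₗ Tw_diff E p q = 0 := by
  have h1 := Tw_mc_eq_apply E p r []
  rw [PPre_ev_nabla_nil, diag_ne _ (by omega), map_zero, add_zero, zero_add,
    seqComp_eq_single _ _ _ p r q fun q' hq' => by
      by_cases h2 : q' ≤ p + 1 ∧ q' ≠ p
      · exact Or.inl (Tw_mc_eq_zero E (by omega))
      · exact Or.inr (Tw_mc_eq_zero E (by omega)),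
    smul_map_unit, PPre_ev_comp_nil, show (r - q) * (1 - (q - p)) = 0 by subst hq; ring,
    Int.negOnePow_zero, one_smul] at h1
  exact h1

/-- The component p → p + 1 of the equation: a path of two components would have to contain a
diagonal one, so only the covariant derivative remains. -/
lemma Tw_diff_parallel (p q : ℤ) (hq : p + 1 = q) (X : VecField d M) (w : Tw_sections E p) :
    (Tw_conn E q).nab X (Tw_diff E p q w) = Tw_diff E p q ((Tw_conn E p).nab X w) := by
  have h1 := Tw_mc_eq_apply E p q [X]
  -- No intermediate position q' is possible: q' ≤ p + 1 and p + 1 ≤ q' + 1 leave p and p + 1, and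
  -- both make one component diagonal.
  have h2 : seqComp (show (1 : ℤ) + 1 = 2 by norm_num) (CDGCategory.Tw.mc E)
      (CDGCategory.Tw.mc E) p q = 0 := by
    rw [seqComp_apply]
    refine Finset.sum_eq_zero fun q' _ => ?_
    by_cases h2 : q' ≤ p + 1 ∧ q' ≠ p
    · rw [Tw_mc_eq_zero E (p := q') (q := q) (by omega), map_zero, LinearMap.zero_apply, smul_zero]
    · rw [Tw_mc_eq_zero E (p := p) (q := q') (by omega), map_zero, smul_zero]
  rw [PPre_ev_nabla_one, h2, diag_ne _ (by omega), map_zero, add_zero, add_zero] at h1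
  exact sub_eq_zero.1 (LinearMap.congr_fun h1 w)

/-- The diagonal component at q of the equation: the only paths from q to itself pass through q - 1
or q + 1. Each combines D with a component of auxiliary degree two, so on cohomology the curvature
is the scalar h. -/
lemma Tw_curvEnd (p q r : ℤ) (hq : p + 1 = q) (hr : q + 1 = r) (X Y : VecField d M) :
    ∃ (U : Tw_sections E q →ₗ[SmoothFun d M] Tw_sections E p)
      (V : Tw_sections E r →ₗ[SmoothFun d M] Tw_sections E q),
      (Tw_conn E q).curvEnd X Y = h.1.1.ev [X, Y] • LinearMap.id + Tw_diff E p q ∘ₗ U +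
        V ∘ₗ Tw_diff E q r := by
  have h1 := Tw_mc_eq_apply E q q [X, Y]
  have h2 : ∀ t, ∃ (U : Tw_sections E q →ₗ[SmoothFun d M] Tw_sections E p)
      (V : Tw_sections E r →ₗ[SmoothFun d M] Tw_sections E q),
      PPre_ev [X, Y] (((q - t) * (1 - (t - q))).negOnePow •
        (PPre.{u, v} h).comp (show 1 - (q - t) + (1 - (t - q)) = 2 - (q - q) by omega)
          (CDGCategory.Tw.mc E t q) (CDGCategory.Tw.mc E q t)) =
        Tw_diff E p q ∘ₗ U + V ∘ₗ Tw_diff E q r := by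
    -- Each summand is brought to the desired form separately, with zero maps if t is neither p nor
    -- r; then no distinction is needed as to which positions occur in the sum.
    intro t
    by_cases ht1 : t = p
    · subst ht1
      refine ⟨((q - t) * (1 - (t - q))).negOnePow • PPre_ev [X, Y] (CDGCategory.Tw.mc E q t), 0, ?_⟩
      rw [smul_map_unit, PPre_ev_comp_two,
        PPre_ev_eq_zero [X, Y] (by simp; omega) (CDGCategory.Tw.mc E t q),
        PPre_ev_eq_zero [X] (by simp; omega) (CDGCategory.Tw.mc E t q),
        PPre_ev_eq_zero [Y] (by simp; omega) (CDGCategory.Tw.mc E t q)]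
      simp only [LinearMap.zero_comp, neg_zero, zero_add, add_zero, Units.smul_def,
        LinearMap.comp_smul]
      rfl
    by_cases ht2 : t = r
    · subst ht2
      refine ⟨0, ((q - t) * (1 - (t - q))).negOnePow • PPre_ev [X, Y] (CDGCategory.Tw.mc E t q), ?_⟩
      rw [smul_map_unit, PPre_ev_comp_two,
        PPre_ev_eq_zero [X, Y] (by simp; omega) (CDGCategory.Tw.mc E q t),
        PPre_ev_eq_zero [X] (by simp; omega) (CDGCategory.Tw.mc E q t),
        PPre_ev_eq_zero [Y] (by simp; omega) (CDGCategory.Tw.mc E q t)]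
      simp only [LinearMap.comp_zero, neg_zero, zero_add, add_zero, Units.smul_def,
        LinearMap.smul_comp]
      rfl
    · refine ⟨0, 0, ?_⟩
      rw [LinearMap.comp_zero, LinearMap.zero_comp, add_zero]
      by_cases h3 : t ≤ q + 1 ∧ t ≠ q
      · rw [Tw_mc_eq_zero E (p := t) (q := q) (by omega), map_zero, LinearMap.zero_apply, smul_zero,
          map_zero]
      · rw [Tw_mc_eq_zero E (p := q) (q := t) (by omega), map_zero, smul_zero, map_zero]
  choose U V hUV using h2
  refine ⟨-∑ t ∈ (CDGCategory.Tw.seq E).finite.toFinset, U t,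
    -∑ t ∈ (CDGCategory.Tw.seq E).finite.toFinset, V t, ?_⟩
  rw [seqComp_apply, map_sum, Finset.sum_congr rfl fun t _ => hUV t, Finset.sum_add_distrib,
    Tw_mc_eq_zero E (Or.inr rfl), map_zero, map_zero, zero_add, diag_self, PPre_ev_degCast,
    PPre_ev_curv_two] at h1
  refine LinearMap.ext fun w => ?_
  have h3 := LinearMap.congr_fun h1 w
  simp only [LinearMap.add_apply, LinearMap.sub_apply, LinearMap.zero_apply, LinearMap.sum_apply,
    LinearMap.comp_apply, LinearMap.neg_apply, map_neg, map_sum] at h3 ⊢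
  rw [← sub_eq_zero, ← h3]
  abel

end Twisted

end Geometry

/-! ### The cohomology of a split complex as the range of an idempotent -/

namespace Cartan

section Splitting

variable {𝕜 A L W₀ W W₂ : Type*} [CommRing 𝕜] [CommRing A] [Algebra 𝕜 A] [LieRing L]
  [LieAlgebra 𝕜 L] [Module A L] [IsScalarTower 𝕜 A L] [LieRingModule L A] [LieRinehartRing A L]
  [AddCommGroup W₀] [Module A W₀] [AddCommGroup W] [Module A W] [Module 𝕜 W]
  [IsScalarTower 𝕜 A W] [AddCommGroup W₂] [Module A W₂] [Module 𝕜 W₀] [IsScalarTower 𝕜 A W₀]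
  [Module 𝕜 W₂] [IsScalarTower 𝕜 A W₂]

/-- The projection onto the cohomology of a complex split by inner inverses. -/
def cohomProj (D' : W₀ →ₗ[A] W) (T' : W →ₗ[A] W₀) (D : W →ₗ[A] W₂) (T : W₂ →ₗ[A] W) :
    W →ₗ[A] W :=
  (LinearMap.id - D' ∘ₗ T') ∘ₗ (LinearMap.id - T ∘ₗ D)

variable {D' : W₀ →ₗ[A] W} {T' : W →ₗ[A] W₀} {D : W →ₗ[A] W₂} {T : W₂ →ₗ[A] W}

lemma cohomProj_apply (w : W) :
    cohomProj D' T' D T w = w - T (D w) - (D' (T' w) - D' (T' (T (D w)))) := by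
  simp [cohomProj]

lemma comp_cohomProj (hD : ∀ w, D (D' w) = 0) (hT : ∀ w, D (T (D w)) = D w) (w : W) :
    D (cohomProj D' T' D T w) = 0 := by
  simp [cohomProj_apply, hD, hT]

/-- The factor id - T D fixes the image of D', and id - D' T' kills it. -/
lemma cohomProj_comp (hD : ∀ w, D (D' w) = 0) (hT' : ∀ w, D' (T' (D' w)) = D' w) (w : W₀) :
    cohomProj D' T' D T (D' w) = 0 := by
  simp [cohomProj_apply, hD, hT']

lemma cohomProj_of_ker {w : W} (hw : D w = 0) :
    cohomProj D' T' D T w = w - D' (T' w) := by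
  simp [cohomProj_apply, hw]

lemma cohomProj_idempotent (hD : ∀ w, D (D' w) = 0) (hT' : ∀ w, D' (T' (D' w)) = D' w)
    (hT : ∀ w, D (T (D w)) = D w) (w : W) :
    cohomProj D' T' D T (cohomProj D' T' D T w) = cohomProj D' T' D T w := by
  rw [cohomProj_of_ker (comp_cohomProj hD hT w), cohomProj_apply]
  simp [hT']

/-- Parallel maps let the connection descend to cohomology, and its curvature there is induced by
that of C. The projection kills D' U, and V D vanishes on the kernel of D, so c remains. -/
lemma curvature_cohomProj (hD : ∀ w, D (D' w) = 0) (hT' : ∀ w, D' (T' (D' w)) = D' w)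
    (hT : ∀ w, D (T (D w)) = D w) (C₀ : Connection 𝕜 A L W₀) (C : Connection 𝕜 A L W)
    (C₂ : Connection 𝕜 A L W₂) (hC' : ∀ X w, C.nab X (D' w) = D' (C₀.nab X w))
    (hC : ∀ X w, C₂.nab X (D w) = D (C.nab X w)) {X Y : L} {c : A} {U : W →ₗ[A] W₀}
    {V : W₂ →ₗ[A] W} (hcurv : C.curvEnd X Y = c • LinearMap.id + D' ∘ₗ U + V ∘ₗ D) {w : W}
    (hw : cohomProj D' T' D T w = w) :
    cohomProj D' T' D T (C.nab X (cohomProj D' T' D T (C.nab Y w))) -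
      cohomProj D' T' D T (C.nab Y (cohomProj D' T' D T (C.nab X w))) -
      cohomProj D' T' D T (C.nab ⁅X, Y⁆ w) = c • w := by
  have hw0 : D w = 0 := by rw [← hw, comp_cohomProj hD hT]
  -- Since C.nab Y w lies in the kernel of D, the inner projection changes it by an element of the
  -- image of D'. The derivative stays in that image, and the outer projection kills it.
  have h1 : ∀ X Y, cohomProj D' T' D T (C.nab X (cohomProj D' T' D T (C.nab Y w))) =
      cohomProj D' T' D T (C.nab X (C.nab Y w)) := fun X Y => by
    rw [cohomProj_of_ker (w := C.nab Y w) (by rw [← hC, hw0, C₂.nab_zero]), C.isConn.sub, hC',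
      map_sub, cohomProj_comp hD hT', sub_zero]
  rw [h1, h1, ← map_sub, ← map_sub, ← Connection.curvEnd_apply, hcurv]
  simp [cohomProj_comp hD hT', hw0, hw]

end Splitting

end Cartan

/-! ### Contractibility of twisted complexes for a non-exact two-form -/

namespace Geometry

open DG GradedCategory

variable {d : ℕ} {M : Type u} [TopologicalSpace M] [ChartedSpace (EuclideanSpace ℝ (Fin d)) M]
  [IsManifold (𝓡 d) ∞ M]

lemma deRhamClass_eq_zero_of_extD_eq {h : ClosedForm d M 2} (α : DiffForm d M 1)
    (hα : Cartan.extD ℝ (SmoothFun d M) (VecField d M) one_add_one_eq_two α = h.1) :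
    deRhamClass h = 0 :=
  (Submodule.Quotient.mk_eq_zero _).2 ⟨α, hα⟩

variable [T2Space M] {h : ClosedForm d M 2} (E : (PPre.{u, v} h).Tw.Obj)

lemma exists_Tw_inner_inverse [SigmaCompactSpace M] (p q : ℤ) (hq : p + 1 = q) :
    ∃ T : Tw_sections E q →ₗ[SmoothFun d M] Tw_sections E p,
      ∀ w, Tw_diff E p q (T (Tw_diff E p q w)) = Tw_diff E p q w :=
  exists_inner_inverse (Tw_conn E p) (Tw_conn E q) (Tw_diff_parallel E p q hq)

/-- Otherwise the compressed connection on the range of this nonzero idempotent would have curvature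
h·id, making h exact. -/
lemma Tw_cohomProj_eq_zero [SigmaCompactSpace M] [PreconnectedSpace M] (hh : deRhamClass h ≠ 0)
    {p q r : ℤ} (hq : p + 1 = q) (hr : q + 1 = r)
    {T' : Tw_sections E q →ₗ[SmoothFun d M] Tw_sections E p}
    (hT' : ∀ w, Tw_diff E p q (T' (Tw_diff E p q w)) = Tw_diff E p q w)
    {T : Tw_sections E r →ₗ[SmoothFun d M] Tw_sections E q}
    (hT : ∀ w, Tw_diff E q r (T (Tw_diff E q r w)) = Tw_diff E q r w) :
    Cartan.cohomProj (Tw_diff E p q) T' (Tw_diff E q r) T = 0 := by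
  have hD : ∀ w, Tw_diff E q r (Tw_diff E p q w) = 0 :=
    LinearMap.congr_fun (Tw_diff_comp E p q r hq hr)
  by_contra hne
  obtain ⟨α, hα⟩ := exists_extD_eq_of_idempotent (Cartan.cohomProj_idempotent hD hT' hT) hne
    (Tw_conn E q) h.1 fun X Y w hw => by
      obtain ⟨U, V, hUV⟩ := Tw_curvEnd E p q r hq hr X Y
      exact Cartan.curvature_cohomProj hD hT' hT (Tw_conn E p) (Tw_conn E q) (Tw_conn E r)
        (Tw_diff_parallel E p q hq) (Tw_diff_parallel E q r hr) hUV hw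
  exact hh (deRhamClass_eq_zero_of_extD_eq α hα)

lemma Tw_id_mem_coboundaries [SigmaCompactSpace M] [PreconnectedSpace M]
    (hh : deRhamClass h ≠ 0) :
    (PPre.{u, v} h).Tw.id E ∈ (PPre.{u, v} h).Tw.coboundaries E E 0 := by
  have hex : ∀ p q : ℤ, ∃ T : Tw_sections E q →ₗ[SmoothFun d M] Tw_sections E p, p + 1 = q →
      ∀ w, Tw_diff E p q (T (Tw_diff E p q w)) = Tw_diff E p q w := fun p q => by
    by_cases hq : p + 1 = q
    · obtain ⟨T, hT⟩ := exists_Tw_inner_inverse E p q hq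
      exact ⟨T, fun _ => hT⟩
    · exact ⟨0, fun hq' => absurd hq' hq⟩
  choose T hT using hex
  -- The contraction is s = (id - D T) T. Vanishing of the projection reads id = D T + T D - D T T
  -- D, and this is D s + s D because D² = 0.
  refine CDGCategory.id_mem_coboundaries_of_contraction (fun p q => PPre_zeroForm
    (T q p - Tw_diff E (q - 1) q ∘ₗ T (q - 1) q ∘ₗ T q p)) fun p q r hq hr => PPre_ext_nil ?_
  obtain rfl : p - 1 = q := by omega
  have h0 := Tw_cohomProj_eq_zero E hh hq hr (hT _ _ hq) (hT _ _ hr)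
  have hD : ∀ w, Tw_diff E (p - 1) p (Tw_diff E (p - 1 - 1) (p - 1) w) = 0 :=
    LinearMap.congr_fun (Tw_diff_comp E _ _ _ (by omega) hq)
  rw [map_add, PPre_ev_comp_nil, PPre_ev_comp_nil, PPre_ev_zeroForm, PPre_ev_zeroForm, PPre_ev_id]
  change Tw_diff E (p - 1) p ∘ₗ _ + _ ∘ₗ Tw_diff E p r = _
  refine LinearMap.ext fun w => ?_
  have h1 := LinearMap.congr_fun h0 w
  rw [Cartan.cohomProj_apply, LinearMap.zero_apply, sub_sub, sub_eq_zero] at h1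
  simp only [LinearMap.add_apply, LinearMap.comp_apply, LinearMap.sub_apply, map_sub, hD, sub_zero,
    LinearMap.id_apply]
  refine Eq.trans ?_ h1.symm
  abel

end Geometry

end

theorem mainTheorem7 {d : ℕ} {M : Type u} [TopologicalSpace M]
    [ChartedSpace (EuclideanSpace ℝ (Fin d)) M] [IsManifold (𝓡 d) ∞ M]
    [T2Space M] [SecondCountableTopology M] [ConnectedSpace M]
    (h : Geometry.ClosedForm d M 2) :
    (Geometry.deRhamClass h = 0 →
      DG.QuasiEquivalent (Geometry.PInfty.{u, v} h)
        (Geometry.PInfty.{u, v} (0 : Geometry.ClosedForm d M 2))) ∧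
    (Geometry.deRhamClass h ≠ 0 →
      DG.QuasiEquivalent (Geometry.PInfty.{u, v} h) (DG.zeroCategory ℝ)) := by
  -- Together with second countability, local compactness gives the σ-compactness required for
  -- partitions of unity.
  have := ChartedSpace.locallyCompactSpace (EuclideanSpace ℝ (Fin d)) M
  refine ⟨Geometry.quasiEquivalent_of_deRhamClass_eq_zero h, fun hh => ?_⟩
  obtain ⟨E₀⟩ := DG.CDGCategory.nonempty_twistedComplex (Geometry.PPre.{u, v} h)
  exact DG.QuasiEquivalent.zeroCategory E₀ fun E => Geometry.Tw_id_mem_coboundaries E hh
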